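/- Let $\omega=e^{i\pi/4}$, let $\mathbb{D}=\mathbb{Z}[\frac12]$ be the ring of dyadic fractions, and let $\mathbb{D}[\omega]=\{a\omega^3+b\omega^2+c\omega+d : a,b,c,d\in\mathbb{D}\}=\mathbb{Z}[\frac1{\sqrt2},i]$. Let $U_4(\mathbb{D}[\omega])$ be the group of unitary $4\times4$ matrices with entries in $\mathbb{D}[\omega]$. For $1\le j<k\le 4$ let $X_{[j,k]}$ and $H_{[j,k]}$ be the $4\times 4$ matrices that act as $$X=\begin{bmatrix}0&1\\1&0\end{bmatrix},\qquad H=\frac1{\sqrt2}\begin{bmatrix}1&1\\1&-1\end{bmatrix}$$ on the rows and columns $j,k$ and as the identity elsewhere, and for $1\le j\le 4$ let $\omega_{[j]}$ be the diagonal matrix with $j$-th diagonal entry $\omega$ and all other diagonal entries $1$. A word is a finite sequence of these generators, treated as formal symbols; $\epsilon$ is the empty word, and a word $G_q\cdots G_1$ denotes the matrix product $G_q\cdot\ldots\cdot G_1$ (the empty word denotes the identity). Write $\vec G\sim\vec H$ if $\vec G$ and $\vec H$ denote the same matrix. Let $\approx$ be the smallest congruence relation on words (equivalence relation compatible with concatenation)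 that satisfies the following equations, for all $j,k,\ell,t\in\{1,2,3,4\}$ subject to the stated conditions: 1. $\omega_{[j]}^8\approx\epsilon$ 2. $H_{[j,k]}^2\approx\epsilon$ ($j<k$) 3. $X_{[j,k]}^2\approx\epsilon$ ($j<k$) 4. $\omega_{[j]}\omega_{[k]}\approx\omega_{[k]}\omega_{[j]}$ ($j\ne k$) 5. $\omega_{[\ell]}H_{[j,k]}\approx H_{[j,k]}\omega_{[\ell]}$ ($j<k$, $\ell\ne j,k$) 6. $\omega_{[\ell]}X_{[j,k]}\approx X_{[j,k]}\omega_{[\ell]}$ ($j<k$, $\ell\ne j,k$) 7. $H_{[j,k]}H_{[\ell,t]}\approx H_{[\ell,t]}H_{[j,k]}$ ($j<k$, $\ell<t$, $\{\ell,t\}\cap\{j,k\}=\emptyset$) 8. $H_{[j,k]}X_{[\ell,t]}\approx X_{[\ell,t]}H_{[j,k]}$ ($j<k$, $\ell<t$, $\{\ell,t\}\cap\{j,k\}=\emptyset$) 9. $X_{[j,k]}X_{[\ell,t]}\approx X_{[\ell,t]}X_{[j,k]}$ ($j<k$, $\ell<t$, $\{\ell,t\}\cap\{j,k\}=\emptyset$)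 10. $X_{[j,k]}\omega_{[k]}\approx\omega_{[j]}X_{[j,k]}$ ($j<k$) 11. $X_{[j,k]}\omega_{[j]}\approx\omega_{[k]}X_{[j,k]}$ ($j<k$) 12. $X_{[j,k]}X_{[j,\ell]}\approx X_{[k,\ell]}X_{[j,k]}$ ($j<k<\ell$) 13. $X_{[j,k]}X_{[\ell,j]}\approx X_{[\ell,k]}X_{[j,k]}$ ($\ell<j<k$) 14. $X_{[j,k]}H_{[j,\ell]}\approx H_{[k,\ell]}X_{[j,k]}$ ($j<k<\ell$) 15. $X_{[j,k]}H_{[\ell,j]}\approx H_{[\ell,k]}X_{[j,k]}$ ($\ell<j<k$) 16. $\omega_{[j]}\omega_{[k]}X_{[j,k]}\approx X_{[j,k]}\omega_{[j]}\omega_{[k]}$ ($j<k$) 17. $\omega_{[j]}\omega_{[k]}H_{[j,k]}\approx H_{[j,k]}\omega_{[j]}\omega_{[k]}$ ($j<k$) 18. $H_{[j,k]}X_{[j,k]}\approx\omega_{[k]}^4H_{[j,k]}$ ($j<k$) 19. $H_{[j,k]}\omega_{[j]}^2H_{[j,k]}\approx\omega_{[j]}^6H_{[j,k]}\omega_{[j]}^3\omega_{[k]}^5$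 ($j<k$) 20. $H_{[j,k]}H_{[\ell,t]}H_{[j,\ell]}H_{[k,t]}\approx H_{[j,\ell]}H_{[k,t]}H_{[j,k]}H_{[\ell,t]}$ ($j<k<\ell<t$) Then for all words $\vec G,\vec H$, we have $\vec G\approx\vec H$ if and only if $\vec G\sim\vec H$. Moreover, the matrices denoted by words are exactly the elements of $U_4(\mathbb{D}[\omega])$. Hence these generators and relations are a presentation of the group $U_4(\mathbb{D}[\omega])$: the group presented by the symbols $X_{[j,k]},H_{[j,k]},\omega_{[j]}$ and the relations 1–20 is isomorphic to $U_4(\mathbb{D}[\omega])$ by an isomorphism that sends each symbol to the matrix it denotes. -/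

import Mathlib

noncomputable section

namespace CliffordT

/-- The primitive eighth root of unity `ω = e^{iπ/4}`. -/
def omega : ℂ := Complex.exp (Complex.I * (Real.pi : ℂ) / 4)

theorem omega_eq : omega = (1 + Complex.I) / ((√2 : ℝ) : ℂ) := by
  have h2 : ((√2 : ℝ) : ℂ) * ((√2 : ℝ) : ℂ) = 2 := by
    rw [← Complex.ofReal_mul, Real.mul_self_sqrt (by norm_num)]; norm_num
  have hne : ((√2 : ℝ) : ℂ) ≠ 0 := by
    intro h; rw [h] at h2; norm_num at h2
  have h : omega = Complex.exp (((Real.pi / 4 : ℝ) : ℂ) * Complex.I) := by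
    unfold omega; congr 1; push_cast; ring
  rw [h, Complex.exp_mul_I, ← Complex.ofReal_cos, ← Complex.ofReal_sin,
    Real.cos_pi_div_four, Real.sin_pi_div_four, eq_div_iff hne]
  push_cast
  linear_combination ((1 + Complex.I) / 2) * h2

theorem omega_sq : omega ^ 2 = Complex.I := by
  have h : omega ^ 2 = Complex.exp ((Real.pi : ℂ) / 2 * Complex.I) := by
    unfold omega
    rw [← Complex.exp_nat_mul]
    congr 1; push_cast; ring
  rw [h, Complex.exp_pi_div_two_mul_I]

theorem omega_pow_four : omega ^ 4 = -1 := by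
  rw [show (4 : ℕ) = 2 * 2 from rfl, pow_mul, omega_sq, Complex.I_sq]

/-- The ring `𝔻 = ℤ[1/2]` of dyadic fractions `a / 2 ^ n`, as a subring of `ℂ`. -/
def dyadic : Subring ℂ where
  carrier := {x | ∃ (a : ℤ) (n : ℕ), x = (a : ℂ) / 2 ^ n}
  mul_mem' := by
    rintro _ _ ⟨a, m, rfl⟩ ⟨b, n, rfl⟩
    exact ⟨a * b, m + n, by push_cast; rw [pow_add, div_mul_div_comm]⟩
  one_mem' := ⟨1, 0, by norm_num⟩
  add_mem' := by
    rintro _ _ ⟨a, m, rfl⟩ ⟨b, n, rfl⟩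
    exact ⟨a * 2 ^ n + 2 ^ m * b, m + n, by
      push_cast; rw [pow_add, div_add_div _ _ (pow_ne_zero _ two_ne_zero) (pow_ne_zero _ two_ne_zero)]⟩
  zero_mem' := ⟨0, 0, by norm_num⟩
  neg_mem' := by
    rintro _ ⟨a, m, rfl⟩
    exact ⟨-a, m, by push_cast; rw [neg_div]⟩

/-- The ring `𝔻[ω] = {a ω³ + b ω² + c ω + d : a, b, c, d ∈ 𝔻}`. -/
def DOmega : Subring ℂ where
  carrier := {z | ∃ a ∈ dyadic, ∃ b ∈ dyadic, ∃ c ∈ dyadic, ∃ d ∈ dyadic,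
    z = a * omega ^ 3 + b * omega ^ 2 + c * omega + d}
  mul_mem' := by
    rintro _ _ ⟨a, ha, b, hb, c, hc, d, hd, rfl⟩ ⟨a', ha', b', hb', c', hc', d', hd', rfl⟩
    refine ⟨a * d' + b * c' + c * b' + d * a', ?_, b * d' + c * c' + d * b' - a * a', ?_,
      c * d' + d * c' - a * b' - b * a', ?_, d * d' - a * c' - b * b' - c * a', ?_, ?_⟩
    · exact add_mem (add_mem (add_mem (mul_mem ha hd') (mul_mem hb hc')) (mul_mem hc hb'))
        (mul_mem hd ha')
    · exact sub_mem (add_mem (add_mem (mul_mem hb hd') (mul_mem hc hc')) (mul_mem hd hb'))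
        (mul_mem ha ha')
    · exact sub_mem (sub_mem (add_mem (mul_mem hc hd') (mul_mem hd hc')) (mul_mem ha hb'))
        (mul_mem hb ha')
    · exact sub_mem (sub_mem (sub_mem (mul_mem hd hd') (mul_mem ha hc')) (mul_mem hb hb'))
        (mul_mem hc ha')
    · linear_combination (a * a' * omega ^ 2 + (a * b' + b * a') * omega
        + (a * c' + b * b' + c * a')) * omega_pow_four
  one_mem' := ⟨0, zero_mem _, 0, zero_mem _, 0, zero_mem _, 1, one_mem _, by ring⟩
  add_mem' := by
    rintro _ _ ⟨a, ha, b, hb, c, hc, d, hd, rfl⟩ ⟨a', ha', b', hb', c', hc', d', hd', rfl⟩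
    exact ⟨a + a', add_mem ha ha', b + b', add_mem hb hb', c + c', add_mem hc hc',
      d + d', add_mem hd hd', by ring⟩
  zero_mem' := ⟨0, zero_mem _, 0, zero_mem _, 0, zero_mem _, 0, zero_mem _, by ring⟩
  neg_mem' := by
    rintro _ ⟨a, ha, b, hb, c, hc, d, hd, rfl⟩
    exact ⟨-a, neg_mem ha, -b, neg_mem hb, -c, neg_mem hc, -d, neg_mem hd, by ring⟩

/-- `𝔻[ω]` is the ring `ℤ[1/√2, i]`. -/
theorem DOmega_eq_closure :
    DOmega = Subring.closure {1 / ((√2 : ℝ) : ℂ), Complex.I} := by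
  have h2 : ((√2 : ℝ) : ℂ) * ((√2 : ℝ) : ℂ) = 2 := by
    rw [← Complex.ofReal_mul, Real.mul_self_sqrt (by norm_num)]; norm_num
  have hne : ((√2 : ℝ) : ℂ) ≠ 0 := by
    intro h; rw [h] at h2; norm_num at h2
  apply le_antisymm
  · set S := Subring.closure {1 / ((√2 : ℝ) : ℂ), Complex.I} with hS
    have hr : 1 / ((√2 : ℝ) : ℂ) ∈ S := Subring.subset_closure (by simp)
    have hI : Complex.I ∈ S := Subring.subset_closure (by simp)
    have hw : omega ∈ S := by
      rw [omega_eq, div_eq_mul_one_div]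
      exact mul_mem (add_mem (one_mem _) hI) hr
    have hhalf : (1 / 2 : ℂ) ∈ S := by
      have : (1 / 2 : ℂ) = 1 / ((√2 : ℝ) : ℂ) * (1 / ((√2 : ℝ) : ℂ)) := by
        rw [div_mul_div_comm, h2, one_mul]
      rw [this]; exact mul_mem hr hr
    have hD : ∀ x ∈ dyadic, x ∈ S := by
      rintro _ ⟨a, n, rfl⟩
      rw [div_eq_mul_one_div, ← one_div_pow]
      exact mul_mem (intCast_mem _ a) (pow_mem hhalf n)
    rintro _ ⟨a, ha, b, hb, c, hc, d, hd, rfl⟩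
    exact add_mem (add_mem (add_mem (mul_mem (hD _ ha) (pow_mem hw 3))
      (mul_mem (hD _ hb) (pow_mem hw 2))) (mul_mem (hD _ hc) hw)) (hD _ hd)
  · rw [Subring.closure_le]
    have hhalf : (1 / 2 : ℂ) ∈ dyadic := ⟨1, 1, by norm_num⟩
    rintro x (rfl | rfl)
    · refine ⟨-(1 / 2), neg_mem hhalf, 0, zero_mem _, 1 / 2, hhalf, 0, zero_mem _, ?_⟩
      rw [show omega ^ 3 = omega ^ 2 * omega by ring, omega_sq, omega_eq]
      field_simp
      linear_combination Complex.I_sq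
    · exact ⟨0, zero_mem _, 1, one_mem _, 0, zero_mem _, 0, zero_mem _, by
        rw [omega_sq]; ring⟩

theorem star_mem_dyadic {x : ℂ} (hx : x ∈ dyadic) : star x ∈ dyadic := by
  obtain ⟨a, n, rfl⟩ := hx
  exact ⟨a, n, by simp⟩

theorem star_mem_DOmega {z : ℂ} (hz : z ∈ DOmega) : star z ∈ DOmega := by
  have hw : star omega = -omega ^ 3 := by
    rw [show -omega ^ 3 = -(omega ^ 2 * omega) by ring, omega_sq, omega_eq]
    simp only [Complex.star_def, map_div₀, map_add, map_one, Complex.conj_I, Complex.conj_ofReal]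
    rw [← mul_div_assoc, ← neg_div]
    congr 1
    linear_combination Complex.I_sq
  obtain ⟨a, ha, b, hb, c, hc, d, hd, rfl⟩ := hz
  refine ⟨-star c, neg_mem (star_mem_dyadic hc), -star b, neg_mem (star_mem_dyadic hb),
    -star a, neg_mem (star_mem_dyadic ha), star d, star_mem_dyadic hd, ?_⟩
  simp only [star_add, star_mul', star_pow, hw]
  linear_combination (star b * omega ^ 2 - star a * omega ^ 5 + star a * omega) * omega_pow_four

/-- The group `U_n(𝔻[ω])` of unitary `n × n` matrices with entries in `𝔻[ω]`. -/
def U (n : ℕ) : Subgroup (Matrix.unitaryGroup (Fin n) ℂ) where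
  carrier := {M | ∀ i j, (M : Matrix (Fin n) (Fin n) ℂ) i j ∈ DOmega}
  mul_mem' := by
    intro M N hM hN i j
    rw [Submonoid.coe_mul, Matrix.mul_apply]
    exact sum_mem fun k _ => mul_mem (hM i k) (hN k j)
  one_mem' := by
    intro i j
    rw [Submonoid.coe_one, Matrix.one_apply]
    split_ifs
    · exact one_mem _
    · exact zero_mem _
  inv_mem' := by
    intro M hM i j
    rw [Matrix.UnitaryGroup.inv_apply, Matrix.star_apply]
    exact star_mem_DOmega (hM j i)

/-- The one-level matrix `x_[j]`: the identity with the `j`-th diagonal entry replaced by `x`. -/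
def oneLevel {n : ℕ} (x : ℂ) (j : Fin n) : Matrix (Fin n) (Fin n) ℂ :=
  Matrix.of fun r c => if r = j ∧ c = j then x else (1 : Matrix (Fin n) (Fin n) ℂ) r c

/-- The two-level matrix `V_[j,k]`: the `2 × 2` matrix `V` in rows and columns `j`, `k`, and the
identity elsewhere. -/
def twoLevel {n : ℕ} (V : Matrix (Fin 2) (Fin 2) ℂ) (j k : Fin n) : Matrix (Fin n) (Fin n) ℂ :=
  Matrix.of fun r c =>
    if r = j ∧ c = j then V 0 0
    else if r = j ∧ c = k then V 0 1
    else if r = k ∧ c = j then V 1 0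
    else if r = k ∧ c = k then V 1 1
    else (1 : Matrix (Fin n) (Fin n) ℂ) r c

/-- `X = [0 1; 1 0]`. -/
def matX : Matrix (Fin 2) (Fin 2) ℂ := !![0, 1; 1, 0]

/-- `H = (1/√2) [1 1; 1 -1]`. -/
def matH : Matrix (Fin 2) (Fin 2) ℂ := (1 / ((√2 : ℝ) : ℂ)) • !![1, 1; 1, -1]

/-- The generators `X_[j,k]`, `H_[j,k]` (for `j < k`) and `ω_[j]`, as formal symbols. -/
inductive Gen (n : ℕ) : Type
  | X (j k : Fin n) (hjk : j < k) : Gen n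
  | H (j k : Fin n) (hjk : j < k) : Gen n
  | W (j : Fin n) : Gen n

/-- The matrix denoted by a generator. -/
def Gen.toMatrix {n : ℕ} : Gen n → Matrix (Fin n) (Fin n) ℂ
  | .X j k _ => twoLevel matX j k
  | .H j k _ => twoLevel matH j k
  | .W j => oneLevel omega j

/-- Words in the generators; the product is concatenation and `1` is the empty word. -/
abbrev Word (n : ℕ) : Type := FreeMonoid (Gen n)

/-- The matrix denoted by a word: `⟦G_q ⋯ G_1⟧ = G_q · ⋯ · G_1`. -/
def Word.eval {n : ℕ} : Word n →* Matrix (Fin n) (Fin n) ℂ := FreeMonoid.lift Gen.toMatrix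

/-- The one-letter word `X_[j,k]`. -/
def wX {n : ℕ} (j k : Fin n) (hjk : j < k) : Word n := FreeMonoid.of (.X j k hjk)

/-- The one-letter word `H_[j,k]`. -/
def wH {n : ℕ} (j k : Fin n) (hjk : j < k) : Word n := FreeMonoid.of (.H j k hjk)

/-- The one-letter word `ω_[j]`. -/
def wW {n : ℕ} (j : Fin n) : Word n := FreeMonoid.of (.W j)

/-- The twenty families of defining equations. -/
inductive Rel (n : ℕ) : Word n → Word n → Prop
  -- orders of the generators
  | W_order (j : Fin n) : Rel n (wW j ^ 8) 1
  | H_order (j k : Fin n) (hjk : j < k) : Rel n (wH j k hjk ^ 2) 1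
  | X_order (j k : Fin n) (hjk : j < k) : Rel n (wX j k hjk ^ 2) 1
  -- generators with disjoint indices commute
  | W_W (j k : Fin n) (hjk : j ≠ k) : Rel n (wW j * wW k) (wW k * wW j)
  | W_H (l j k : Fin n) (hjk : j < k) (hlj : l ≠ j) (hlk : l ≠ k) :
      Rel n (wW l * wH j k hjk) (wH j k hjk * wW l)
  | W_X (l j k : Fin n) (hjk : j < k) (hlj : l ≠ j) (hlk : l ≠ k) :
      Rel n (wW l * wX j k hjk) (wX j k hjk * wW l)
  | H_H (j k l t : Fin n) (hjk : j < k) (hlt : l < t)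
      (hd : Disjoint ({l, t} : Set (Fin n)) {j, k}) :
      Rel n (wH j k hjk * wH l t hlt) (wH l t hlt * wH j k hjk)
  | H_X (j k l t : Fin n) (hjk : j < k) (hlt : l < t)
      (hd : Disjoint ({l, t} : Set (Fin n)) {j, k}) :
      Rel n (wH j k hjk * wX l t hlt) (wX l t hlt * wH j k hjk)
  | X_X (j k l t : Fin n) (hjk : j < k) (hlt : l < t)
      (hd : Disjoint ({l, t} : Set (Fin n)) {j, k}) :
      Rel n (wX j k hjk * wX l t hlt) (wX l t hlt * wX j k hjk)
  -- `X` permutes indices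
  | X_W_right (j k : Fin n) (hjk : j < k) :
      Rel n (wX j k hjk * wW k) (wW j * wX j k hjk)
  | X_W_left (j k : Fin n) (hjk : j < k) :
      Rel n (wX j k hjk * wW j) (wW k * wX j k hjk)
  | X_X_up (j k l : Fin n) (hjk : j < k) (hkl : k < l) :
      Rel n (wX j k hjk * wX j l (hjk.trans hkl)) (wX k l hkl * wX j k hjk)
  | X_X_down (l j k : Fin n) (hlj : l < j) (hjk : j < k) :
      Rel n (wX j k hjk * wX l j hlj) (wX l k (hlj.trans hjk) * wX j k hjk)
  | X_H_up (j k l : Fin n) (hjk : j < k) (hkl : k < l) :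
      Rel n (wX j k hjk * wH j l (hjk.trans hkl)) (wH k l hkl * wX j k hjk)
  | X_H_down (l j k : Fin n) (hlj : l < j) (hjk : j < k) :
      Rel n (wX j k hjk * wH l j hlj) (wH l k (hlj.trans hjk) * wX j k hjk)
  -- `ω_[j] ω_[k]` is scalar on the indices `j`, `k`
  | WW_X (j k : Fin n) (hjk : j < k) :
      Rel n (wW j * wW k * wX j k hjk) (wX j k hjk * wW j * wW k)
  | WW_H (j k : Fin n) (hjk : j < k) :
      Rel n (wW j * wW k * wH j k hjk) (wH j k hjk * wW j * wW k)
  -- the remaining equations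
  | HX (j k : Fin n) (hjk : j < k) :
      Rel n (wH j k hjk * wX j k hjk) (wW k ^ 4 * wH j k hjk)
  | HWWH (j k : Fin n) (hjk : j < k) :
      Rel n (wH j k hjk * wW j ^ 2 * wH j k hjk)
        (wW j ^ 6 * wH j k hjk * wW j ^ 3 * wW k ^ 5)
  | HHHH (j k l t : Fin n) (hjk : j < k) (hkl : k < l) (hlt : l < t) :
      Rel n (wH j k hjk * wH l t hlt * wH j l (hjk.trans hkl) * wH k t (hkl.trans hlt))
        (wH j l (hjk.trans hkl) * wH k t (hkl.trans hlt) * wH j k hjk * wH l t hlt)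

/-- `G ≈ G'`: the smallest congruence on words that contains the defining equations. -/
def EqEquiv {n : ℕ} (G G' : Word n) : Prop := conGen (Rel n) G G'

/-- `G ∼ G'`: the two words denote the same matrix. -/
def OpEquiv {n : ℕ} (G G' : Word n) : Prop := Word.eval G = Word.eval G'

/-- The defining equations `u ≈ v` as group relators `u v⁻¹` in the free group on the
generators. -/
def relators (n : ℕ) : Set (FreeGroup (Gen n)) :=
  {r | ∃ u v : Word n, Rel n u v ∧
    r = FreeMonoid.lift FreeGroup.of u * (FreeMonoid.lift FreeGroup.of v)⁻¹}

end CliffordT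

end

/-!
The presented group `Pres 4` acts on the unit vectors of `ℂ⁴` with entries in `𝔻[ω]`, and the theorem
says that this action is faithful and that its image is all of `U 4`. Both follow from a descent on
the denominators of a single vector.

The ring `ℤ[ω]` has one prime `δ = 1 + ω` above `2`, with residue field `𝔽₂`; up to units, `√2` is
`δ²` and `2` is `δ⁴`, and the units modulo `δ³` are exactly the powers of `ω`
(`exists_sub_omega_pow_mul_mem_filt`). Let `e ≥ 1` be the denominator exponent of a unit vector `v`,
that is, the largest exponent of `δ` in a denominator. Since the squared absolute values add up to `1`,
the number of coordinates at which `e` is attained is even, hence `2` or `4`. Two such coordinates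
agree modulo `δ³`, relative to `δ⁻ᵉ`, after a multiplication by a power of `ω`, and then `H` on them
lowers their denominators. So the level of `v`, the pair of `e` and the number of coordinates
attaining it, can always be lowered, until `v` is a basis vector up to a power of `ω`. This gives
surjectivity, column by column.

For injectivity it is enough that the stabilizer of the basis vector `e_b` in the subgroup
`standard (b + 1)`, generated by the generators with indices at most `b`, is `standard b`
(`mem_standard_of_act_single`), because these subgroups go down from the whole group to the trivial
one. To see this, `frame b` assigns a coset of `standard b` to each unit vector with support in the
first `b + 1` coordinates: the coset is pulled back along a descent, by recursion on the level. The
point is that `frame b` commutes with the generators (`equivariantBelow_frame`); this is shown by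
induction on the level, in these cases:

* descents along the same pair of coordinates differ by a monomial element, by the relations that
  move `X` and `ω` past `H`;
* a vector with four coordinates of maximal denominator has several descents. It can be normalized
  by powers of `ω` such that these coordinates agree modulo `δ³` and add up to zero modulo `δ⁵`
  (`exists_normalization`). Then both sides of
  `H_[p,q] H_[r,s] H_[p,r] H_[q,s] = H_[p,r] H_[q,s] H_[p,q] H_[r,s]` are paths of lower level, and
  they connect the targets of the descents along `{p, q}` and `{p, r}` (`pullBack_eq_of_overlap`);
* if `H_[i,j]` does not raise the level and is not a descent itself, then either `v` and its image
  have a common descent, by the relation for `H_[j,k] ω_[j]² H_[j,k]`, or `H_[i,j]` acts on two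
  coordinates of small denominator and commutes with a descent on two others
  (`frame_act_gH_of_level_le`).

The normalization needs the sum of the four coordinates to vanish modulo `δ⁴`. This comes from the
norm equation, since the trace of an element of odd valuation `s` has valuation exactly `s + 1`
(`add_star_notMem_filt`), except for `e = 2`, where such a vector is excluded because the rational
part of `|aω³ + bω² + cω + d|²` is `a² + b² + c² + d²`.
-/

noncomputable section

namespace CliffordT

/-! ### The ring `ℤ[ω]` and its filtration by powers of `1 + ω` -/

/-- The ring `ℤ[ω]` as a subring of `ℂ`. -/
def ZOmega : Subring ℂ where
  carrier := {z | ∃ a b c d : ℤ, z = a * omega ^ 3 + b * omega ^ 2 + c * omega + d}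
  mul_mem' := by
    rintro _ _ ⟨a, b, c, d, rfl⟩ ⟨a', b', c', d', rfl⟩
    refine ⟨a * d' + b * c' + c * b' + d * a', b * d' + c * c' + d * b' - a * a',
      c * d' + d * c' - a * b' - b * a', d * d' - a * c' - b * b' - c * a', ?_⟩
    push_cast
    linear_combination (a * a' * omega ^ 2 + (a * b' + b * a') * omega
        + (a * c' + b * b' + c * a')) * omega_pow_four
  one_mem' := ⟨0, 0, 0, 1, by push_cast; ring⟩
  add_mem' := by
    rintro _ _ ⟨a, b, c, d, rfl⟩ ⟨a', b', c', d', rfl⟩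
    exact ⟨a + a', b + b', c + c', d + d', by push_cast; ring⟩
  zero_mem' := ⟨0, 0, 0, 0, by push_cast; ring⟩
  neg_mem' := by
    rintro _ ⟨a, b, c, d, rfl⟩
    exact ⟨-a, -b, -c, -d, by push_cast; ring⟩

theorem omega_mem_ZOmega : omega ∈ ZOmega := ⟨0, 0, 1, 0, by push_cast; ring⟩

theorem omega_ne_zero : omega ≠ 0 := Complex.exp_ne_zero _

theorem omega_pow_eight : omega ^ 8 = 1 := by
  linear_combination (omega ^ 4 - 1) * omega_pow_four

theorem star_omega : star omega = omega⁻¹ := by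
  have h : star omega * omega = 1 := by
    rw [omega_eq]
    have h2 : ((√2 : ℝ) : ℂ) * ((√2 : ℝ) : ℂ) = 2 := by
      rw [← Complex.ofReal_mul, Real.mul_self_sqrt (by norm_num)]; norm_num
    have hne : ((√2 : ℝ) : ℂ) ≠ 0 := by
      intro h; rw [h] at h2; norm_num at h2
    simp only [Complex.star_def, map_div₀, map_add, map_one, Complex.conj_I, Complex.conj_ofReal]
    field_simp
    linear_combination -h2 - Complex.I_sq
  exact eq_inv_of_mul_eq_one_left h

theorem omega_inv : omega⁻¹ = -omega ^ 3 := by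
  rw [inv_eq_iff_eq_inv, eq_comm, inv_eq_of_mul_eq_one_left]
  linear_combination -omega_pow_four

/-- `√2` as a complex number. -/
def sqrtTwo : ℂ := ((√2 : ℝ) : ℂ)

theorem sqrtTwo_sq : sqrtTwo ^ 2 = 2 := by
  rw [sqrtTwo, ← Complex.ofReal_pow, Real.sq_sqrt (by norm_num)]; norm_num

theorem sqrtTwo_ne_zero : sqrtTwo ≠ 0 := by
  intro h; have := sqrtTwo_sq; rw [h] at this; norm_num at this

theorem star_sqrtTwo : star sqrtTwo = sqrtTwo := Complex.conj_ofReal _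

theorem sqrtTwo_eq : sqrtTwo = omega - omega ^ 3 := by
  have h : omega * sqrtTwo = 1 + Complex.I := by
    rw [omega_eq]; exact div_mul_cancel₀ _ sqrtTwo_ne_zero
  have : omega * sqrtTwo = omega * (omega - omega ^ 3) := by
    rw [h, ← omega_sq]; linear_combination omega_pow_four
  exact mul_left_cancel₀ omega_ne_zero this

/-- The powers `1`, `ω`, `ω²`, `ω³` are linearly independent over `ℤ`. -/
theorem int_coord_eq_zero {a b c d : ℤ}
    (h : (a : ℂ) * omega ^ 3 + b * omega ^ 2 + c * omega + d = 0) :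
    a = 0 ∧ b = 0 ∧ c = 0 ∧ d = 0 := by
  have h2 : sqrtTwo * omega = 1 + Complex.I := by
    rw [omega_eq, mul_comm]; exact div_mul_cancel₀ _ sqrtTwo_ne_zero
  have h3 : sqrtTwo * omega ^ 3 = Complex.I - 1 := by
    rw [show sqrtTwo * omega ^ 3 = sqrtTwo * omega * omega ^ 2 by ring, h2, omega_sq]
    linear_combination Complex.I_sq
  have key : (a : ℂ) * (Complex.I - 1) + b * Complex.I * sqrtTwo + c * (1 + Complex.I)
      + d * sqrtTwo = 0 := by
    rw [← h2, ← h3, ← omega_sq]; linear_combination sqrtTwo * h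
  have hre := congrArg Complex.re key
  have him := congrArg Complex.im key
  simp [sqrtTwo] at hre him
  have irr : ∀ x y : ℤ, (x : ℝ) + y * √2 = 0 → x = 0 ∧ y = 0 := by
    intro x y hxy
    have hy : y = 0 := by
      by_contra hy
      have hir := (irrational_sqrt_two.intCast_mul hy).intCast_add x
      exact hir ⟨0, by push_cast; linarith⟩
    subst hy
    simpa using hxy
  obtain ⟨h1, h1'⟩ := irr (c - a) d (by push_cast; linarith)
  obtain ⟨h4, h4'⟩ := irr (a + c) b (by push_cast; linarith)
  omega

/-- The uniformizer `δ = 1 + ω` of `ℤ[ω]` at `2`. -/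
def delta : ℂ := 1 + omega

theorem delta_ne_zero : delta ≠ 0 := by
  intro h
  have := int_coord_eq_zero (a := 0) (b := 0) (c := 1) (d := 1)
    (by rw [delta] at h; push_cast; linear_combination h)
  omega

theorem delta_mem_ZOmega : delta ∈ ZOmega := add_mem (one_mem _) omega_mem_ZOmega

/-- The fractional ideal `δ ^ r ℤ[ω]`, for `r : ℤ`. -/
def filt (r : ℤ) : AddSubgroup ℂ where
  carrier := {z | ∃ x ∈ ZOmega, z = delta ^ r * x}
  add_mem' := by
    rintro _ _ ⟨x, hx, rfl⟩ ⟨y, hy, rfl⟩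
    exact ⟨x + y, add_mem hx hy, by ring⟩
  zero_mem' := ⟨0, zero_mem _, by ring⟩
  neg_mem' := by
    rintro _ ⟨x, hx, rfl⟩
    exact ⟨-x, neg_mem hx, by ring⟩

theorem mem_filt {r : ℤ} {z : ℂ} : z ∈ filt r ↔ ∃ x ∈ ZOmega, z = delta ^ r * x := Iff.rfl

theorem mem_filt_zero {z : ℂ} : z ∈ filt 0 ↔ z ∈ ZOmega := by simp [mem_filt]

theorem filt_anti {r s : ℤ} (h : r ≤ s) {z : ℂ} (hz : z ∈ filt s) : z ∈ filt r := by
  obtain ⟨x, hx, rfl⟩ := hz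
  obtain ⟨n, rfl⟩ := Int.le.dest h
  exact ⟨delta ^ n * x, mul_mem (pow_mem delta_mem_ZOmega n) hx, by
    rw [zpow_add₀ delta_ne_zero, zpow_natCast]; ring⟩

theorem mul_mem_filt {r s : ℤ} {x y : ℂ} (hx : x ∈ filt r) (hy : y ∈ filt s) :
    x * y ∈ filt (r + s) := by
  obtain ⟨x, hx, rfl⟩ := hx
  obtain ⟨y, hy, rfl⟩ := hy
  exact ⟨x * y, mul_mem hx hy, by rw [zpow_add₀ delta_ne_zero]; ring⟩

theorem mul_mem_filt_of_mem_ZOmega {r : ℤ} {x y : ℂ} (hx : x ∈ ZOmega) (hy : y ∈ filt r) :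
    x * y ∈ filt r := by
  simpa using mul_mem_filt (mem_filt_zero.2 hx) hy

theorem delta_mul_mem_filt {r : ℤ} {z : ℂ} : delta * z ∈ filt (r + 1) ↔ z ∈ filt r := by
  constructor
  · rintro ⟨x, hx, h⟩
    refine ⟨x, hx, mul_left_cancel₀ delta_ne_zero ?_⟩
    rw [h, zpow_add_one₀ delta_ne_zero]; ring
  · rintro ⟨x, hx, rfl⟩
    exact ⟨x, hx, by rw [zpow_add_one₀ delta_ne_zero]; ring⟩

theorem omega_pow_mul_mem_filt {r : ℤ} (m : ℕ) {z : ℂ} : omega ^ m * z ∈ filt r ↔ z ∈ filt r := by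
  refine ⟨fun h => ?_, mul_mem_filt_of_mem_ZOmega (pow_mem omega_mem_ZOmega m)⟩
  have := mul_mem_filt_of_mem_ZOmega (pow_mem omega_mem_ZOmega (7 * m)) h
  rwa [← mul_assoc, ← pow_add, show 7 * m + m = 8 * m by ring, pow_mul, omega_pow_eight, one_pow,
    one_mul] at this

theorem omega_mul_mem_filt {r : ℤ} {z : ℂ} : omega * z ∈ filt r ↔ z ∈ filt r := by
  simpa using omega_pow_mul_mem_filt (r := r) 1 (z := z)

/-- `√2` is `δ ^ 2` up to a unit of `ℤ[ω]`. -/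
theorem sqrtTwo_mul_mem_filt {r : ℤ} {z : ℂ} : sqrtTwo * z ∈ filt (r + 2) ↔ z ∈ filt r := by
  have h1 : sqrtTwo = delta * (delta * (1 - omega ^ 2 + omega ^ 3)) := by
    rw [sqrtTwo_eq, delta]; linear_combination -(omega+1)*omega_pow_four
  have h2 : sqrtTwo * (1 + omega + omega ^ 2) = delta * delta := by
    rw [sqrtTwo_eq, delta]; linear_combination -(omega+1)*omega_pow_four
  have hm1 : (1 - omega ^ 2 + omega ^ 3) ∈ ZOmega :=
    add_mem (sub_mem (one_mem _) (pow_mem omega_mem_ZOmega 2)) (pow_mem omega_mem_ZOmega 3)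
  have hm2 : (1 + omega + omega ^ 2) ∈ ZOmega :=
    add_mem (add_mem (one_mem _) omega_mem_ZOmega) (pow_mem omega_mem_ZOmega 2)
  rw [show r + 2 = r + 1 + 1 by ring]
  constructor
  · intro h
    have := mul_mem_filt_of_mem_ZOmega hm2 h
    rwa [← mul_assoc, mul_comm _ sqrtTwo, h2, mul_assoc, delta_mul_mem_filt,
      delta_mul_mem_filt] at this
  · intro h
    rw [h1, mul_assoc, delta_mul_mem_filt, mul_assoc, delta_mul_mem_filt]
    exact mul_mem_filt_of_mem_ZOmega hm1 h

theorem div_sqrtTwo_mem_filt {r : ℤ} {z : ℂ} : z / sqrtTwo ∈ filt r ↔ z ∈ filt (r + 2) := by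
  rw [← sqrtTwo_mul_mem_filt, mul_div_cancel₀ _ sqrtTwo_ne_zero]

theorem two_mul_mem_filt {r : ℤ} {z : ℂ} : 2 * z ∈ filt (r + 4) ↔ z ∈ filt r := by
  rw [← sqrtTwo_sq, pow_two, mul_assoc, show r + 4 = r + 2 + 2 by ring, sqrtTwo_mul_mem_filt,
    sqrtTwo_mul_mem_filt]

theorem one_notMem_filt_one : (1 : ℂ) ∉ filt 1 := by
  rintro ⟨_, ⟨a, b, c, d, rfl⟩, h⟩
  have := int_coord_eq_zero (a := a + b) (b := b + c) (c := c + d) (d := d - a - 1) (by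
    rw [zpow_one, delta] at h
    push_cast
    linear_combination -h - a * omega_pow_four)
  omega

theorem filt_one_of_mul_delta {x y : ℂ} (hx : x ∈ ZOmega) (h : y = delta * x) : y ∈ filt 1 :=
  ⟨x, hx, by rw [h, zpow_one]⟩

theorem two_mem_filt_four : (2 : ℂ) ∈ filt 4 := by
  have := (two_mul_mem_filt (r := 0) (z := 1)).2 (mem_filt_zero.2 (one_mem _))
  simpa using this

/-- The residue field `ℤ[ω] / δ` has two elements. -/
theorem mem_filt_one_or {x : ℂ} (hx : x ∈ ZOmega) : x ∈ filt 1 ∨ x - 1 ∈ filt 1 := by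
  obtain ⟨a, b, c, d, rfl⟩ := hx
  have hw : omega - 1 ∈ filt 1 := by
    have h := sub_mem (filt_one_of_mul_delta (one_mem _) (mul_one delta).symm)
      (filt_anti (by norm_num) two_mem_filt_four)
    rw [delta] at h
    convert h using 1; ring
  have h2 : (2 : ℂ) ∈ filt 1 := filt_anti (by norm_num) two_mem_filt_four
  have hm : ((a : ℂ) * (omega ^ 2 + omega + 1) + b * (omega + 1) + c) ∈ ZOmega :=
    ⟨0, a, a + b, a + b + c, by push_cast; ring⟩
  have hres := mul_mem_filt_of_mem_ZOmega hm hw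
  obtain ⟨t, ht⟩ | ⟨t, ht⟩ := (a + b + c + d).even_or_odd
  · left
    have := add_mem hres (mul_mem_filt_of_mem_ZOmega (intCast_mem ZOmega t) h2)
    convert this using 1
    have : (a : ℂ) + b + c + d = t + t := by exact_mod_cast ht
    linear_combination this
  · right
    have := add_mem hres (mul_mem_filt_of_mem_ZOmega (intCast_mem ZOmega t) h2)
    convert this using 1
    have : (a : ℂ) + b + c + d = 2 * t + 1 := by exact_mod_cast ht
    linear_combination this

theorem mem_filt_add_iff {r s : ℤ} {x : ℂ} : delta ^ r * x ∈ filt (r + s) ↔ x ∈ filt s := by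
  constructor
  · rintro ⟨y, hy, h⟩
    refine ⟨y, hy, mul_left_cancel₀ (zpow_ne_zero r delta_ne_zero) ?_⟩
    rw [h, zpow_add₀ delta_ne_zero]; ring
  · rintro ⟨y, hy, rfl⟩
    exact ⟨y, hy, by rw [zpow_add₀ delta_ne_zero]; ring⟩

/-- `filt r / filt (r + 1)` has two elements. -/
theorem add_mem_filt_succ {r : ℤ} {x y : ℂ} (hx : x ∈ filt r) (hx' : x ∉ filt (r + 1))
    (hy : y ∈ filt r) (hy' : y ∉ filt (r + 1)) : x + y ∈ filt (r + 1) := by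
  obtain ⟨x, hx, rfl⟩ := hx
  obtain ⟨y, hy, rfl⟩ := hy
  rw [mem_filt_add_iff] at hx' hy'
  rw [← mul_add, mem_filt_add_iff]
  have h := add_mem (add_mem ((mem_filt_one_or hx).resolve_left hx')
    ((mem_filt_one_or hy).resolve_left hy')) (filt_anti (r := 1) (by norm_num) two_mem_filt_four)
  convert h using 1; ring

theorem sub_mem_filt_succ {r : ℤ} {x y : ℂ} (hx : x ∈ filt r) (hx' : x ∉ filt (r + 1))
    (hy : y ∈ filt r) (hy' : y ∉ filt (r + 1)) : x - y ∈ filt (r + 1) := by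
  rw [sub_eq_add_neg]
  exact add_mem_filt_succ hx hx' (neg_mem hy) (by rwa [neg_mem_iff])

/-- The element `δ` is prime: valuations add under multiplication. -/
theorem mul_notMem_filt_succ {r s : ℤ} {x y : ℂ} (hx : x ∈ filt r) (hx' : x ∉ filt (r + 1))
    (hy : y ∈ filt s) (hy' : y ∉ filt (s + 1)) : x * y ∉ filt (r + s + 1) := by
  obtain ⟨x, hx, rfl⟩ := hx
  obtain ⟨y, hy, rfl⟩ := hy
  rw [mem_filt_add_iff] at hx' hy'
  rw [show delta ^ r * x * (delta ^ s * y) = delta ^ (r + s) * (x * y) by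
    rw [zpow_add₀ delta_ne_zero]; ring, mem_filt_add_iff]
  intro h
  have h1 := (mem_filt_one_or hx).resolve_left hx'
  have h2 := (mem_filt_one_or hy).resolve_left hy'
  have h3 := sub_mem (sub_mem h (mul_mem_filt_of_mem_ZOmega hy h1)) h2
  apply one_notMem_filt_one
  convert h3 using 1; ring

/-- Multiplication by `ω ^ m` is trivial modulo `δ ^ 3` only for `m` divisible by `4`. -/
theorem four_dvd_of_mem_filt {r : ℤ} {y : ℂ} (hy : y ∈ filt r) (hy' : y ∉ filt (r + 1)) {m : ℕ}
    (h : omega ^ m * y - y ∈ filt (r + 3)) : 4 ∣ m := by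
  have h2y : 2 * y ∈ filt (r + 4) := two_mul_mem_filt.2 hy
  have hred : omega ^ (m % 4) * y - y ∈ filt (r + 3) := by
    rw [← Nat.div_add_mod m 4, pow_add, pow_mul, omega_pow_four] at h
    rcases neg_one_pow_eq_or ℂ (m / 4) with h1 | h1
    · simpa [h1] using h
    · rw [h1] at h
      have := add_mem h (filt_anti (r := r + 3) (by omega) h2y)
      rw [← neg_mem_iff]
      convert this using 1; ring
  have hlt := Nat.mod_lt m (show 4 > 0 by norm_num)
  rw [Nat.dvd_iff_mod_eq_zero]
  generalize m % 4 = k at *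
  interval_cases k
  · rfl
  · exfalso
    apply hy'
    rw [← delta_mul_mem_filt]
    have := add_mem (filt_anti (r := r + 1 + 1) (by omega) hred) (filt_anti (by omega) h2y)
    convert this using 1
    rw [delta]; ring
  · exfalso
    apply hy'
    rw [← delta_mul_mem_filt, ← delta_mul_mem_filt]
    have := add_mem (add_mem hred (filt_anti (by omega) h2y))
      (filt_anti (by omega) (omega_mul_mem_filt.2 h2y))
    rw [show r + 1 + 1 + 1 = r + 3 by ring]
    convert this using 1
    rw [delta]; ring
  · exfalso
    apply hy'
    rw [← delta_mul_mem_filt, ← neg_mem_iff]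
    have := filt_anti (r := r + 1 + 1) (by omega) (omega_mul_mem_filt.2 hred)
    convert this using 1
    rw [delta]; linear_combination -y * omega_pow_four

/-- Modulo `δ ^ 2`, multiplication by `ω ^ m` is trivial only for even `m`. -/
theorem even_of_mem_filt {r : ℤ} {y : ℂ} (hy : y ∈ filt r) (hy' : y ∉ filt (r + 1)) {m : ℕ}
    (h : omega ^ m * y - y ∈ filt (r + 2)) : Even m := by
  have h4 : 4 ∣ m * 2 := by
    apply four_dvd_of_mem_filt hy hy'
    -- `ω ^ (2 m) - 1 = (ω ^ m - 1) (ω ^ m + 1)`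
    have hd : omega ^ m * (omega ^ m * y - y) + (omega ^ m * y - y) ∈ filt (r + 2 + 1) := by
      by_cases h3 : omega ^ m * y - y ∈ filt (r + 2 + 1)
      · exact add_mem ((omega_pow_mul_mem_filt m).2 h3) h3
      · exact add_mem_filt_succ ((omega_pow_mul_mem_filt m).2 h)
          (by rwa [omega_pow_mul_mem_filt]) h h3
    rw [show r + 3 = r + 2 + 1 by ring]
    convert hd using 1
    rw [pow_mul]; ring
  rw [Nat.even_iff]; omega

/-- The units modulo `δ ^ 3` are the powers of `ω`. -/
theorem exists_sub_omega_pow_mul_mem_filt {r : ℤ} {x y : ℂ} (hx : x ∈ filt r)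
    (hx' : x ∉ filt (r + 1)) (hy : y ∈ filt r) (hy' : y ∉ filt (r + 1)) :
    ∃ m < 4, x - omega ^ m * y ∈ filt (r + 3) := by
  have step : ∀ s : ℤ, ∀ k ∈ ({1, 2} : Set ℕ), s = r + k → ∀ z, z ∈ filt r → z ∉ filt (r + 1) →
      x - z ∈ filt s → x - z ∈ filt (s + 1) ∨ x - omega ^ k * z ∈ filt (s + 1) := by
    intro s k hk hs z hz hz' hxz
    by_cases h : x - z ∈ filt (s + 1)
    · exact Or.inl h
    right
    rw [show x - omega ^ k * z = (x - z) - (omega ^ k * z - z) by ring]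
    have h2z : 2 * z ∈ filt (r + 4) := two_mul_mem_filt.2 hz
    rcases hk with rfl | rfl
    · have hmem : omega ^ 1 * z - z ∈ filt (r + 1) := by
        have := sub_mem (delta_mul_mem_filt.2 hz) (filt_anti (by omega) h2z)
        convert this using 1; rw [delta]; ring
      subst hs
      refine sub_mem_filt_succ hxz h hmem fun hc => ?_
      have := even_of_mem_filt hz hz' (m := 1) (by convert hc using 2; push_cast; ring)
      exact absurd this (by decide)
    · have hmem : omega ^ 2 * z - z ∈ filt (r + 2) := by
        have := sub_mem (sub_mem (delta_mul_mem_filt.2 (delta_mul_mem_filt.2 hz))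
          (filt_anti (by omega) h2z)) (filt_anti (by omega) (omega_mul_mem_filt.2 h2z))
        rw [show r + 2 = r + 1 + 1 by ring]
        convert this using 1; rw [delta]; ring
      subst hs
      refine sub_mem_filt_succ hxz h hmem fun hc => ?_
      have := four_dvd_of_mem_filt hz hz' (m := 2) (by convert hc using 2; push_cast; ring)
      exact absurd this (by decide)
  have h0 := sub_mem_filt_succ hx hx' hy hy'
  have h1 : ∃ k < 2, x - omega ^ k * y ∈ filt (r + 2) := by
    rw [show r + 2 = r + 1 + 1 by ring]
    rcases step (r + 1) 1 (by simp) (by simp) y hy hy' h0 with h | h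
    · exact ⟨0, by norm_num, by simpa using h⟩
    · exact ⟨1, by norm_num, h⟩
  obtain ⟨k, hk, h1⟩ := h1
  rw [show r + 3 = r + 2 + 1 by ring]
  rcases step (r + 2) 2 (by simp) (by simp) (omega ^ k * y) ((omega_pow_mul_mem_filt k).2 hy)
    (by rwa [omega_pow_mul_mem_filt]) h1 with h | h
  · exact ⟨k, by omega, h⟩
  · exact ⟨2 + k, by omega, by rwa [pow_add, mul_assoc]⟩

/-! ### Complex conjugation and the trace -/

theorem star_mem_ZOmega {x : ℂ} (hx : x ∈ ZOmega) : star x ∈ ZOmega := by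
  obtain ⟨a, b, c, d, rfl⟩ := hx
  refine ⟨-c, -b, -a, d, ?_⟩
  simp only [star_add, star_mul', star_pow, star_omega, omega_inv, star_intCast]
  push_cast
  linear_combination (-a * omega ^ 5 + b * omega ^ 2 + a * omega) * omega_pow_four

theorem star_delta : star delta = omega⁻¹ * delta := by
  rw [delta, star_add, star_one, star_omega, mul_add, inv_mul_cancel₀ omega_ne_zero]; ring

/-- Conjugation is trivial modulo `δ ^ 2`. -/
theorem star_sub_self_mem_filt {x : ℂ} (hx : x ∈ ZOmega) : star x - x ∈ filt 2 := by
  obtain ⟨a, b, c, d, rfl⟩ := hx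
  have h : star ((a : ℂ) * omega ^ 3 + b * omega ^ 2 + c * omega + d)
      - (a * omega ^ 3 + b * omega ^ 2 + c * omega + d)
      = sqrtTwo * (-(a + c : ℤ) * omega ^ 2 - b * omega ^ 3 - b * omega) := by
    simp only [star_add, star_mul', star_pow, star_omega, omega_inv, star_intCast, sqrtTwo_eq]
    push_cast
    linear_combination -(a * omega ^ 5 + c * omega) * omega_pow_four
  rw [h]
  refine (sqrtTwo_mul_mem_filt (r := 0)).2 (mem_filt_zero.2 ⟨-b, -(a + c), -b, 0, ?_⟩)
  push_cast; ring

theorem exists_omega_zpow_eq (s : ℤ) : ∃ m : ℕ, omega ^ s = omega ^ m ∧ (Even m ↔ Even s) := by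
  refine ⟨(s % 8).toNat, ?_, ?_⟩
  · have h : ((s % 8).toNat : ℤ) = s % 8 := Int.toNat_of_nonneg (by omega)
    rw [← zpow_natCast, h]
    conv_lhs => rw [← Int.emod_add_mul_ediv s 8]
    rw [zpow_add₀ omega_ne_zero, zpow_mul]
    have h8 : omega ^ (8 : ℤ) = 1 := by exact_mod_cast omega_pow_eight
    rw [h8, one_zpow, mul_one]
  · rw [Nat.even_iff, Int.even_iff]; omega

theorem star_delta_zpow (r : ℤ) : star (delta ^ r) = omega ^ (-r) * delta ^ r := by
  rw [Complex.star_def, map_zpow₀, ← Complex.star_def, star_delta, mul_zpow, inv_zpow, zpow_neg]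

theorem star_mem_filt {r : ℤ} {x : ℂ} (hx : x ∈ filt r) : star x ∈ filt r := by
  obtain ⟨x, hx, rfl⟩ := hx
  obtain ⟨m, hm, -⟩ := exists_omega_zpow_eq (-r)
  exact ⟨omega ^ m * star x, mul_mem (pow_mem omega_mem_ZOmega m) (star_mem_ZOmega hx), by
    rw [star_mul', star_delta_zpow, hm]; ring⟩

theorem star_mem_filt_iff {r : ℤ} {x : ℂ} : star x ∈ filt r ↔ x ∈ filt r :=
  ⟨fun h => by simpa using star_mem_filt h, star_mem_filt⟩

/-- The trace of an element of odd valuation `s` has valuation `s + 1`. -/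
theorem add_star_notMem_filt {s : ℤ} (hs : Odd s) {z : ℂ} (hz : z ∈ filt s)
    (hz' : z ∉ filt (s + 1)) : z + star z ∉ filt (s + 2) := by
  obtain ⟨y, hy, rfl⟩ := hz
  obtain ⟨m, hm, hpar⟩ := exists_omega_zpow_eq (-s)
  rw [mem_filt_add_iff] at hz'
  rw [star_mul', star_delta_zpow, hm, show delta ^ s * y + omega ^ m * delta ^ s * star y
    = delta ^ s * (y + omega ^ m * star y) by ring, mem_filt_add_iff]
  intro h
  -- modulo `δ ^ 2`, conjugation is trivial and `1 = -1`
  have h1 : y + omega ^ m * star y - omega ^ m * (star y - y) - 2 * y ∈ filt 2 :=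
    sub_mem (sub_mem h ((omega_pow_mul_mem_filt m).2 (star_sub_self_mem_filt hy)))
    (filt_anti (r := 2) (by norm_num) (two_mul_mem_filt.2 (mem_filt_zero.2 hy)))
  have h2 : Even m := even_of_mem_filt (r := 0) (mem_filt_zero.2 hy) (by simpa using hz') (by
    have he : y + omega ^ m * star y - omega ^ m * (star y - y) - 2 * y = omega ^ m * y - y := by
      ring
    rw [zero_add, ← he]; exact h1)
  rw [hpar, even_neg] at h2
  exact Int.not_even_iff_odd.2 hs h2

theorem exists_mem_filt_of_mem_DOmega {z : ℂ} (hz : z ∈ DOmega) : ∃ e : ℕ, z ∈ filt (-e) := by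
  have hD : ∀ x ∈ dyadic, ∃ e : ℕ, x ∈ filt (-e) := by
    rintro _ ⟨a, n, rfl⟩
    refine ⟨4 * n, ?_⟩
    induction n with
    | zero => simpa using mem_filt_zero.2 (intCast_mem ZOmega a)
    | succ n ih =>
      rw [← two_mul_mem_filt]
      convert ih using 1
      · push_cast; ring_nf
      · rw [pow_succ]; field_simp
  have hadd : ∀ x y, (∃ e : ℕ, x ∈ filt (-e)) → (∃ e : ℕ, y ∈ filt (-e)) →
      ∃ e : ℕ, x + y ∈ filt (-e) := by
    rintro x y ⟨e, hx⟩ ⟨e', hy⟩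
    exact ⟨max e e', add_mem (filt_anti (by simp) hx) (filt_anti (by simp) hy)⟩
  have hmul : ∀ x (m : ℕ), (∃ e : ℕ, x ∈ filt (-e)) → ∃ e : ℕ, x * omega ^ m ∈ filt (-e) := by
    rintro x m ⟨e, hx⟩
    exact ⟨e, by rwa [mul_comm, omega_pow_mul_mem_filt]⟩
  obtain ⟨a, ha, b, hb, c, hc, d, hd, rfl⟩ := hz
  refine hadd _ _ (hadd _ _ (hadd _ _ (hmul _ 3 (hD a ha)) (hmul _ 2 (hD b hb))) ?_) (hD d hd)
  simpa using hmul _ 1 (hD c hc)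

theorem coord_mul_star (a b c d : ℤ) :
    ((a : ℂ) * omega ^ 3 + b * omega ^ 2 + c * omega + d)
      * star ((a : ℂ) * omega ^ 3 + b * omega ^ 2 + c * omega + d)
      = (a ^ 2 + b ^ 2 + c ^ 2 + d ^ 2) + (a * b + b * c + c * d - a * d) * sqrtTwo := by
  have hw : star ((a : ℂ) * omega ^ 3 + b * omega ^ 2 + c * omega + d)
      = - c * omega ^ 3 - b * omega ^ 2 - a * omega + d := by
    simp only [star_add, star_mul', star_pow, star_omega, omega_inv, star_intCast]
    linear_combination (-a * omega ^ 5 + b * omega ^ 2 + a * omega) * omega_pow_four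
  rw [hw, sqrtTwo_eq]
  linear_combination (-a * c * omega ^ 2 - (a * b + b * c) * omega - a ^ 2 - b ^ 2 - c ^ 2)
    * omega_pow_four

/-- The rational part of `|aω³ + bω² + cω + d|²` is `a² + b² + c² + d²`. -/
theorem sum_coord_sq {ι : Type*} (s : Finset ι) (a b c d : ι → ℤ) (N : ℤ)
    (h : ∑ i ∈ s, ((a i : ℂ) * omega ^ 3 + b i * omega ^ 2 + c i * omega + d i)
      * star ((a i : ℂ) * omega ^ 3 + b i * omega ^ 2 + c i * omega + d i) = N) :
    ∑ i ∈ s, (a i ^ 2 + b i ^ 2 + c i ^ 2 + d i ^ 2) = N := by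
  simp only [coord_mul_star, Finset.sum_add_distrib (s := s) (M := ℂ), ← Finset.sum_mul] at h
  set p : ℤ := ∑ i ∈ s, (a i * b i + b i * c i + c i * d i - a i * d i) with hp
  set q : ℤ := ∑ i ∈ s, (a i ^ 2 + b i ^ 2 + c i ^ 2 + d i ^ 2) with hq
  have h' : (q : ℂ) + p * (omega - omega ^ 3) = N := by
    rw [← h, hq, hp, sqrtTwo_eq]; push_cast
    simp only [Finset.sum_add_distrib]
  have := int_coord_eq_zero (a := -p) (b := 0) (c := p) (d := q - N) (by
    push_cast; linear_combination h')
  omega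

/-- A vector over `ℤ[ω]` whose squared absolute values add up to the integer `N` has at most `N`
nonzero entries. -/
theorem card_ne_zero_le {ι : Type*} (s : Finset ι) (v : ι → ℂ) (hv : ∀ i, v i ∈ ZOmega) (N : ℤ)
    (h : ∑ i ∈ s, v i * star (v i) = N) (h0 : ∀ i ∈ s, v i ≠ 0) : (s.card : ℤ) ≤ N := by
  choose a b c d hz using hv
  have hsum := sum_coord_sq s a b c d N (by rw [← h]; simp only [← hz])
  rw [← hsum, Finset.card_eq_sum_ones, Nat.cast_sum]
  refine Finset.sum_le_sum fun i hi => ?_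
  by_contra hlt
  have hsq : a i ^ 2 = 0 ∧ b i ^ 2 = 0 ∧ c i ^ 2 = 0 ∧ d i ^ 2 = 0 := by
    have := sq_nonneg (a i); have := sq_nonneg (b i)
    have := sq_nonneg (c i); have := sq_nonneg (d i)
    push_cast at hlt
    omega
  simp only [sq_eq_zero_iff] at hsq
  exact h0 i hi (by rw [hz i, hsq.1, hsq.2.1, hsq.2.2.1, hsq.2.2.2]; simp)

/-- The elements of `ℤ[ω]` of absolute value one are the powers of `ω`. -/
theorem eq_omega_pow_of_norm_one {z : ℂ} (hz : z ∈ ZOmega) (h : z * star z = 1) :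
    ∃ n : ℕ, z = omega ^ n := by
  obtain ⟨a, b, c, d, rfl⟩ := hz
  have hq := sum_coord_sq {()} (fun _ => a) (fun _ => b) (fun _ => c) (fun _ => d) 1 (by simpa using h)
  simp only [Finset.sum_singleton] at hq
  have bd : ∀ x : ℤ, x ^ 2 ≤ 1 → x = -1 ∨ x = 0 ∨ x = 1 := fun x hx => by
    have : -1 ≤ x := by nlinarith
    have : x ≤ 1 := by nlinarith
    omega
  have := sq_nonneg a; have := sq_nonneg b; have := sq_nonneg c; have := sq_nonneg d
  have h5 : omega ^ 5 = -omega := by linear_combination omega * omega_pow_four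
  have h6 : omega ^ 6 = -omega ^ 2 := by linear_combination omega ^ 2 * omega_pow_four
  have h7 : omega ^ 7 = -omega ^ 3 := by linear_combination omega ^ 3 * omega_pow_four
  have h4 := omega_pow_four
  rcases bd a (by omega) with rfl | rfl | rfl <;> rcases bd b (by omega) with rfl | rfl | rfl <;>
    rcases bd c (by omega) with rfl | rfl | rfl <;>
    rcases bd d (by omega) with rfl | rfl | rfl <;> norm_num at hq
  · exact ⟨7, by simp [h7]⟩
  · exact ⟨6, by simp [h6]⟩
  · exact ⟨5, by simp [h5]⟩
  · exact ⟨4, by simp [h4]⟩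
  · exact ⟨0, by simp⟩
  · exact ⟨1, by simp⟩
  · exact ⟨2, by simp⟩
  · exact ⟨3, by simp⟩


/-! ### The generators as operators on vectors -/

/-- The action of `X_[i,j]` on vectors; there is no condition on `i`, `j`. -/
def opX {n : ℕ} (i j : Fin n) (v : Fin n → ℂ) : Fin n → ℂ := fun l => v (Equiv.swap i j l)

/-- The action of `ω_[i]` on vectors. -/
def opW {n : ℕ} (i : Fin n) (v : Fin n → ℂ) : Fin n → ℂ :=
  fun l => if l = i then omega * v l else v l

/-- The action of `H_[i,j]` on vectors, for `i ≠ j` in either order. -/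
def opH {n : ℕ} (i j : Fin n) (v : Fin n → ℂ) : Fin n → ℂ := fun l =>
  if l = i then (v i + v j) / sqrtTwo else if l = j then (v i - v j) / sqrtTwo else v l

theorem opH_left {n : ℕ} (i j : Fin n) (v : Fin n → ℂ) :
    opH i j v i = (v i + v j) / sqrtTwo := by simp [opH]

theorem opH_right {n : ℕ} {i j : Fin n} (h : i ≠ j) (v : Fin n → ℂ) :
    opH i j v j = (v i - v j) / sqrtTwo := by simp [opH, h.symm]

theorem opH_other {n : ℕ} {i j l : Fin n} (hi : l ≠ i) (hj : l ≠ j) (v : Fin n → ℂ) :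
    opH i j v l = v l := by simp [opH, hi, hj]

theorem opW_iterate {n : ℕ} (i : Fin n) (m : ℕ) (v : Fin n → ℂ) :
    (opW i)^[m] v = fun l => if l = i then omega ^ m * v l else v l := by
  induction m with
  | zero => funext l; simp
  | succ m ih =>
    rw [Function.iterate_succ_apply', ih]
    funext l
    by_cases h : l = i <;> simp [opW, h, pow_succ]; ring

/-! ### The level of a vector -/

/-- The vector has entries in `ℤ[ω][1/2] = ⋃ filt (-e)`. -/
def IsDyadicVec (v : Fin 4 → ℂ) : Prop := ∃ e : ℕ, ∀ i, v i ∈ filt (-e)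

/-- The least denominator exponent of a vector, with respect to the prime `δ = 1 + ω`. -/
def denExp (v : Fin 4 → ℂ) : ℕ := sInf {e : ℕ | ∀ i, v i ∈ filt (-e)}

open Classical in
/-- The coordinates at which the denominator `δ ^ e` is needed. -/
def tops (v : Fin 4 → ℂ) (e : ℕ) : Finset (Fin 4) := {i | v i ∉ filt (-e + 1)}

/-- The level of a vector: the denominator exponent and the number of coordinates at which it is
attained, in lexicographic order, encoded in a natural number. -/
def level (v : Fin 4 → ℂ) : ℕ := 5 * denExp v + (tops v (denExp v)).card

theorem mem_tops {v : Fin 4 → ℂ} {e : ℕ} {i : Fin 4} : i ∈ tops v e ↔ v i ∉ filt (-e + 1) := by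
  simp [tops]

theorem card_tops_le (v : Fin 4 → ℂ) (e : ℕ) : (tops v e).card ≤ 4 := by
  simpa using Finset.card_le_univ (tops v e)

theorem mem_filt_denExp {v : Fin 4 → ℂ} (hv : IsDyadicVec v) (i : Fin 4) :
    v i ∈ filt (-(denExp v)) := Nat.sInf_mem (s := {e : ℕ | ∀ i, v i ∈ filt (-e)}) hv i

theorem denExp_le {v : Fin 4 → ℂ} {e : ℕ} (h : ∀ i, v i ∈ filt (-e)) : denExp v ≤ e := Nat.sInf_le h

theorem tops_nonempty {v : Fin 4 → ℂ} (h : denExp v ≠ 0) : (tops v (denExp v)).Nonempty := by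
  by_contra hne
  rw [Finset.not_nonempty_iff_eq_empty, Finset.eq_empty_iff_forall_notMem] at hne
  obtain ⟨k, hk⟩ := Nat.exists_eq_succ_of_ne_zero h
  have := denExp_le (v := v) (e := k) fun i => by
    have := hne i
    rw [mem_tops, not_not, hk] at this
    convert this using 2; push_cast; ring
  omega

theorem level_le {v : Fin 4 → ℂ} {e : ℕ} (h : ∀ i, v i ∈ filt (-e)) :
    level v ≤ 5 * e + (tops v e).card := by
  rcases (denExp_le h).lt_or_eq with h' | h'
  · have := card_tops_le v (denExp v)
    rw [level]; omega
  · rw [level, h']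

theorem le_level {v : Fin 4 → ℂ} (hv : IsDyadicVec v) {e : ℕ} (h : (tops v e).Nonempty) :
    5 * e + (tops v e).card ≤ level v := by
  obtain ⟨i, hi⟩ := h
  rw [mem_tops] at hi
  have : e ≤ denExp v := by
    by_contra hlt
    exact hi (filt_anti (by omega) (mem_filt_denExp hv i))
  rcases this.lt_or_eq with h' | h'
  · have := card_tops_le v e
    rw [level]; omega
  · rw [level, ← h']

theorem five_le_level_iff {v : Fin 4 → ℂ} : 5 ≤ level v ↔ denExp v ≠ 0 := by
  have := card_tops_le v (denExp v)
  rw [level]; omega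

theorem level_lt_of_forall_mem {v w : Fin 4 → ℂ} (he : denExp v ≠ 0)
    (hw : ∀ i, w i ∈ filt (-(denExp v) + 1)) : level w < level v := by
  obtain ⟨k, hk⟩ := Nat.exists_eq_succ_of_ne_zero he
  have h1 := level_le (v := w) (e := k) fun i => by
    have := hw i
    rw [hk] at this
    convert this using 2; push_cast; ring
  have := card_tops_le w k
  rw [level.eq_def v, hk]; omega

theorem IsDyadicVec.opX {v : Fin 4 → ℂ} (hv : IsDyadicVec v) (i j : Fin 4) :
    IsDyadicVec (opX i j v) := by
  obtain ⟨e, he⟩ := hv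
  exact ⟨e, fun l => he _⟩

theorem opW_apply_mem_filt {v : Fin 4 → ℂ} {i l : Fin 4} {r : ℤ} :
    opW i v l ∈ filt r ↔ v l ∈ filt r := by
  rw [opW]; split_ifs
  · exact omega_mul_mem_filt
  · rfl

theorem IsDyadicVec.opW {v : Fin 4 → ℂ} (hv : IsDyadicVec v) (i : Fin 4) :
    IsDyadicVec (opW i v) := by
  obtain ⟨e, he⟩ := hv
  exact ⟨e, fun l => opW_apply_mem_filt.2 (he l)⟩

theorem IsDyadicVec.opH {v : Fin 4 → ℂ} (hv : IsDyadicVec v) (i j : Fin 4) :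
    IsDyadicVec (opH i j v) := by
  obtain ⟨e, he⟩ := hv
  refine ⟨e + 2, fun l => ?_⟩
  have h2 : -((e + 2 : ℕ) : ℤ) + 2 = -e := by push_cast; ring
  rw [CliffordT.opH]; split_ifs
  · rw [div_sqrtTwo_mem_filt, h2]; exact add_mem (he i) (he j)
  · rw [div_sqrtTwo_mem_filt, h2]; exact sub_mem (he i) (he j)
  · exact filt_anti (by push_cast; omega) (he l)

theorem denExp_opX (i j : Fin 4) (v : Fin 4 → ℂ) : denExp (opX i j v) = denExp v := by
  rw [denExp, denExp]
  congr 1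
  ext e
  exact ⟨fun h l => by simpa [opX] using h (Equiv.swap i j l), fun h l => h _⟩

theorem level_opX (i j : Fin 4) (v : Fin 4 → ℂ) : level (opX i j v) = level v := by
  rw [level, level, denExp_opX]
  congr 1
  refine Finset.card_bij' (fun l _ => Equiv.swap i j l) (fun l _ => Equiv.swap i j l) ?_ ?_ ?_ ?_
  · intro l hl; rw [mem_tops] at *; exact hl
  · intro l hl; rw [mem_tops] at *; simpa [opX] using hl
  · simp
  · simp

theorem denExp_opW (i : Fin 4) (v : Fin 4 → ℂ) : denExp (opW i v) = denExp v := by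
  simp only [denExp, opW_apply_mem_filt]

theorem tops_opW (i : Fin 4) (v : Fin 4 → ℂ) (e : ℕ) : tops (opW i v) e = tops v e := by
  ext l; rw [mem_tops, mem_tops, opW_apply_mem_filt]

theorem level_opW (i : Fin 4) (v : Fin 4 → ℂ) : level (opW i v) = level v := by
  rw [level, level, denExp_opW, tops_opW]

theorem iterate_opW_invariants (i : Fin 4) (m : ℕ) (v : Fin 4 → ℂ) :
    denExp ((opW i)^[m] v) = denExp v ∧ (∀ e, tops ((opW i)^[m] v) e = tops v e) ∧
      (IsDyadicVec v → IsDyadicVec ((opW i)^[m] v)) := by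
  induction m with
  | zero => simp
  | succ m ih =>
    rw [Function.iterate_succ_apply']
    exact ⟨by rw [denExp_opW, ih.1], fun e => by rw [tops_opW, ih.2.1], fun h => (ih.2.2 h).opW i⟩

theorem level_iterate_opW (i : Fin 4) (m : ℕ) (v : Fin 4 → ℂ) :
    level ((opW i)^[m] v) = level v := by
  rw [level, level, (iterate_opW_invariants i m v).1, (iterate_opW_invariants i m v).2.1]

/-- If `H_[i,j]` does not raise the level, then it does not raise the denominator exponent. -/
theorem mem_filt_of_level_opH_le {v : Fin 4 → ℂ} (hv : IsDyadicVec v) {i j : Fin 4} (hij : i ≠ j)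
    (h : level (opH i j v) ≤ level v) :
    v i + v j ∈ filt (-(denExp v) + 2) ∧ v i - v j ∈ filt (-(denExp v) + 2) := by
  have key : ∀ l, opH i j v l ∈ filt (-(denExp v)) := by
    intro l
    by_contra hl
    have h1 := le_level (hv.opH i j) (e := denExp v + 1) ⟨l, by
      rw [mem_tops]; convert hl using 3; push_cast; ring⟩
    have h2 := card_tops_le v (denExp v)
    rw [level.eq_def v] at h
    omega
  have hi := key i
  have hj := key j
  rw [opH_left, div_sqrtTwo_mem_filt] at hi
  rw [opH_right hij, div_sqrtTwo_mem_filt] at hj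
  exact ⟨hi, hj⟩

/-- If `H_[i,j]` does not raise the level and acts on coordinates with smaller denominators, then
it does not change the level. -/
theorem opH_of_notMem_tops {v : Fin 4 → ℂ} (hv : IsDyadicVec v) (he : denExp v ≠ 0)
    {i j : Fin 4} (hij : i ≠ j) (hi : i ∉ tops v (denExp v)) (hj : j ∉ tops v (denExp v))
    (h : level (opH i j v) ≤ level v) :
    level (opH i j v) = level v ∧ denExp (opH i j v) = denExp v ∧
      tops v (denExp v) ⊆ tops (opH i j v) (denExp v) := by
  obtain ⟨h1, h2⟩ := mem_filt_of_level_opH_le hv hij h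
  have hsub : tops v (denExp v) ⊆ tops (opH i j v) (denExp v) := by
    intro l hl
    have hli : l ≠ i := fun h => hi (h ▸ hl)
    have hlj : l ≠ j := fun h => hj (h ▸ hl)
    rw [mem_tops] at hl ⊢
    rwa [opH_other hli hlj]
  have hlow := le_level (hv.opH i j) ((tops_nonempty he).mono hsub)
  have hcard := Finset.card_le_card hsub
  have heq : level (opH i j v) = level v := by
    refine le_antisymm h ?_
    rw [level.eq_def v]; omega
  refine ⟨heq, le_antisymm (denExp_le fun l => ?_) ?_, hsub⟩
  · rw [opH]; split_ifs
    · rwa [div_sqrtTwo_mem_filt]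
    · rwa [div_sqrtTwo_mem_filt]
    · exact mem_filt_denExp hv l
  · have h3 := card_tops_le (opH i j v) (denExp (opH i j v))
    have h4 := (tops_nonempty he).card_pos
    simp only [level] at heq
    omega

/-- `H_[i,j]` lowers the level exactly if both coordinates have maximal denominator and agree
modulo `δ ^ 3`, relative to that denominator. -/
theorem level_opH_lt_iff {v : Fin 4 → ℂ} (hv : IsDyadicVec v) (he : denExp v ≠ 0)
    {i j : Fin 4} (hij : i ≠ j) :
    level (opH i j v) < level v ↔ i ∈ tops v (denExp v) ∧ j ∈ tops v (denExp v) ∧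
      v i - v j ∈ filt (-(denExp v) + 3) := by
  have hm := mem_filt_denExp hv
  constructor
  · intro hlt
    obtain ⟨h1, h2⟩ := mem_filt_of_level_opH_le hv hij hlt.le
    by_cases hi : i ∈ tops v (denExp v)
    · have hj : j ∈ tops v (denExp v) := by
        rw [mem_tops] at hi ⊢
        intro hj
        exact hi (by simpa using add_mem (filt_anti (by omega) h2) hj)
      refine ⟨hi, hj, ?_⟩
      by_contra h3
      -- otherwise both new entries have maximal denominator
      have h4 : v i + v j ∉ filt (-(denExp v) + 3) := by
        intro h4
        apply h3
        have h5 : 2 * v j ∈ filt (-(denExp v) + 3) :=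
          filt_anti (by omega) (two_mul_mem_filt.2 (hm j))
        have := sub_mem h4 h5
        convert this using 1; ring
      have hsub : tops v (denExp v) ⊆ tops (opH i j v) (denExp v) := by
        intro l hl
        rw [mem_tops] at hl ⊢
        rw [opH]; split_ifs
        · rwa [div_sqrtTwo_mem_filt, add_assoc]
        · rwa [div_sqrtTwo_mem_filt, add_assoc]
        · exact hl
      have := le_level (hv.opH i j) ((tops_nonempty he).mono hsub)
      have := Finset.card_le_card hsub
      rw [level.eq_def v] at hlt
      omega
    · have hj : j ∉ tops v (denExp v) := by
        rw [mem_tops, not_not] at hi ⊢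
        simpa using sub_mem hi (filt_anti (by omega) h2)
      have := (opH_of_notMem_tops hv he hij hi hj hlt.le).1
      omega
  · rintro ⟨hi, hj, h3⟩
    have h4 : v i + v j ∈ filt (-(denExp v) + 3) := by
      have := add_mem h3 (filt_anti (r := -(denExp v) + 3) (by omega) (two_mul_mem_filt.2 (hm j)))
      convert this using 1; ring
    have hi' : opH i j v i ∈ filt (-(denExp v) + 1) := by
      rwa [opH_left, div_sqrtTwo_mem_filt, add_assoc]
    have hj' : opH i j v j ∈ filt (-(denExp v) + 1) := by
      rwa [opH_right hij, div_sqrtTwo_mem_filt, add_assoc]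
    have h1 := level_le (v := opH i j v) (e := denExp v) fun l => by
      by_cases hli : l = i
      · rw [hli]; exact filt_anti (by omega) hi'
      by_cases hlj : l = j
      · rw [hlj]; exact filt_anti (by omega) hj'
      rw [opH_other hli hlj]; exact hm l
    have hss : tops (opH i j v) (denExp v) ⊂ tops v (denExp v) := by
      rw [Finset.ssubset_iff_of_subset]
      · exact ⟨i, hi, by rw [mem_tops, not_not]; exact hi'⟩
      · intro l hl
        have hli : l ≠ i := fun h => (mem_tops.1 hl) (h ▸ hi')
        have hlj : l ≠ j := fun h => (mem_tops.1 hl) (h ▸ hj')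
        rw [mem_tops] at hl ⊢
        rwa [opH_other hli hlj] at hl
    have := Finset.card_lt_card hss
    rw [level.eq_def v]
    omega

theorem level_opH_iterate_opW_lt_iff {v : Fin 4 → ℂ} (hv : IsDyadicVec v) (he : denExp v ≠ 0)
    {i j : Fin 4} (hij : i ≠ j) (m : ℕ) :
    level (opH i j ((opW j)^[m] v)) < level v ↔ i ∈ tops v (denExp v) ∧ j ∈ tops v (denExp v) ∧
      v i - omega ^ m * v j ∈ filt (-(denExp v) + 3) := by
  obtain ⟨h1, h2, h3⟩ := iterate_opW_invariants j m v
  have := level_opH_lt_iff (h3 hv) (by rwa [h1]) hij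
  rw [level_iterate_opW, h1, h2] at this
  rw [this, opW_iterate]
  simp [hij]

/-! ### Unit vectors -/

/-- Unit vectors with entries in `ℤ[ω][1/2]`. -/
def IsUnitVec (v : Fin 4 → ℂ) : Prop := IsDyadicVec v ∧ ∑ i, v i * star (v i) = 1

theorem sum_mem_filt_succ_iff {ι : Type*} (s : Finset ι) (a : ι → ℂ) (r : ℤ)
    (h : ∀ i ∈ s, a i ∈ filt r) (h' : ∀ i ∈ s, a i ∉ filt (r + 1)) :
    ∑ i ∈ s, a i ∈ filt (r + 1) ↔ Even s.card := by
  classical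
  induction s using Finset.induction_on with
  | empty => simp
  | insert i s hi ih =>
    have ih' := ih (fun j hj => h j (Finset.mem_insert_of_mem hj))
      (fun j hj => h' j (Finset.mem_insert_of_mem hj))
    rw [Finset.sum_insert hi, Finset.card_insert_of_notMem hi, Nat.even_add_one, ← ih']
    have hai := h i (Finset.mem_insert_self _ _)
    have hai' := h' i (Finset.mem_insert_self _ _)
    constructor
    · intro h1 h2
      exact hai' (by simpa using sub_mem h1 h2)
    · intro h2
      exact add_mem_filt_succ hai hai'
        (sum_mem fun j hj => h j (Finset.mem_insert_of_mem hj)) h2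

/-- The maximal denominator is attained at an even number of coordinates. -/
theorem even_card_tops {v : Fin 4 → ℂ} (hv : IsUnitVec v) (he : denExp v ≠ 0) :
    Even (tops v (denExp v)).card := by
  classical
  set r : ℤ := -(denExp v) with hr
  have hm : ∀ i, v i ∈ filt r := mem_filt_denExp hv.1
  rw [← sum_mem_filt_succ_iff _ (fun i => v i * star (v i)) (r + r)
    (fun i _ => mul_mem_filt (hm i) (star_mem_filt (hm i)))
    (fun i hi => mul_notMem_filt_succ (hm i) (mem_tops.1 hi) (star_mem_filt (hm i))
      (by rw [star_mem_filt_iff]; exact mem_tops.1 hi))]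
  have h1 := hv.2
  rw [← Finset.sum_add_sum_compl (tops v (denExp v))] at h1
  rw [eq_sub_of_add_eq h1]
  refine sub_mem (filt_anti (s := 0) (by omega) (mem_filt_zero.2 (one_mem _)))
    (sum_mem fun i hi => ?_)
  rw [Finset.mem_compl, mem_tops, not_not] at hi
  rw [add_right_comm]
  exact mul_mem_filt hi (star_mem_filt (hm i))

/-- Unit vectors over `ℤ[ω]` are standard basis vectors up to powers of `ω`. -/
theorem eq_single_of_denExp_eq_zero {v : Fin 4 → ℂ} (hv : IsUnitVec v) (he : denExp v = 0) :
    ∃ (l : Fin 4) (a : ℕ), v = Pi.single l (omega ^ a) := by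
  classical
  have hm : ∀ i, v i ∈ ZOmega := fun i => by
    have := mem_filt_denExp hv.1 i
    rw [he] at this
    simpa using mem_filt_zero.1 (by simpa using this)
  set s : Finset (Fin 4) := {i | v i ≠ 0} with hs
  have hsum : ∑ i ∈ s, v i * star (v i) = 1 := by
    rw [← hv.2]
    refine Finset.sum_subset (Finset.subset_univ _) fun i _ hi => ?_
    have : v i = 0 := by simpa [hs] using hi
    rw [this, zero_mul]
  have hcard := card_ne_zero_le s v hm 1 (by rw [hsum]; norm_num) (fun i hi => by simpa [hs] using hi)
  have hne : s.Nonempty := by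
    rw [Finset.nonempty_iff_ne_empty]
    intro h0
    rw [h0] at hsum
    simp at hsum
  have hpos := hne.card_pos
  obtain ⟨l, hl⟩ := Finset.card_eq_one.1 (show s.card = 1 by omega)
  rw [hl, Finset.sum_singleton] at hsum
  obtain ⟨a, ha⟩ := eq_omega_pow_of_norm_one (hm l) hsum
  refine ⟨l, a, funext fun i => ?_⟩
  by_cases hi : i = l
  · subst hi; rw [Pi.single_eq_same, ha]
  · rw [Pi.single_eq_of_ne hi]
    by_contra h0
    have : i ∈ s := by simpa [hs] using h0
    rw [hl] at this
    exact hi (by simpa using this)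

/-- If all four coordinates of a unit vector have maximal denominator and agree modulo `δ ^ 3`,
then the leading coefficients of their differences cancel. -/
theorem sum_mem_filt_of_forall_sub_mem {v : Fin 4 → ℂ} (hv : IsUnitVec v) (he : denExp v ≠ 0)
    (ht : ∀ i, i ∈ tops v (denExp v)) (h3 : ∀ i j, v i - v j ∈ filt (-(denExp v) + 3)) :
    ∑ i, v i ∈ filt (-(denExp v) + 4) := by
  set r : ℤ := -(denExp v) with hr
  have hm : ∀ i, v i ∈ filt r := mem_filt_denExp hv.1
  have ht' : ∀ i, v i ∉ filt (r + 1) := fun i => mem_tops.1 (ht i)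
  set x := v 0 with hx
  set T := ∑ i, (v i - x) with hT
  have hTm : T ∈ filt (r + 3) := sum_mem fun i _ => h3 i 0
  have h4x : 4 * x ∈ filt (r + 4 + 4) := by
    have := two_mul_mem_filt.2 (two_mul_mem_filt.2 (hm 0))
    convert this using 1; ring
  have hsum : ∑ i, v i = 4 * x + T := by
    rw [hT, Finset.sum_sub_distrib]; simp
  rw [hsum]
  refine add_mem (filt_anti (by omega) h4x) ?_
  by_contra hT4
  have hz := mul_mem_filt (star_mem_filt (hm 0)) hTm
  have hz' := mul_notMem_filt_succ (star_mem_filt (hm 0)) (by rw [star_mem_filt_iff]; exact ht' 0)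
    hTm (by rwa [add_assoc])
  rw [← hx] at hz hz'
  have hrest : 4 * x * star x + ∑ i, (v i - x) * star (v i - x) ∈ filt (r + (r + 3) + 2) := by
    refine add_mem (filt_anti (by omega) (mul_mem_filt h4x (star_mem_filt (hm 0))))
      (sum_mem fun i _ => filt_anti (by omega) (mul_mem_filt (h3 i 0) (star_mem_filt (h3 i 0))))
  have hone : star x * T + star (star x * T)
      + (4 * x * star x + ∑ i, (v i - x) * star (v i - x)) = 1 := by
    rw [← hv.2, hT]
    simp only [Fin.sum_univ_four, star_mul', star_add, star_sub, star_star]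
    ring
  have hodd : Odd (r + (r + 3)) := by rw [Int.odd_iff]; omega
  have htr := add_star_notMem_filt hodd hz hz'
  have hr0 : r ≤ -1 := by omega
  obtain h | h | h : r ≤ -3 ∨ r = -2 ∨ r = -1 := by omega
  · apply htr
    rw [eq_sub_of_add_eq hone]
    exact sub_mem (filt_anti (s := 0) (by omega) (mem_filt_zero.2 (one_mem _))) hrest
  · -- here `√2 v` has entries in `ℤ[ω]` and squared norm `2`, so it has a zero entry
    have hc := card_ne_zero_le Finset.univ (fun i => sqrtTwo * v i) (fun i => by
        rw [← mem_filt_zero, show (0 : ℤ) = r + 2 by omega, sqrtTwo_mul_mem_filt]; exact hm i) 2 (by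
        simp only [star_mul', star_sqrtTwo]
        have : ∀ i, sqrtTwo * v i * (sqrtTwo * star (v i)) = 2 * (v i * star (v i)) := fun i => by
          rw [← sqrtTwo_sq]; ring
        simp only [this, ← Finset.mul_sum, hv.2]; norm_num)
      (fun i _ => mul_ne_zero sqrtTwo_ne_zero fun h0 => ht' i (by rw [h0]; exact zero_mem _))
    simp at hc
  · apply one_notMem_filt_one
    rw [← hone]
    have h1 : star x * T ∈ filt 1 := filt_anti (by omega) hz
    exact add_mem (add_mem h1 (star_mem_filt h1)) (filt_anti (by omega) hrest)

/-- Four coordinates of maximal denominator can be normalized by powers of `ω` such that they agree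
modulo `δ ^ 3` and their sum vanishes modulo `δ ^ 5`. -/
theorem exists_normalization {v : Fin 4 → ℂ} (hv : IsUnitVec v) (he : denExp v ≠ 0)
    (ht : ∀ i, i ∈ tops v (denExp v)) :
    ∃ a : Fin 4 → ℕ, (∀ i j, omega ^ a i * v i - omega ^ a j * v j ∈ filt (-(denExp v) + 3)) ∧
      ∑ i, omega ^ a i * v i ∈ filt (-(denExp v) + 5) := by
  set r : ℤ := -(denExp v) with hr
  have hm : ∀ i, v i ∈ filt r := mem_filt_denExp hv.1
  have ht' : ∀ i, v i ∉ filt (r + 1) := fun i => mem_tops.1 (ht i)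
  choose a ha ha3 using fun i =>
    exists_sub_omega_pow_mul_mem_filt (hm 0) (ht' 0) (hm i) (ht' i)
  set u : Fin 4 → ℂ := fun i => omega ^ a i * v i with hu
  have hmem : ∀ i (s : ℤ), u i ∈ filt s ↔ v i ∈ filt s := fun i s => omega_pow_mul_mem_filt _
  have hdiff : ∀ i j, u i - u j ∈ filt (r + 3) := fun i j => by
    have := sub_mem (ha3 j) (ha3 i)
    convert this using 1; ring
  have hexp : denExp u = denExp v := by simp only [denExp, hmem]
  have hut : ∀ i, i ∈ tops u (denExp u) := fun i => by
    rw [mem_tops, hexp, hmem]; exact ht' i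
  have huv : IsUnitVec u := by
    obtain ⟨⟨e, h1⟩, h2⟩ := hv
    refine ⟨⟨e, fun i => (hmem i _).2 (h1 i)⟩, ?_⟩
    rw [← h2]
    refine Finset.sum_congr rfl fun i _ => ?_
    have : omega ^ a i * (omega⁻¹) ^ a i = 1 := by
      rw [← mul_pow, mul_inv_cancel₀ omega_ne_zero, one_pow]
    rw [hu, star_mul', star_pow, star_omega]
    linear_combination v i * star (v i) * this
  have hsum := sum_mem_filt_of_forall_sub_mem huv (by rwa [hexp]) hut (by rwa [hexp])
  rw [hexp, ← hr] at hsum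
  have h2u : 2 * u 3 ∈ filt (r + 4) := two_mul_mem_filt.2 ((hmem 3 _).2 (hm 3))
  by_cases h5 : ∑ i, u i ∈ filt (r + 5)
  · exact ⟨a, hdiff, h5⟩
  -- changing the sign of one coordinate changes the sum by an element of valuation `r + 4`
  have hflip : ∀ i, omega ^ (if i = 3 then a i + 4 else a i) * v i
      = if i = 3 then - u i else u i := fun i => by
    split_ifs
    · rw [hu, pow_add, omega_pow_four]; ring
    · rfl
  refine ⟨fun i => if i = 3 then a i + 4 else a i, fun i j => ?_, ?_⟩
  · have h2 : ∀ i, 2 * u i ∈ filt (r + 3) := fun i =>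
      filt_anti (by omega) (two_mul_mem_filt.2 ((hmem i _).2 (hm i)))
    rw [hflip, hflip]
    split_ifs
    · convert hdiff j i using 1; ring
    · convert sub_mem (hdiff j i) (h2 j) using 1; ring
    · convert add_mem (hdiff i j) (h2 j) using 1; ring
    · exact hdiff i j
  · have h2u' : 2 * u 3 ∉ filt (r + 4 + 1) := by
      rw [add_right_comm, two_mul_mem_filt, hmem]; exact ht' 3
    have := sub_mem_filt_succ hsum (by rwa [add_assoc]) h2u h2u'
    rw [show r + 4 + 1 = r + 5 by ring] at this
    simp only [hflip]
    convert this using 1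
    rw [Fin.sum_univ_four, Fin.sum_univ_four]
    simp only [Fin.reduceEq, if_true, if_false]
    ring

/-- If four coordinates agree modulo `δ ^ 3` and their sum vanishes modulo `δ ^ 5`, relative to the
common denominator, then the vectors on the path from `H_[p,q] v` through `H_[r,s] H_[p,q] v` to
`H_[q,s] H_[p,r] H_[r,s] H_[p,q] v` have lower level than `v`. -/
theorem level_square_lt {v : Fin 4 → ℂ} (hv : IsDyadicVec v) (he : denExp v ≠ 0)
    (ht : ∀ i, i ∈ tops v (denExp v)) (h3 : ∀ i j, v i - v j ∈ filt (-(denExp v) + 3))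
    (h5 : ∑ i, v i ∈ filt (-(denExp v) + 5)) {p q r s : Fin 4} (hpq : p ≠ q) (hpr : p ≠ r)
    (hps : p ≠ s) (hqr : q ≠ r) (hqs : q ≠ s) (hrs : r ≠ s) :
    level (opH p q v) < level v ∧ level (opH r s (opH p q v)) < level v ∧
      level (opH p r (opH r s (opH p q v))) < level v ∧
      level (opH q s (opH p r (opH r s (opH p q v)))) < level v := by
  have huniv : ∀ l, l = p ∨ l = q ∨ l = r ∨ l = s := by
    intro l; omega
  have hm := mem_filt_denExp hv
  have h3' : ∀ i j, v i + v j ∈ filt (-(denExp v) + 3) := fun i j => by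
    have := add_mem (h3 i j) (filt_anti (r := -(denExp v) + 3) (by omega) (two_mul_mem_filt.2 (hm j)))
    convert this using 1; ring
  have hsum : v p + v q + v r + v s ∈ filt (-(denExp v) + 5) := by
    convert h5 using 1
    have : (Finset.univ : Finset (Fin 4)) = {p, q, r, s} := by
      ext l; simpa using huniv l
    rw [this, Finset.sum_insert (by simp [*]), Finset.sum_insert (by simp [*]),
      Finset.sum_insert (by simp [*]), Finset.sum_singleton]
    ring
  have hsum' : ∀ i j, v p + v q + v r + v s - 2 * (v i + v j) ∈ filt (-(denExp v) + 5) :=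
    fun i j => sub_mem hsum (filt_anti (by omega) (two_mul_mem_filt.2 (h3' i j)))
  have hdiv : ∀ z, z / sqrtTwo / sqrtTwo ∈ filt (-(denExp v) + 1) ↔ z ∈ filt (-(denExp v) + 5) := by
    intro z
    rw [div_sqrtTwo_mem_filt, div_sqrtTwo_mem_filt]
    ring_nf
  have hdiv' : ∀ z, z / sqrtTwo ∈ filt (-(denExp v) + 1) ↔ z ∈ filt (-(denExp v) + 3) := by
    intro z
    rw [div_sqrtTwo_mem_filt, add_assoc]; norm_num
  refine ⟨(level_opH_lt_iff hv he hpq).2 ⟨ht _, ht _, h3 _ _⟩, level_lt_of_forall_mem he ?_,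
    level_lt_of_forall_mem he ?_, level_lt_of_forall_mem he ?_⟩
  · intro l
    rcases huniv l with rfl | rfl | rfl | rfl <;> simp only [opH, hpq, hpr, hps, hqr, hqs, hrs,
      hpq.symm, hpr.symm, hps.symm, hqr.symm, hqs.symm, hrs.symm, if_true, if_false, hdiv', h3, h3']
  · intro l
    rcases huniv l with rfl | rfl | rfl | rfl <;> simp only [opH, hpq, hpr, hps, hqr, hqs, hrs,
      hpq.symm, hpr.symm, hps.symm, hqr.symm, hqs.symm, hrs.symm, if_true, if_false,
      ← add_div, ← sub_div]
    · rw [hdiv]; convert hsum using 1; ring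
    · rw [hdiv']; exact h3 _ _
    · rw [hdiv]; convert hsum' l s using 1; ring
    · rw [hdiv']; exact h3 _ _
  · intro l
    rcases huniv l with rfl | rfl | rfl | rfl <;> simp only [opH, hpq, hpr, hps, hqr, hqs, hrs,
      hpq.symm, hpr.symm, hps.symm, hqr.symm, hqs.symm, hrs.symm, if_true, if_false,
      ← add_div, ← sub_div]
    · rw [hdiv]; convert hsum using 1; ring
    · rw [hdiv]; convert hsum' l s using 1; ring
    · rw [hdiv]; convert hsum' l s using 1; ring
    · rw [hdiv]; convert hsum' q r using 1; ring


/-! ### Symmetric generators of the presented group -/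

/-- The group presented by the generators and relations. -/
abbrev Pres (n : ℕ) : Type := PresentedGroup (relators n)

/-- The element of the presented group denoted by a word. -/
def Word.toPres {n : ℕ} : Word n →* Pres n := FreeMonoid.lift PresentedGroup.of

theorem Word.toPres_eq_mk {n : ℕ} (u : Word n) :
    Word.toPres u = PresentedGroup.mk (relators n) (FreeMonoid.lift FreeGroup.of u) := by
  have : Word.toPres = (PresentedGroup.mk (relators n)).comp (FreeMonoid.lift FreeGroup.of) :=
    FreeMonoid.hom_eq fun g => by simp [Word.toPres]; rfl
  rw [this]; rfl

theorem Word.toPres_eq_of_rel {n : ℕ} {u v : Word n} (h : Rel n u v) :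
    Word.toPres u = Word.toPres v := by
  rw [Word.toPres_eq_mk, Word.toPres_eq_mk, ← mul_inv_eq_one, ← map_inv, ← map_mul]
  exact PresentedGroup.one_of_mem ⟨u, v, h, rfl⟩

section Generators

variable {n : ℕ}

/-- `ω_[i]` in the presented group. -/
def gW (i : Fin n) : Pres n := PresentedGroup.of (.W i)

/-- `X_[i,j]` in the presented group, for `i` and `j` in either order; it is `1` for `i = j`. -/
def gX (i j : Fin n) : Pres n :=
  if h : i < j then PresentedGroup.of (.X i j h)
  else if h : j < i then PresentedGroup.of (.X j i h) else 1

/-- `H_[i,j]` in the presented group. For `j < i` it is defined as the conjugate of `H_[j,i]` by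
`X_[j,i]`, and for `i = j` as `1`. -/
def gH (i j : Fin n) : Pres n :=
  if h : i < j then PresentedGroup.of (.H i j h)
  else if h : j < i then gX i j * PresentedGroup.of (.H j i h) * gX i j else 1

theorem toPres_wW (i : Fin n) : Word.toPres (wW i) = gW i := by simp [Word.toPres, wW, gW]

theorem toPres_wX {i j : Fin n} (h : i < j) : Word.toPres (wX i j h) = gX i j := by
  simp [Word.toPres, wX, gX, h]

theorem toPres_wH {i j : Fin n} (h : i < j) : Word.toPres (wH i j h) = gH i j := by
  simp [Word.toPres, wH, gH, h]

theorem gX_self (i : Fin n) : gX i i = 1 := by simp [gX]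

theorem gX_comm (i j : Fin n) : gX i j = gX j i := by
  rcases lt_trichotomy i j with h | rfl | h
  · simp [gX, h, h.not_gt]
  · rfl
  · simp [gX, h, h.not_gt]

theorem gX_mul_self (i j : Fin n) : gX i j * gX i j = 1 := by
  have key : ∀ i j : Fin n, i < j → gX i j * gX i j = 1 := fun i j h => by
    simpa [toPres_wX, pow_two] using Word.toPres_eq_of_rel (Rel.X_order i j h)
  rcases lt_trichotomy i j with h | rfl | h
  · exact key i j h
  · simp [gX_self]
  · rw [gX_comm]; exact key j i h

theorem gX_mul_cancel (i j : Fin n) (g : Pres n) : gX i j * (gX i j * g) = g := by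
  rw [← mul_assoc, gX_mul_self, one_mul]

theorem gX_inv (i j : Fin n) : (gX i j)⁻¹ = gX i j := inv_eq_of_mul_eq_one_left (gX_mul_self i j)

theorem gW_pow_eight (i : Fin n) : gW i ^ 8 = 1 := by
  simpa [toPres_wW] using Word.toPres_eq_of_rel (Rel.W_order i)

theorem gW_comm (i j : Fin n) : gW i * gW j = gW j * gW i := by
  by_cases h : i = j
  · rw [h]
  · simpa [toPres_wW] using Word.toPres_eq_of_rel (Rel.W_W i j h)

/-- Conjugation by `X_[i,j]`. -/
def conjX (i j : Fin n) : Pres n →* Pres n := (MulAut.conj (gX i j)).toMonoidHom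

theorem conjX_apply (i j : Fin n) (g : Pres n) : conjX i j g = gX i j * g * gX i j := by
  simp [conjX, gX_inv]

theorem conjX_conjX (i j : Fin n) (g : Pres n) : conjX i j (conjX i j g) = g := by
  simp only [conjX_apply, mul_assoc, gX_mul_self, mul_one, gX_mul_cancel]

theorem conjX_symm (i j : Fin n) : conjX i j = conjX j i := by
  rw [conjX, conjX, gX_comm]

theorem conjX_eq_iff {i j : Fin n} {g h : Pres n} : conjX i j g = h ↔ gX i j * g = h * gX i j := by
  rw [conjX_apply]
  constructor
  · rintro rfl; simp [mul_assoc, gX_mul_self]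
  · intro h'; rw [h', mul_assoc, gX_mul_self, mul_one]

theorem conjX_gW (i j l : Fin n) : conjX i j (gW l) = gW (Equiv.swap i j l) := by
  have key : ∀ i j : Fin n, i < j → conjX i j (gW l) = gW (Equiv.swap i j l) := fun i j h => by
    rw [conjX_eq_iff]
    by_cases hi : l = i
    · subst hi
      simpa [toPres_wX, toPres_wW] using Word.toPres_eq_of_rel (Rel.X_W_left l j h)
    by_cases hj : l = j
    · subst hj
      simpa [toPres_wX, toPres_wW] using Word.toPres_eq_of_rel (Rel.X_W_right i l h)
    rw [Equiv.swap_apply_of_ne_of_ne hi hj]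
    simpa [toPres_wX, toPres_wW] using (Word.toPres_eq_of_rel (Rel.W_X l i j h hi hj)).symm
  rcases lt_trichotomy i j with h | rfl | h
  · exact key i j h
  · simp [conjX_apply, gX_self]
  · rw [conjX_symm, Equiv.swap_comm]; exact key j i h

theorem conj_eq_of_involutions {G : Type*} [Group G] {a b c : G} (ha : a * a = 1)
    (h1 : a * b * a = c) (h2 : c * a * c = b) : b * a * b = c := by
  have hb : a * b * a * b * a = b := by
    rw [← h1] at h2
    calc a * b * a * b * a = a * b * (a * a) * a * b * a := by rw [ha, mul_one]
      _ = a * b * a * a * (a * b * a) := by simp only [mul_assoc]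
      _ = b := h2
  calc b * a * b = a * a * b * a * b * (a * a) := by rw [ha, one_mul, mul_one]
    _ = a * (a * b * a * b * a) * a := by simp only [mul_assoc]
    _ = c := by rw [hb, h1]

theorem conjX_gX_of_ne {a b c : Fin n} (hab : a ≠ b) (hac : a ≠ c) (hbc : b ≠ c) :
    conjX a b (gX a c) = gX b c := by
  have up : ∀ {a b c : Fin n}, a < b → b < c → conjX a b (gX a c) = gX b c := fun h h' => by
    rw [conjX_eq_iff]
    simpa [toPres_wX] using Word.toPres_eq_of_rel (Rel.X_X_up _ _ _ h h')
  have down : ∀ {a b c : Fin n}, a < b → b < c → conjX b c (gX a b) = gX a c := fun h h' => by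
    rw [conjX_eq_iff]
    simpa [toPres_wX] using Word.toPres_eq_of_rel (Rel.X_X_down _ _ _ h h')
  have mid : ∀ {a b c : Fin n}, a < b → b < c → conjX a c (gX a b) = gX b c := fun h h' => by
    rw [conjX_apply]
    exact conj_eq_of_involutions (gX_mul_self _ _) (by rw [← conjX_apply, up h h'])
      (by rw [← conjX_apply, down h h'])
  have inv : ∀ {i j : Fin n} {g h : Pres n}, conjX i j g = h → conjX i j h = g := by
    rintro i j g _ rfl; exact conjX_conjX i j g
  rcases hab.lt_or_gt with h1 | h1 <;> rcases hac.lt_or_gt with h2 | h2 <;>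
    rcases hbc.lt_or_gt with h3 | h3
  · exact up h1 h3
  · rw [gX_comm b c]; exact mid h2 h3
  · exact absurd (h1.trans h3) h2.not_gt
  · rw [gX_comm a c, gX_comm b c]; exact down h2 h1
  · rw [conjX_symm]; exact inv (up h1 h2)
  · exact absurd (h3.trans h1) h2.not_gt
  · rw [conjX_symm, gX_comm a c]; exact inv (mid h3 h2)
  · rw [conjX_symm, gX_comm a c, gX_comm b c]; exact inv (down h3 h1)

/-- `X_[i,j]` acts on the generators `X_[k,l]` by permuting the indices. -/
theorem conjX_gX (i j k l : Fin n) :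
    conjX i j (gX k l) = gX (Equiv.swap i j k) (Equiv.swap i j l) := by
  by_cases hij : i = j
  · subst hij; simp [conjX_apply, gX_self]
  by_cases hkl : k = l
  · subst hkl; simp [gX_self]
  by_cases hki : k = i
  · subst hki
    by_cases hlj : l = j
    · subst hlj; simp [conjX_apply, gX_mul_self, gX_comm]
    · rw [conjX_gX_of_ne hij hkl (Ne.symm hlj), Equiv.swap_apply_left,
        Equiv.swap_apply_of_ne_of_ne (Ne.symm hkl) hlj]
  by_cases hkj : k = j
  · subst hkj
    by_cases hli : l = i
    · subst hli; simp [conjX_apply, gX_mul_self, gX_comm]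
    · rw [conjX_symm, conjX_gX_of_ne hki hkl (Ne.symm hli), Equiv.swap_apply_right,
        Equiv.swap_apply_of_ne_of_ne hli (Ne.symm hkl)]
  rw [Equiv.swap_apply_of_ne_of_ne hki hkj]
  by_cases hli : l = i
  · subst hli
    rw [gX_comm, conjX_gX_of_ne hij (Ne.symm hkl) (Ne.symm hkj), Equiv.swap_apply_left, gX_comm]
  by_cases hlj : l = j
  · subst hlj
    rw [gX_comm, conjX_symm, conjX_gX_of_ne (Ne.symm hij) (Ne.symm hkl) (Ne.symm hki),
      Equiv.swap_apply_right, gX_comm]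
  rw [Equiv.swap_apply_of_ne_of_ne hli hlj, conjX_eq_iff]
  have key : ∀ {i j k l : Fin n}, i < j → k < l → k ≠ i → k ≠ j → l ≠ i → l ≠ j →
      gX i j * gX k l = gX k l * gX i j := fun {i j k l} h h' h1 h2 h3 h4 => by
    simpa [toPres_wX] using Word.toPres_eq_of_rel (Rel.X_X i j k l h h'
      (by simp [h1.symm, h2.symm, h3.symm, h4.symm]))
  rcases lt_or_gt_of_ne hij with h | h <;> rcases lt_or_gt_of_ne hkl with h' | h'
  · exact key h h' hki hkj hli hlj
  · rw [gX_comm k l]; exact key h h' hli hlj hki hkj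
  · rw [gX_comm i j]; exact key h h' hkj hki hlj hli
  · rw [gX_comm i j, gX_comm k l]; exact key h h' hlj hli hkj hki

theorem gH_self (i : Fin n) : gH i i = 1 := by simp [gH]

theorem conjX_gH_self (i j : Fin n) : conjX i j (gH i j) = gH j i := by
  rw [conjX_apply]
  rcases lt_trichotomy i j with h | rfl | h
  · simp [gH, h, h.not_gt, gX_comm]
  · simp [gX_self]
  · rw [gH, dif_neg h.not_gt, dif_pos h, gH, dif_pos h]
    simp only [mul_assoc, gX_mul_self, gX_mul_cancel, mul_one]

theorem conjX_gH_of_ne {a b c : Fin n} (hab : a ≠ b) (hac : a ≠ c) (hbc : b ≠ c) :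
    conjX a b (gH a c) = gH b c := by
  have up : ∀ {a b c : Fin n}, a < b → b < c → conjX a b (gH a c) = gH b c := fun h h' => by
    rw [conjX_eq_iff]
    simpa [toPres_wX, toPres_wH] using Word.toPres_eq_of_rel (Rel.X_H_up _ _ _ h h')
  have down : ∀ {a b c : Fin n}, a < b → b < c → conjX b c (gH a b) = gH a c := fun h h' => by
    rw [conjX_eq_iff]
    simpa [toPres_wX, toPres_wH] using Word.toPres_eq_of_rel (Rel.X_H_down _ _ _ h h')
  have inv : ∀ {i j : Fin n} {g h : Pres n}, conjX i j g = h → conjX i j h = g := by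
    rintro i j g _ rfl; exact conjX_conjX i j g
  -- the order of the indices of `H` may be reversed on both sides
  have flip : ∀ {i j k l k' l' : Fin n}, conjX i j (gX k l) = gX k' l' →
      conjX i j (gH k l) = gH k' l' → conjX i j (gH l k) = gH l' k' := fun {i j k l k' l'} h h' => by
    rw [← conjX_gH_self k l, ← conjX_gH_self k' l', ← h', conjX_apply k l, conjX_apply k' l', map_mul,
      map_mul, h]
  have mid : ∀ {a b c : Fin n}, a < b → b < c → conjX a c (gH a b) = gH c b := fun {a b c} h h' => by
    have hX : ∀ g, conjX a c g = conjX a b (conjX b c (conjX a b g)) := fun g => by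
      have hac : gX a c = gX a b * gX b c * gX a b := by
        rw [← conjX_apply, conjX_symm, conjX_gX_of_ne h.ne' h'.ne (h.trans h').ne]
      rw [conjX_apply, hac]
      simp only [conjX_apply, mul_assoc]
    have hbc : conjX b c (gX a b) = gX a c := by
      rw [gX_comm, conjX_gX_of_ne h'.ne h.ne' (h.trans h').ne', gX_comm]
    rw [hX, conjX_gH_self, flip hbc (down h h'),
      flip (conjX_gX_of_ne h.ne (h.trans h').ne h'.ne) (up h h')]
  rcases hab.lt_or_gt with h1 | h1 <;> rcases hac.lt_or_gt with h2 | h2 <;>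
    rcases hbc.lt_or_gt with h3 | h3
  · exact up h1 h3
  · exact mid h2 h3
  · exact absurd (h1.trans h3) h2.not_gt
  · exact flip (by rw [gX_comm c a, gX_comm c b, conjX_gX_of_ne hab hac hbc]) (down h2 h1)
  · rw [conjX_symm]; exact inv (up h1 h2)
  · exact absurd (h3.trans h1) h2.not_gt
  · rw [conjX_symm]; exact inv (mid h3 h2)
  · rw [conjX_symm]
    exact inv (flip (by rw [gX_comm c a, gX_comm c b, conjX_gX_of_ne hab.symm hbc hac])
      (down h3 h1))

theorem conjX_gH_of_disjoint {i j k l : Fin n} (hij : i ≠ j) (hki : k ≠ i) (hkj : k ≠ j)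
    (hli : l ≠ i) (hlj : l ≠ j) : conjX i j (gH k l) = gH k l := by
  have key : ∀ {i j k l : Fin n}, i < j → k < l → k ≠ i → k ≠ j → l ≠ i → l ≠ j →
      conjX i j (gH k l) = gH k l := fun {i j k l} h h' h1 h2 h3 h4 => by
    rw [conjX_eq_iff]
    simpa [toPres_wX, toPres_wH] using (Word.toPres_eq_of_rel (Rel.H_X k l i j h' h
      (by simp [h1, h2, h3, h4]))).symm
  have key' : ∀ {i j k l : Fin n}, i < j → k ≠ i → k ≠ j → l ≠ i → l ≠ j →
      conjX i j (gH k l) = gH k l := fun {i j k l} h h1 h2 h3 h4 => by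
    rcases lt_trichotomy k l with h' | rfl | h'
    · exact key h h' h1 h2 h3 h4
    · simp [gH_self]
    · rw [← conjX_gH_self l k, conjX_apply l k, map_mul, map_mul, key h h' h3 h4 h1 h2, conjX_gX,
        Equiv.swap_apply_of_ne_of_ne h1 h2, Equiv.swap_apply_of_ne_of_ne h3 h4]
  rcases lt_or_gt_of_ne hij with h | h
  · exact key' h hki hkj hli hlj
  · rw [conjX_symm]; exact key' h hkj hki hlj hli

/-- `X_[i,j]` acts on the generators `H_[k,l]` by permuting the indices. -/
theorem conjX_gH (i j k l : Fin n) :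
    conjX i j (gH k l) = gH (Equiv.swap i j k) (Equiv.swap i j l) := by
  by_cases hij : i = j
  · subst hij; simp [conjX_apply, gX_self]
  have first : ∀ {i j k l : Fin n}, i ≠ j → (k = i ∨ k = j) →
      conjX i j (gH k l) = gH (Equiv.swap i j k) (Equiv.swap i j l) := by
    have first' : ∀ {i j l : Fin n}, i ≠ j →
        conjX i j (gH i l) = gH (Equiv.swap i j i) (Equiv.swap i j l) := fun {i j l} hij => by
      by_cases hli : l = i
      · subst hli; simp [gH_self]
      by_cases hlj : l = j
      · subst hlj; simp [conjX_gH_self]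
      rw [conjX_gH_of_ne hij (Ne.symm hli) (Ne.symm hlj), Equiv.swap_apply_left,
        Equiv.swap_apply_of_ne_of_ne hli hlj]
    rintro i j k l hij (rfl | rfl)
    · exact first' hij
    · rw [conjX_symm, Equiv.swap_comm]; exact first' hij.symm
  by_cases hk : k = i ∨ k = j
  · exact first hij hk
  by_cases hl : l = i ∨ l = j
  · rw [← conjX_gH_self l k, conjX_apply l k, map_mul, map_mul, first hij hl, conjX_gX,
      ← conjX_gH_self (Equiv.swap i j l), conjX_apply (Equiv.swap i j l)]
  push Not at hk hl
  rw [conjX_gH_of_disjoint hij hk.1 hk.2 hl.1 hl.2, Equiv.swap_apply_of_ne_of_ne hk.1 hk.2,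
    Equiv.swap_apply_of_ne_of_ne hl.1 hl.2]

/-! ### The relations for the symmetric generators -/

/-- A relation between two indices may be checked in increasing order only, if it is preserved by
exchanging them. -/
theorem of_lt_of_swap {p : Fin n → Fin n → Prop} (h : ∀ i j, i < j → p i j)
    (hs : ∀ i j, p i j → p j i) {i j : Fin n} (hij : i ≠ j) : p i j :=
  hij.lt_or_gt.elim (h i j) fun h' => hs _ _ (h j i h')

theorem gH_mul_self (i j : Fin n) : gH i j * gH i j = 1 := by
  by_cases hij : i = j
  · subst hij; simp [gH_self]
  refine of_lt_of_swap (p := fun i j => gH i j * gH i j = 1) (fun i j h => ?_) (fun i j h => ?_) hij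
  · simpa [toPres_wH, pow_two] using Word.toPres_eq_of_rel (Rel.H_order i j h)
  · simpa [conjX_gH_self] using congrArg (conjX i j) h

theorem gH_inv (i j : Fin n) : (gH i j)⁻¹ = gH i j := inv_eq_of_mul_eq_one_left (gH_mul_self i j)

theorem gH_gW_comm {i j l : Fin n} (hij : i ≠ j) (hli : l ≠ i) (hlj : l ≠ j) :
    Commute (gH i j) (gW l) := by
  refine of_lt_of_swap (p := fun i j => l ≠ i → l ≠ j → Commute (gH i j) (gW l))
    (fun i j h h1 h2 => ?_) (fun i j h h1 h2 => ?_) hij hli hlj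
  · simpa [commute_iff_eq, toPres_wH, toPres_wW] using (Word.toPres_eq_of_rel (Rel.W_H l i j h h1 h2)).symm
  · simpa [conjX_gH_self, conjX_gW, Equiv.swap_apply_of_ne_of_ne h2 h1] using
      (h h2 h1).map (conjX i j)

theorem gH_gW_gW_comm {i j : Fin n} (hij : i ≠ j) : Commute (gH i j) (gW i * gW j) := by
  refine of_lt_of_swap (p := fun i j => Commute (gH i j) (gW i * gW j))
    (fun i j h => ?_) (fun i j h => ?_) hij
  · simpa [commute_iff_eq, toPres_wH, toPres_wW, mul_assoc] using (Word.toPres_eq_of_rel (Rel.WW_H i j h)).symm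
  · simpa [conjX_gH_self, conjX_gW] using h.map (conjX i j)

theorem gH_mul_gX {i j : Fin n} (hij : i ≠ j) : gH i j * gX i j = gW j ^ 4 * gH i j := by
  refine of_lt_of_swap (p := fun i j => gH i j * gX i j = gW j ^ 4 * gH i j)
    (fun i j h => ?_) (fun i j h => ?_) hij
  · simpa [toPres_wH, toPres_wX, toPres_wW] using Word.toPres_eq_of_rel (Rel.HX i j h)
  · simpa [conjX_gH_self, conjX_gW, conjX_gX, gX_comm] using congrArg (conjX i j) h

theorem gX_mul_gH {i j : Fin n} (hij : i ≠ j) : gX i j * gH i j = gH i j * gW j ^ 4 := by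
  have h := congrArg (fun g => gH i j * g * gH i j) (gH_mul_gX hij)
  simpa [← mul_assoc, gH_mul_self, mul_assoc _ (gH i j) (gH i j)] using h

theorem gH_mul_gW_sq_mul_gH {i j : Fin n} (hij : i ≠ j) :
    gH i j * gW i ^ 2 * gH i j = gW i ^ 6 * gH i j * gW i ^ 3 * gW j ^ 5 := by
  refine of_lt_of_swap
    (p := fun i j => gH i j * gW i ^ 2 * gH i j = gW i ^ 6 * gH i j * gW i ^ 3 * gW j ^ 5)
    (fun i j h => ?_) (fun i j h => ?_) hij
  · simpa [toPres_wH, toPres_wX, toPres_wW] using Word.toPres_eq_of_rel (Rel.HWWH i j h)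
  · simpa [conjX_gH_self, conjX_gW] using congrArg (conjX i j) h

theorem gH_gH_comm {i j k l : Fin n} (hij : i ≠ j) (hkl : k ≠ l) (hki : k ≠ i) (hkj : k ≠ j)
    (hli : l ≠ i) (hlj : l ≠ j) : Commute (gH i j) (gH k l) := by
  refine of_lt_of_swap (p := fun i j => k ≠ i → k ≠ j → l ≠ i → l ≠ j →
    Commute (gH i j) (gH k l)) (fun i j h h1 h2 h3 h4 => ?_) (fun i j h h1 h2 h3 h4 => ?_)
    hij hki hkj hli hlj
  · refine of_lt_of_swap (p := fun k l => k ≠ i → k ≠ j → l ≠ i → l ≠ j →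
      Commute (gH i j) (gH k l)) (fun k l h' h1 h2 h3 h4 => ?_) (fun k l h' h1 h2 h3 h4 => ?_)
      hkl h1 h2 h3 h4
    · simpa [commute_iff_eq, toPres_wH] using Word.toPres_eq_of_rel (Rel.H_H i j k l h h'
        (by simp [h1.symm, h2.symm, h3.symm, h4.symm]))
    · have := (h' h3 h4 h1 h2).map (conjX k l)
      by_cases hkl : k = l
      · simp [hkl, gH_self]
      rwa [conjX_gH_self, conjX_gH_of_disjoint hkl h3.symm h1.symm h4.symm h2.symm] at this
  · have := (h h2 h1 h4 h3).map (conjX i j)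
    by_cases hij : i = j
    · simp [hij, gH_self]
    rwa [conjX_gH_self, conjX_gH_of_disjoint hij h2 h1 h4 h3] at this

end Generators

/-- The relation between four generators `H`, for distinct indices in any order. -/
theorem gH_square {p q r s : Fin 4} (hpq : p ≠ q) (hpr : p ≠ r)
    (hps : p ≠ s) (hqr : q ≠ r) (hqs : q ≠ s) (hrs : r ≠ s) :
    gH p q * gH r s * gH p r * gH q s = gH p r * gH q s * gH p q * gH r s := by
  have key : ∀ σ : Equiv.Perm (Fin 4), gH (σ 0) (σ 1) * gH (σ 2) (σ 3) * gH (σ 0) (σ 2)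
      * gH (σ 1) (σ 3) = gH (σ 0) (σ 2) * gH (σ 1) (σ 3) * gH (σ 0) (σ 1) * gH (σ 2) (σ 3) := by
    intro σ
    induction σ using Equiv.Perm.swap_induction_on with
    | one =>
      simpa [toPres_wH] using Word.toPres_eq_of_rel
        (Rel.HHHH (0 : Fin 4) 1 2 3 (by decide) (by decide) (by decide))
    | swap_mul σ x y hxy ih => simpa [conjX_gH] using congrArg (conjX x y) ih
  have hinj : Function.Injective ![p, q, r, s] := by
    intro i j h
    fin_cases i <;> fin_cases j <;> simp_all
  simpa using key (Equiv.ofBijective _ (Finite.injective_iff_bijective.1 hinj))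


/-! ### The matrices of the generators -/

section Matrices

variable {n : ℕ}

open Matrix

theorem twoLevel_mulVec (V : Matrix (Fin 2) (Fin 2) ℂ) {j k : Fin n} (hjk : j ≠ k) (v : Fin n → ℂ) :
    twoLevel V j k *ᵥ v = fun l => if l = j then V 0 0 * v j + V 0 1 * v k
      else if l = k then V 1 0 * v j + V 1 1 * v k else v l := by
  funext l
  by_cases hl : l = j ∨ l = k
  · rw [mulVec, dotProduct, Finset.sum_eq_add j k hjk]
    · rcases hl with rfl | rfl <;> simp [twoLevel, hjk, hjk.symm]
    · intro c _ hc
      rcases hl with rfl | rfl <;> simp [twoLevel, hc.1, hc.2, hc.1.symm, hc.2.symm]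
    · simp
    · simp
  · push Not at hl
    rw [mulVec, dotProduct, Finset.sum_eq_single l]
    · simp [twoLevel, hl.1, hl.2]
    · intro c _ hc
      simp [twoLevel, hl.1, hl.2, hc.symm]
    · simp

theorem toMatrix_X_mulVec {j k : Fin n} (h : j < k) (v : Fin n → ℂ) :
    (Gen.X j k h).toMatrix *ᵥ v = opX j k v := by
  rw [Gen.toMatrix, twoLevel_mulVec _ h.ne]
  funext l
  simp only [opX, matX, Equiv.swap_apply_def]
  split_ifs <;> simp

theorem toMatrix_H_mulVec {j k : Fin n} (h : j < k) (v : Fin n → ℂ) :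
    (Gen.H j k h).toMatrix *ᵥ v = opH j k v := by
  rw [Gen.toMatrix, twoLevel_mulVec _ h.ne]
  funext l
  simp only [opH, matH, sqrtTwo]
  split_ifs <;> simp <;> ring

theorem oneLevel_eq_diagonal (x : ℂ) (j : Fin n) :
    oneLevel x j = diagonal fun l => if l = j then x else 1 := by
  ext r c
  by_cases h : r = c
  · subst h; simp [oneLevel]
  · simp [oneLevel, h, one_apply]
    rintro rfl rfl; exact absurd rfl h

theorem toMatrix_W_mulVec (j : Fin n) (v : Fin n → ℂ) :
    (Gen.W j).toMatrix *ᵥ v = opW j v := by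
  rw [Gen.toMatrix, oneLevel_eq_diagonal]
  funext l
  simp [mulVec_diagonal, opW]

theorem opX_opX (i j : Fin n) (v : Fin n → ℂ) : opX i j (opX i j v) = v := by
  funext l; simp [opX]

theorem div_sqrtTwo_div_sqrtTwo (z : ℂ) : z / sqrtTwo / sqrtTwo = z / 2 := by
  rw [div_div, ← pow_two, sqrtTwo_sq]

theorem opH_opH {i j : Fin n} (h : i ≠ j) (v : Fin n → ℂ) : opH i j (opH i j v) = v := by
  funext l
  by_cases hi : l = i
  · subst hi
    simp only [opH, if_true, h.symm, if_false, ← add_div, div_sqrtTwo_div_sqrtTwo]; ring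
  by_cases hj : l = j
  · subst hj
    simp only [opH, if_true, h.symm, if_false, ← sub_div, div_sqrtTwo_div_sqrtTwo]; ring
  simp [opH, hi, hj]

theorem toMatrix_mem_unitaryGroup (g : Gen n) : g.toMatrix ∈ unitaryGroup (Fin n) ℂ := by
  rw [mem_unitaryGroup_iff]
  cases g with
  | X j k h =>
    have hs : star (Gen.X j k h).toMatrix = (Gen.X j k h).toMatrix := by
      ext r c
      have h1 : star (matX 0 0) = matX 0 0 := by simp [matX]
      have h2 : star (matX 0 1) = matX 1 0 := by simp [matX]
      have h3 : star (matX 1 0) = matX 0 1 := by simp [matX]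
      have h4 : star (matX 1 1) = matX 1 1 := by simp [matX]
      simp only [Gen.toMatrix, twoLevel, star_apply, of_apply, one_apply]
      have := h.ne
      grind [star_zero, star_one]
    rw [hs]
    refine mulVec_injective (funext fun v => ?_)
    rw [← mulVec_mulVec, toMatrix_X_mulVec, toMatrix_X_mulVec, opX_opX, one_mulVec]
  | H j k h =>
    have hs : star (Gen.H j k h).toMatrix = (Gen.H j k h).toMatrix := by
      ext r c
      have h1 : star (matH 0 0) = matH 0 0 := by simp [matH]
      have h2 : star (matH 0 1) = matH 1 0 := by simp [matH]
      have h3 : star (matH 1 0) = matH 0 1 := by simp [matH]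
      have h4 : star (matH 1 1) = matH 1 1 := by simp [matH]
      simp only [Gen.toMatrix, twoLevel, star_apply, of_apply, one_apply]
      have := h.ne
      grind [star_zero, star_one]
    rw [hs]
    refine mulVec_injective (funext fun v => ?_)
    rw [← mulVec_mulVec, toMatrix_H_mulVec, toMatrix_H_mulVec, opH_opH h.ne, one_mulVec]
  | W j =>
    rw [Gen.toMatrix, oneLevel_eq_diagonal, star_eq_conjTranspose, diagonal_conjTranspose,
      diagonal_mul_diagonal, ← diagonal_one]
    congr 1
    funext l
    by_cases h : l = j
    · simp only [Pi.star_apply, h, if_true, star_omega, mul_inv_cancel₀ omega_ne_zero]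
    · simp [h]

theorem omega_mem_DOmega : omega ∈ DOmega :=
  ⟨0, zero_mem _, 0, zero_mem _, 1, one_mem _, 0, zero_mem _, by ring⟩

theorem toMatrix_mem_DOmega (g : Gen n) (r c : Fin n) : g.toMatrix r c ∈ DOmega := by
  have hr : (1 / ((√2 : ℝ) : ℂ)) ∈ DOmega := by
    rw [DOmega_eq_closure]; exact Subring.subset_closure (by simp)
  have h1 : (1 : Matrix (Fin n) (Fin n) ℂ) r c ∈ DOmega := by
    rw [one_apply]; split_ifs
    · exact one_mem _
    · exact zero_mem _
  cases g with
  | X j k h =>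
    simp only [Gen.toMatrix, twoLevel, of_apply]
    split_ifs <;> simp [matX, h1, one_mem, zero_mem]
  | H j k h =>
    simp only [one_div] at hr
    simp only [Gen.toMatrix, twoLevel, of_apply]
    split_ifs <;> simp [matH, h1, hr]
  | W j =>
    simp only [Gen.toMatrix, oneLevel, of_apply]
    split_ifs
    · exact omega_mem_DOmega
    · exact h1

theorem eval_wX {j k : Fin n} (h : j < k) : Word.eval (wX j k h) = (Gen.X j k h).toMatrix := by
  simp [Word.eval, wX]

theorem eval_wH {j k : Fin n} (h : j < k) : Word.eval (wH j k h) = (Gen.H j k h).toMatrix := by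
  simp [Word.eval, wH]

theorem eval_wW (j : Fin n) : Word.eval (wW j) = (Gen.W j).toMatrix := by
  simp [Word.eval, wW]

theorem toMatrix_W_pow_mulVec (j : Fin n) (m : ℕ) (v : Fin n → ℂ) :
    (Gen.W j).toMatrix ^ m *ᵥ v = (opW j)^[m] v := by
  induction m generalizing v with
  | zero => simp
  | succ m ih => rw [pow_succ, ← mulVec_mulVec, ih, toMatrix_W_mulVec, Function.iterate_succ_apply]

/-- The defining equations hold for the matrices. -/
theorem eval_eq_of_rel {u v : Word n} (h : Rel n u v) : Word.eval u = Word.eval v := by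
  refine mulVec_injective (funext fun x => ?_)
  have h2 := sqrtTwo_ne_zero
  induction h <;> simp only [map_mul, map_pow, map_one, eval_wX, eval_wH, eval_wW, ← mulVec_mulVec, toMatrix_X_mulVec,
    toMatrix_H_mulVec, toMatrix_W_mulVec, toMatrix_W_pow_mulVec, one_mulVec, opW_iterate, pow_two,
    opX_opX]
  case W_order j => funext l; simp [omega_pow_eight]
  case H_order j k h => exact opH_opH h.ne x
  case W_W j k h =>
    funext l
    simp only [opW]; grind
  case W_H l j k h h1 h2 =>
    funext i
    simp only [opW, opH]; grind
  case W_X l j k h h1 h2 =>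
    funext i
    simp only [opW, opX, Equiv.swap_apply_def]; grind
  case H_H j k l t h h' hd =>
    simp at hd
    funext i
    simp only [opH]; grind
  case H_X j k l t h h' hd =>
    simp at hd
    funext i
    simp only [opH, opX, Equiv.swap_apply_def]; grind
  case X_X j k l t h h' hd =>
    simp at hd
    funext i
    simp only [opX, Equiv.swap_apply_def]; grind
  case X_W_right j k h =>
    funext i
    simp only [opW, opX, Equiv.swap_apply_def]; grind
  case X_W_left j k h =>
    funext i
    simp only [opW, opX, Equiv.swap_apply_def]; grind
  case X_X_up j k l h h' =>
    have := (h.trans h').ne; have := h.ne; have := h'.ne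
    funext i
    simp only [opX, Equiv.swap_apply_def]; grind
  case X_X_down l j k h h' =>
    have := (h.trans h').ne; have := h.ne; have := h'.ne
    funext i
    simp only [opX, Equiv.swap_apply_def]; grind
  case X_H_up j k l h h' =>
    have := (h.trans h').ne; have := h.ne; have := h'.ne
    funext i
    simp only [opX, opH, Equiv.swap_apply_def]; grind
  case X_H_down l j k h h' =>
    have := (h.trans h').ne; have := h.ne; have := h'.ne
    funext i
    simp only [opX, opH, Equiv.swap_apply_def]; grind
  case WW_X j k h =>
    funext i
    simp only [opW, opX, Equiv.swap_apply_def]; grind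
  case WW_H j k h =>
    have := h.ne
    funext i
    simp only [opW, opH]; grind
  case HX j k h =>
    have := h.ne
    funext i
    simp only [opX, opH, Equiv.swap_apply_def]; grind [omega_pow_four]
  case HWWH j k h =>
    have := h.ne
    funext i
    have hw := omega_pow_four
    have hd : ∀ z, z / sqrtTwo = z * (omega - omega ^ 3) / 2 := fun z => by
      rw [← sqrtTwo_eq, div_eq_div_iff h2 two_ne_zero, mul_assoc, ← pow_two, sqrtTwo_sq]
    simp only [opW, opH, hd]
    grind
  case HHHH j k l t h h' h'' =>
    have h1 := h.ne; have h2 := h'.ne; have h3 := h''.ne; have h4 := (h.trans h').ne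
    have h5 := (h'.trans h'').ne; have h6 := (h.trans (h'.trans h'')).ne
    funext i
    by_cases hj : i = j
    · subst hj; simp [opH, *, Ne.symm]; ring
    by_cases hk : i = k
    · subst hk; simp [opH, *, Ne.symm]; ring
    by_cases hl : i = l
    · subst hl; simp [opH, *, Ne.symm]; ring
    by_cases ht : i = t
    · subst ht; simp [opH, *, Ne.symm]; ring
    simp [opH, hj, hk, hl, ht]

end Matrices


/-! ### The representation of the presented group -/

section Representation

open Matrix

variable {n : ℕ}

/-- The matrix of a generator as an element of `U_n(𝔻[ω])`. -/
def genU (g : Gen n) : U n := ⟨⟨g.toMatrix, toMatrix_mem_unitaryGroup g⟩, toMatrix_mem_DOmega g⟩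

/-- The matrix underlying an element of `U_n(𝔻[ω])`. -/
def matrixHom : U n →* Matrix (Fin n) (Fin n) ℂ :=
  (unitaryGroup (Fin n) ℂ).subtype.comp (U n).subtype

theorem matrixHom_injective : Function.Injective (matrixHom (n := n)) :=
  fun _ _ h => Subtype.ext (Subtype.ext h)

theorem lift_genU (u : Word n) :
    matrixHom (FreeGroup.lift genU (FreeMonoid.lift FreeGroup.of u)) = Word.eval u := by
  have : (matrixHom.comp (FreeGroup.lift genU : _ →* U n)).comp (FreeMonoid.lift FreeGroup.of)
      = Word.eval := FreeMonoid.hom_eq fun g => by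
    simp [Word.eval]; rfl
  rw [← this]; rfl

/-- The homomorphism from the presented group to `U_n(𝔻[ω])`. -/
def rep : Pres n →* U n := PresentedGroup.toGroup (f := genU) (by
  rintro _ ⟨u, v, h, rfl⟩
  rw [map_mul, map_inv, mul_inv_eq_one]
  apply matrixHom_injective
  rw [lift_genU, lift_genU, eval_eq_of_rel h])

theorem rep_of (g : Gen n) : rep (PresentedGroup.of g) = genU g := PresentedGroup.toGroup.of _

/-- The linear action of the presented group on vectors. -/
def act (g : Pres n) (v : Fin n → ℂ) : Fin n → ℂ := matrixHom (rep g) *ᵥ v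

theorem act_one (v : Fin n → ℂ) : act 1 v = v := by simp [act]

theorem act_mul (g h : Pres n) (v : Fin n → ℂ) : act (g * h) v = act g (act h v) := by
  simp [act]

theorem act_inv_act (g : Pres n) (v : Fin n → ℂ) : act g⁻¹ (act g v) = v := by
  rw [← act_mul, inv_mul_cancel, act_one]

theorem act_of (g : Gen n) (v : Fin n → ℂ) : act (PresentedGroup.of g) v = g.toMatrix *ᵥ v := by
  rw [act, rep_of]; rfl

theorem act_gW (i : Fin n) : act (gW i) = opW i := by
  funext v; rw [gW, act_of, toMatrix_W_mulVec]

theorem act_gX (i j : Fin n) : act (gX i j) = opX i j := by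
  funext v
  rcases lt_trichotomy i j with h | rfl | h
  · rw [gX, dif_pos h, act_of, toMatrix_X_mulVec]
  · rw [gX_self, act_one]; funext l; simp [opX]
  · rw [gX_comm, gX, dif_pos h, act_of, toMatrix_X_mulVec]
    funext l; rw [opX, opX, Equiv.swap_comm]

theorem act_gH {i j : Fin n} (hij : i ≠ j) : act (gH i j) = opH i j := by
  funext v
  rcases lt_or_gt_of_ne hij with h | h
  · rw [gH, dif_pos h, act_of, toMatrix_H_mulVec]
  · rw [gH, dif_neg h.not_gt, dif_pos h, act_mul, act_mul, act_of, toMatrix_H_mulVec, act_gX]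
    funext l
    simp only [opX, opH, Equiv.swap_apply_def]
    grind

theorem act_gW_pow (i : Fin n) (m : ℕ) : act (gW i ^ m) = (opW i)^[m] := by
  induction m with
  | zero => funext v; simp [act_one]
  | succ m ih => funext v; rw [pow_succ, act_mul, ih, act_gW, Function.iterate_succ_apply]

theorem star_mulVec_dotProduct_mulVec (N : U n) (v w : Fin n → ℂ) :
    star (matrixHom N *ᵥ v) ⬝ᵥ (matrixHom N *ᵥ w) = star v ⬝ᵥ w := by
  have h : star (matrixHom N) * matrixHom N = 1 := mem_unitaryGroup_iff'.1 N.1.2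
  rw [star_mulVec, ← dotProduct_mulVec, mulVec_mulVec, ← star_eq_conjTranspose, h, one_mulVec]

theorem sum_mulVec_mul_star (N : U n) (v : Fin n → ℂ) :
    ∑ i, (matrixHom N *ᵥ v) i * star ((matrixHom N *ᵥ v) i) = ∑ i, v i * star (v i) := by
  have h : ∀ w : Fin n → ℂ, ∑ i, w i * star (w i) = star w ⬝ᵥ w := fun w => by
    simp [dotProduct, mul_comm]
  rw [h, h, star_mulVec_dotProduct_mulVec]

end Representation

/-! ### Standard subgroups -/

/-- The generators with indices below `k`. -/
inductive IsGen (k : ℕ) : Pres 4 → Prop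
  | W (i : Fin 4) (hi : i.val < k) : IsGen k (gW i)
  | X (i j : Fin 4) (hi : i.val < k) (hj : j.val < k) : IsGen k (gX i j)
  | H (i j : Fin 4) (hij : i ≠ j) (hi : i.val < k) (hj : j.val < k) : IsGen k (gH i j)

/-- The subgroup generated by the generators with indices below `k`. -/
def standard (k : ℕ) : Subgroup (Pres 4) := Subgroup.closure {g | IsGen k g}

/-- The subgroup generated by the `X_[i,j]` and `ω_[i]` with indices below `k`. It denotes monomial
matrices. -/
def monomial (k : ℕ) : Subgroup (Pres 4) :=
  Subgroup.closure {g | IsGen k g ∧ ((∃ i, g = gW i) ∨ ∃ i j, g = gX i j)}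

theorem IsGen.inv_eq_pow {k : ℕ} {g : Pres 4} (hg : IsGen k g) : ∃ m : ℕ, g⁻¹ = g ^ m := by
  cases hg with
  | W i hi => exact ⟨7, inv_eq_of_mul_eq_one_left (by rw [← pow_succ, gW_pow_eight])⟩
  | X i j hi hj => exact ⟨1, by rw [gX_inv, pow_one]⟩
  | H i j hij hi hj => exact ⟨1, by rw [gH_inv, pow_one]⟩

/-- Induction over a subgroup closure without a case for inverses, if the generators have finite
order. -/
theorem closure_induction_of_inv_eq_pow {G : Type*} [Group G] {s : Set G} {p : G → Prop}
    (hinv : ∀ x ∈ s, ∃ m : ℕ, x⁻¹ = x ^ m) (mem : ∀ x ∈ s, p x) (one : p 1)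
    (mul : ∀ x y, p x → p y → p (x * y)) {g : G} (hg : g ∈ Subgroup.closure s) : p g := by
  induction hg using Subgroup.closure_induction_left with
  | one => exact one
  | mul_left x hx y hy ih => exact mul x y (mem x hx) ih
  | inv_mul_cancel x hx y hy ih =>
    obtain ⟨m, hm⟩ := hinv x hx
    rw [hm]
    clear hm
    induction m with
    | zero => simpa using ih
    | succ m ihm => rw [pow_succ', mul_assoc]; exact mul x _ (mem x hx) ihm

theorem gW_mem_monomial {k : ℕ} {i : Fin 4} (hi : i.val < k) : gW i ∈ monomial k :=
  Subgroup.subset_closure ⟨.W i hi, .inl ⟨i, rfl⟩⟩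

theorem gX_mem_monomial {k : ℕ} {i j : Fin 4} (hi : i.val < k) (hj : j.val < k) :
    gX i j ∈ monomial k :=
  Subgroup.subset_closure ⟨.X i j hi hj, .inr ⟨i, j, rfl⟩⟩

theorem standard_zero : standard 0 = ⊥ := by
  rw [standard, Subgroup.closure_eq_bot_iff]
  intro g hg
  cases hg <;> omega

theorem isGen_of (g : Gen 4) : IsGen 4 (PresentedGroup.of g) := by
  cases g with
  | X j k h =>
    have := IsGen.X (k := 4) j k j.2 k.2
    rwa [gX, dif_pos h] at this
  | H j k h =>
    have := IsGen.H (k := 4) j k h.ne j.2 k.2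
    rwa [gH, dif_pos h] at this
  | W j => exact IsGen.W (k := 4) j j.2

theorem standard_four : standard 4 = ⊤ := by
  rw [eq_top_iff, ← PresentedGroup.closure_range_of, standard]
  refine Subgroup.closure_mono ?_
  rintro _ ⟨g, rfl⟩
  exact isGen_of g

/-- Unit vectors with entries in `ℤ[ω][1/2]` whose coordinates from `k` on vanish. -/
def IsVec (k : ℕ) (v : Fin 4 → ℂ) : Prop := IsUnitVec v ∧ ∀ l : Fin 4, k ≤ l.val → v l = 0

theorem IsVec.act_of_isGen {k : ℕ} {v : Fin 4 → ℂ} (hv : IsVec k v) {g : Pres 4} (hg : IsGen k g) :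
    IsVec k (act g v) := by
  refine ⟨⟨?_, (sum_mulVec_mul_star _ _).trans hv.1.2⟩, fun l hl => ?_⟩
  · cases hg with
    | W i hi => rw [act_gW]; exact hv.1.1.opW i
    | X i j hi hj => rw [act_gX]; exact hv.1.1.opX i j
    | H i j hij hi hj => rw [act_gH hij]; exact hv.1.1.opH i j
  · cases hg with
    | W i hi => rw [act_gW, opW, hv.2 l hl]; simp
    | X i j hi hj =>
      rw [act_gX, opX, Equiv.swap_apply_of_ne_of_ne, hv.2 l hl]
      · rintro rfl; omega
      · rintro rfl; omega
    | H i j hij hi hj =>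
      rw [act_gH hij, opH_other, hv.2 l hl]
      · rintro rfl; omega
      · rintro rfl; omega

theorem IsVec.lt_of_mem_tops {k : ℕ} {v : Fin 4 → ℂ} (hv : IsVec k v) {i : Fin 4} {e : ℕ}
    (hi : i ∈ tops v e) : i.val < k := by
  by_contra h
  rw [mem_tops] at hi
  exact hi (by rw [hv.2 i (by omega)]; exact zero_mem _)

/-! ### Normal forms of descents -/

theorem exists_monomial_of_four_dvd {k : ℕ} {i j : Fin 4} (hij : i ≠ j) (hi : i.val < k)
    (hj : j.val < k) {m m' : ℕ} (h : 4 ∣ m' + 7 * m) :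
    ∃ μ ∈ monomial k, gH i j * gW j ^ m' = μ * (gH i j * gW j ^ m) := by
  obtain ⟨t, ht⟩ := h
  refine ⟨gX i j ^ t, pow_mem (gX_mem_monomial hi hj) t, ?_⟩
  have h1 : gW j ^ m' = (gW j ^ 4) ^ t * gW j ^ m := by
    rw [← pow_mul, ← ht, ← pow_add, show m' + 7 * m + m = m' + 8 * m by ring, pow_add,
      pow_mul _ 8, gW_pow_eight, one_pow, mul_one]
  have h2 : gX i j ^ t * gH i j = gH i j * (gW j ^ 4) ^ t := by
    have : SemiconjBy (gH i j) (gW j ^ 4) (gX i j) := (gX_mul_gH hij).symm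
    exact (this.pow_right t).symm
  rw [h1, ← mul_assoc, ← h2, mul_assoc]

theorem gH_mul_gW_left {i j : Fin 4} (hij : i ≠ j) (m : ℕ) :
    gH i j * gW i ^ m = (gW i * gW j) ^ m * (gH i j * gW j ^ (7 * m)) := by
  have hc : Commute (gW i) (gW j) := gW_comm i j
  rw [← mul_assoc, ← ((gH_gW_gW_comm hij).pow_right m).eq, hc.mul_pow, mul_assoc, mul_assoc,
    ← pow_add, show m + 7 * m = 8 * m by ring, pow_mul _ 8, gW_pow_eight, one_pow, mul_one]

theorem exists_monomial_swap {k : ℕ} {i j : Fin 4} (hij : i ≠ j) (hi : i.val < k)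
    (hj : j.val < k) {m m' : ℕ} (h : 4 ∣ m + m') :
    ∃ μ ∈ monomial k, gH j i * gW i ^ m' = μ * (gH i j * gW j ^ m) := by
  obtain ⟨μ, hμ, h1⟩ := exists_monomial_of_four_dvd hij hi hj (m := m) (m' := 7 * m') (by omega)
  have h2 : gH j i = gX i j * gW j ^ 4 * gH i j := by
    rw [← conjX_gH_self, conjX_apply, mul_assoc, gH_mul_gX hij, mul_assoc]
  refine ⟨gX i j * gW j ^ 4 * (gW i * gW j) ^ m' * μ, ?_, ?_⟩
  · exact mul_mem (mul_mem (mul_mem (gX_mem_monomial hi hj) (pow_mem (gW_mem_monomial hj) _))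
      (pow_mem (mul_mem (gW_mem_monomial hi) (gW_mem_monomial hj)) _)) hμ
  · rw [h2, mul_assoc _ (gH i j), gH_mul_gW_left hij, h1]
    simp only [mul_assoc]

theorem exists_monomial_mul_gW_pow {k : ℕ} {i j l : Fin 4} (hij : i ≠ j) (hi : i.val < k)
    (hj : j.val < k) (hl : l.val < k) (m a : ℕ) :
    ∃ μ ∈ monomial k, ∃ m', gH i j * gW j ^ m * gW l ^ a = μ * (gH i j * gW j ^ m') := by
  have hc : Commute (gW j) (gW l) := gW_comm j l
  have hc' := (hc.pow_pow m a).eq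
  by_cases hlj : l = j
  · subst hlj
    exact ⟨1, one_mem _, m + a, by rw [one_mul, mul_assoc, pow_add]⟩
  by_cases hli : l = i
  · subst hli
    refine ⟨(gW l * gW j) ^ a, pow_mem (mul_mem (gW_mem_monomial hi) (gW_mem_monomial hj)) _,
      7 * a + m, ?_⟩
    rw [mul_assoc, hc', ← mul_assoc, gH_mul_gW_left hij, mul_assoc, mul_assoc, pow_add]
  · refine ⟨gW l ^ a, pow_mem (gW_mem_monomial hl) _, m, ?_⟩
    rw [mul_assoc, hc', ← mul_assoc, ((gH_gW_comm hij hli hlj).pow_right a).eq, mul_assoc]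

/-- The diagonal element with entries `ω ^ a l`. -/
def diagW (a : Fin 4 → ℕ) : Pres 4 := gW 0 ^ a 0 * gW 1 ^ a 1 * gW 2 ^ a 2 * gW 3 ^ a 3

theorem act_diagW (a : Fin 4 → ℕ) (v : Fin 4 → ℂ) :
    act (diagW a) v = fun l => omega ^ a l * v l := by
  funext l
  simp only [diagW, act_mul, act_gW_pow, opW_iterate]
  fin_cases l <;> simp

theorem diagW_mem_monomial (a : Fin 4 → ℕ) : diagW a ∈ monomial 4 :=
  mul_mem (mul_mem (mul_mem (pow_mem (gW_mem_monomial (by decide)) _)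
    (pow_mem (gW_mem_monomial (by decide)) _)) (pow_mem (gW_mem_monomial (by decide)) _))
    (pow_mem (gW_mem_monomial (by decide)) _)

theorem exists_monomial_mul_diagW {i j : Fin 4} (hij : i ≠ j) (a : Fin 4 → ℕ) :
    ∃ μ ∈ monomial 4, ∃ m, gH i j * diagW a = μ * (gH i j * gW j ^ m) := by
  obtain ⟨μ0, h0, m0, e0⟩ := exists_monomial_mul_gW_pow (k := 4) (l := 0) hij i.2 j.2 (by decide) 0 (a 0)
  obtain ⟨μ1, h1, m1, e1⟩ := exists_monomial_mul_gW_pow (k := 4) (l := 1) hij i.2 j.2 (by decide) m0 (a 1)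
  obtain ⟨μ2, h2, m2, e2⟩ := exists_monomial_mul_gW_pow (k := 4) (l := 2) hij i.2 j.2 (by decide) m1 (a 2)
  obtain ⟨μ3, h3, m3, e3⟩ := exists_monomial_mul_gW_pow (k := 4) (l := 3) hij i.2 j.2 (by decide) m2 (a 3)
  refine ⟨μ0 * μ1 * μ2 * μ3, mul_mem (mul_mem (mul_mem h0 h1) h2) h3, m3, ?_⟩
  rw [pow_zero, mul_one] at e0
  rw [diagW, ← mul_assoc, ← mul_assoc, ← mul_assoc, e0, mul_assoc μ0, e1, ← mul_assoc μ0,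
    mul_assoc (μ0 * μ1), e2, ← mul_assoc (μ0 * μ1), mul_assoc (μ0 * μ1 * μ2), e3, ← mul_assoc]


/-! ### Independence of the choice of descent -/

section Descent

variable {α : Type*} [MulAction (Pres 4) α] {f : (Fin 4 → ℂ) → α} {k ℓ : ℕ}

/-- The function `f` commutes with the generators with indices below `k`, as long as the level
stays below `ℓ`. -/
def EquivariantBelow (f : (Fin 4 → ℂ) → α) (k ℓ : ℕ) : Prop :=
  ∀ v, IsVec k v → level v < ℓ → ∀ g, IsGen k g → level (act g v) < ℓ → f (act g v) = g • f v

/-- The value of `f` at `v` that is predicted by its value at `act g v`. -/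
def pullBack (f : (Fin 4 → ℂ) → α) (g : Pres 4) (v : Fin 4 → ℂ) : α := g⁻¹ • f (act g v)

/-- Monomial elements preserve the level, so equivariance extends to them at every vector. -/
theorem monomial_invariants {μ : Pres 4} (hμ : μ ∈ monomial k) :
    ∀ v, IsVec k v → IsVec k (act μ v) ∧ level (act μ v) = level v ∧
      (EquivariantBelow f k ℓ → level v < ℓ → f (act μ v) = μ • f v) := by
  have hgen : ∀ g, (IsGen k g ∧ ((∃ i, g = gW i) ∨ ∃ i j, g = gX i j)) →
      ∀ v, level (act g v) = level v := by
    rintro g ⟨-, ⟨i, rfl⟩ | ⟨i, j, rfl⟩⟩ v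
    · rw [act_gW, level_opW]
    · rw [act_gX, level_opX]
  refine closure_induction_of_inv_eq_pow (p := fun μ => ∀ v, IsVec k v → IsVec k (act μ v) ∧
    level (act μ v) = level v ∧ (EquivariantBelow f k ℓ → level v < ℓ → f (act μ v) = μ • f v))
    (fun x hx => hx.1.inv_eq_pow) (fun x hx v hv => ?_)
    (fun v hv => ?_) (fun x y hx hy v hv => ?_) hμ
  · exact ⟨hv.act_of_isGen hx.1, hgen x hx v, fun hf hl => hf v hv hl x hx.1 (by rwa [hgen x hx v])⟩
  · rw [act_one]; exact ⟨hv, rfl, fun _ _ => (one_smul _ _).symm⟩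
  · obtain ⟨h1, h2, h3⟩ := hy v hv
    obtain ⟨h4, h5, h6⟩ := hx _ h1
    rw [act_mul]
    exact ⟨h4, h5.trans h2, fun hf hl => by rw [h6 hf (h2 ▸ hl), h3 hf hl, mul_smul]⟩

theorem pullBack_monomial_mul (hf : EquivariantBelow f k ℓ) {μ g : Pres 4} (hμ : μ ∈ monomial k)
    {v : Fin 4 → ℂ} (hv : IsVec k (act g v)) (hl : level (act g v) < ℓ) :
    pullBack f (μ * g) v = pullBack f g v := by
  rw [pullBack, act_mul, (monomial_invariants hμ _ hv).2.2 hf hl, mul_inv_rev, mul_smul,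
    inv_smul_smul, pullBack]

theorem pullBack_mul (f : (Fin 4 → ℂ) → α) (g h : Pres 4) (v : Fin 4 → ℂ) :
    pullBack f (g * h) v = h⁻¹ • pullBack f g (act h v) := by
  rw [pullBack, act_mul, mul_inv_rev, mul_smul, pullBack]

/-- The element `H_[i,j] ω_[j]^m` lowers the level of `v`. -/
def IsDescent (v : Fin 4 → ℂ) (i j : Fin 4) (m : ℕ) : Prop :=
  i ≠ j ∧ level (act (gH i j * gW j ^ m) v) < level v

theorem act_gH_mul_gW_pow {i j : Fin 4} (hij : i ≠ j) (m : ℕ) (v : Fin 4 → ℂ) :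
    act (gH i j * gW j ^ m) v = opH i j ((opW j)^[m] v) := by
  rw [act_mul, act_gW_pow, act_gH hij]

theorem isDescent_iff {v : Fin 4 → ℂ} (hv : IsDyadicVec v) (he : denExp v ≠ 0) {i j : Fin 4}
    {m : ℕ} : IsDescent v i j m ↔ i ≠ j ∧ i ∈ tops v (denExp v) ∧ j ∈ tops v (denExp v) ∧
      v i - omega ^ m * v j ∈ filt (-(denExp v) + 3) := by
  refine and_congr_right fun hij => ?_
  rw [act_gH_mul_gW_pow hij, level_opH_iterate_opW_lt_iff hv he hij]

theorem IsVec.act_descent {v : Fin 4 → ℂ} (hv : IsVec k v) {i j : Fin 4} (hij : i ≠ j)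
    (hi : i.val < k) (hj : j.val < k) (m : ℕ) : IsVec k (act (gH i j * gW j ^ m) v) := by
  rw [act_mul]
  exact (monomial_invariants (f := fun _ => ()) (α := PUnit) (ℓ := 0)
    (pow_mem (gW_mem_monomial hj) m) v hv).1.act_of_isGen (.H i j hij hi hj)

/-- Descents along the same pair of coordinates predict the same value. -/
theorem pullBack_eq_of_same_pair {v : Fin 4 → ℂ} (hv : IsVec k v) (he : denExp v ≠ 0)
    (hf : EquivariantBelow f k (level v)) {i j i' j' : Fin 4} {m m' : ℕ} (h : IsDescent v i j m)
    (h' : IsDescent v i' j' m') (hp : i' = i ∧ j' = j ∨ i' = j ∧ j' = i) :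
    pullBack f (gH i' j' * gW j' ^ m') v = pullBack f (gH i j * gW j ^ m) v := by
  have hd := (isDescent_iff hv.1.1 he).1 h
  have hd' := (isDescent_iff hv.1.1 he).1 h'
  have hi := hv.lt_of_mem_tops hd.2.1
  have hj := hv.lt_of_mem_tops hd.2.2.1
  have hm := mem_filt_denExp hv.1.1
  rcases hp with ⟨rfl, rfl⟩ | ⟨rfl, rfl⟩
  · have h4 : 4 ∣ m' + 7 * m := by
      refine four_dvd_of_mem_filt (hm j') (mem_tops.1 hd.2.2.1) ?_
      have := (omega_pow_mul_mem_filt (7 * m)).2 (sub_mem hd.2.2.2 hd'.2.2.2)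
      convert this using 1
      have h8 : omega ^ (8 * m) = 1 := by rw [pow_mul, omega_pow_eight, one_pow]
      have h8' : omega ^ (7 * m) * omega ^ m = 1 := by rw [← h8, ← pow_add]; congr 1; ring
      rw [pow_add]
      linear_combination v j' * h8'
    obtain ⟨μ, hμ, e⟩ := exists_monomial_of_four_dvd hd.1 hi hj h4
    rw [e, pullBack_monomial_mul hf hμ (hv.act_descent hd.1 hi hj m) h.2]
  · have h4 : 4 ∣ m + m' := by
      refine four_dvd_of_mem_filt (hm j') (mem_tops.1 hd.2.1) ?_
      have := add_mem hd.2.2.2 ((omega_pow_mul_mem_filt m).2 hd'.2.2.2)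
      rw [← neg_mem_iff]
      convert this using 1
      rw [pow_add]; ring
    obtain ⟨μ, hμ, e⟩ := exists_monomial_swap hd.1 hi hj h4
    rw [e, pullBack_monomial_mul hf hμ (hv.act_descent hd.1 hi hj m) h.2]

/-- Overlapping descents from a normalized vector predict the same value: the relation
`H_[p,q] H_[r,s] H_[p,r] H_[q,s] = H_[p,r] H_[q,s] H_[p,q] H_[r,s]` connects their targets by a path
of low level. -/
theorem pullBack_eq_of_overlap {v : Fin 4 → ℂ} (hv : IsVec 4 v) (he : denExp v ≠ 0)
    (hf : EquivariantBelow f 4 (level v)) (ht : ∀ i, i ∈ tops v (denExp v))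
    (h3 : ∀ i j, v i - v j ∈ filt (-(denExp v) + 3)) (h5 : ∑ i, v i ∈ filt (-(denExp v) + 5))
    {p q r : Fin 4} (hpq : p ≠ q) (hpr : p ≠ r) (hqr : q ≠ r) :
    pullBack f (gH p q) v = pullBack f (gH p r) v := by
  obtain ⟨s, hps, hqs, hrs⟩ : ∃ s : Fin 4, p ≠ s ∧ q ≠ s ∧ r ≠ s := by
    revert p q r; decide
  have key : ∀ {p q r s : Fin 4}, p ≠ q → p ≠ r → p ≠ s → q ≠ r → q ≠ s → r ≠ s →
      f (act (gH q s * gH p r * gH r s * gH p q) v)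
        = (gH q s * gH p r * gH r s * gH p q) • pullBack f (gH p q) v := by
    intro p q r s hpq hpr hps hqr hqs hrs
    obtain ⟨l1, l2, l3, l4⟩ := level_square_lt hv.1.1 he ht h3 h5 hpq hpr hps hqr hqs hrs
    rw [← act_gH hpq] at l1 l2 l3 l4
    rw [← act_gH hrs] at l2 l3 l4
    rw [← act_gH hpr] at l3 l4
    rw [← act_gH hqs] at l4
    have g1 := IsGen.H (k := 4) p q hpq p.2 q.2
    have g2 := IsGen.H (k := 4) r s hrs r.2 s.2
    have g3 := IsGen.H (k := 4) p r hpr p.2 r.2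
    have g4 := IsGen.H (k := 4) q s hqs q.2 s.2
    have v1 := hv.act_of_isGen g1
    have v2 := v1.act_of_isGen g2
    have v3 := v2.act_of_isGen g3
    rw [act_mul, act_mul, act_mul, hf _ v3 l3 _ g4 l4, hf _ v2 l2 _ g3 l3, hf _ v1 l1 _ g2 l2,
      pullBack, smul_smul, smul_smul, smul_smul, mul_inv_cancel_right]
  have e1 := key hpq hpr hps hqr hqs hrs
  have e2 := key hpr hpq hps hqr.symm hrs hqs
  have hsq : gH q s * gH p r * gH r s * gH p q = gH r s * gH p q * gH q s * gH p r := by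
    have c1 := (gH_gH_comm hpq hrs hpr.symm hqr.symm hps.symm hqs.symm).eq
    have c2 := (gH_gH_comm hpr hqs hpq.symm hqr hps.symm hrs.symm).eq
    have := gH_square hpq hpr hps hqr hqs hrs
    rw [c1, mul_assoc (gH r s * gH p q), c2, ← mul_assoc, mul_assoc (gH q s * gH p r),
      c1, ← mul_assoc] at this
    exact this.symm
  rw [hsq] at e1
  exact smul_left_cancel _ (e1.symm.trans e2)

/-- All descents from a vector predict the same value. -/
theorem pullBack_eq_of_isDescent {v : Fin 4 → ℂ} (hv : IsVec k v) (hk : k ≤ 4) (he : denExp v ≠ 0)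
    (hf : EquivariantBelow f k (level v)) {i j i' j' : Fin 4} {m m' : ℕ} (h : IsDescent v i j m)
    (h' : IsDescent v i' j' m') :
    pullBack f (gH i' j' * gW j' ^ m') v = pullBack f (gH i j * gW j ^ m) v := by
  have hd := (isDescent_iff hv.1.1 he).1 h
  have hd' := (isDescent_iff hv.1.1 he).1 h'
  have heven := even_card_tops hv.1 he
  have hle := card_tops_le v (denExp v)
  have hsub : {i, j} ⊆ tops v (denExp v) := by
    intro x hx
    rcases Finset.mem_insert.1 hx with rfl | hx
    · exact hd.2.1
    · rw [Finset.mem_singleton.1 hx]; exact hd.2.2.1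
  have hcard2 : ({i, j} : Finset (Fin 4)).card = 2 := Finset.card_pair hd.1
  have hge := Finset.card_le_card hsub
  obtain hc | hc : (tops v (denExp v)).card = 2 ∨ (tops v (denExp v)).card = 4 := by
    rw [Nat.even_iff] at heven; omega
  · have heq := Finset.eq_of_subset_of_card_le hsub (by rw [hc, hcard2])
    refine pullBack_eq_of_same_pair hv he hf h h' ?_
    have h1 := hd'.2.1
    have h2 := hd'.2.2.1
    rw [← heq, Finset.mem_insert, Finset.mem_singleton] at h1 h2
    have := hd'.1
    grind
  · have ht : ∀ l, l ∈ tops v (denExp v) := by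
      have : tops v (denExp v) = Finset.univ := (Finset.card_eq_iff_eq_univ _).1 (by simpa using hc)
      intro l; rw [this]; exact Finset.mem_univ l
    obtain rfl : k = 4 := by
      have := hv.lt_of_mem_tops (ht 3)
      have h3 : ((3 : Fin 4) : ℕ) = 3 := rfl
      omega
    obtain ⟨a, ha3, ha5⟩ := exists_normalization hv.1 he ht
    obtain ⟨hu, hul, -⟩ := monomial_invariants (f := f) (ℓ := 0) (diagW_mem_monomial a) v hv
    set u := act (diagW a) v with hudef
    have hua : u = fun l => omega ^ a l * v l := act_diagW a v
    have hmem : ∀ i (s : ℤ), u i ∈ filt s ↔ v i ∈ filt s := fun i s => by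
      rw [hua]; exact omega_pow_mul_mem_filt _
    have hexp : denExp u = denExp v := by simp only [denExp, hmem]
    have hut : ∀ l, l ∈ tops u (denExp u) := fun l => by
      rw [mem_tops, hmem, hexp]; exact mem_tops.1 (ht l)
    have hu3 : ∀ i j, u i - u j ∈ filt (-(denExp u) + 3) := by rw [hexp, hua]; exact ha3
    have hu5 : ∑ i, u i ∈ filt (-(denExp u) + 5) := by rw [hexp, hua]; exact ha5
    have heu : denExp u ≠ 0 := by rwa [hexp]
    have hfu : EquivariantBelow f 4 (level u) := by rwa [hul]
    have hdesc : ∀ {p q : Fin 4}, p ≠ q → IsDescent u p q 0 := fun hpq =>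
      (isDescent_iff hu.1.1 heu).2 ⟨hpq, hut _, hut _, by rw [pow_zero, one_mul]; exact hu3 _ _⟩
    -- at the normalized vector, all descents predict the same value
    have hswap : ∀ {p q : Fin 4}, p ≠ q → pullBack f (gH p q) u = pullBack f (gH q p) u :=
      fun {p q} hpq => by
      simpa using pullBack_eq_of_same_pair hu heu hfu (hdesc hpq.symm) (hdesc hpq)
        (Or.inr ⟨rfl, rfl⟩)
    have hover : ∀ {p q r : Fin 4}, p ≠ q → p ≠ r → pullBack f (gH p q) u = pullBack f (gH p r) u :=
      fun {p q r} hpq hpr => by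
      by_cases hqr : q = r
      · rw [hqr]
      · exact pullBack_eq_of_overlap hu heu hfu hut hu3 hu5 hpq hpr hqr
    have hall : pullBack f (gH i' j') u = pullBack f (gH i j) u := by
      have hij := hd.1
      have hij' := hd'.1
      by_cases hji : j' = i
      · subst hji
        rw [hswap hij']; exact hover hij'.symm hij
      · rw [hswap hij', hover hij'.symm hji, hswap hji]
        exact hover (Ne.symm hji) hij
    -- every descent of `v` factors through the normalized vector
    have hfactor : ∀ {p q : Fin 4} {l : ℕ}, IsDescent v p q l →
        pullBack f (gH p q * gW q ^ l) v = (diagW a)⁻¹ • pullBack f (gH p q) u := by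
      intro p q l hpql
      obtain ⟨μ, hμ, t, e⟩ := exists_monomial_mul_diagW hpql.1 a
      have hvt := hv.act_descent hpql.1 p.2 q.2 t
      have hlt : level (act (gH p q * gW q ^ t) v) < level v := by
        have h1 := (monomial_invariants (f := f) (ℓ := 0) hμ _ hvt).2.1
        rw [← act_mul, ← e, act_mul] at h1
        have h2 := (hdesc hpql.1).2
        rw [pow_zero, mul_one, hul] at h2
        rwa [← h1]
      rw [← pullBack_mul, e, pullBack_monomial_mul hf hμ hvt hlt]
      exact pullBack_eq_of_same_pair hv he hf ⟨hpql.1, hlt⟩ hpql (Or.inl ⟨rfl, rfl⟩)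
    rw [hfactor h, hfactor h', hall]

end Descent


/-! ### The equivariant map from unit vectors to cosets -/

theorem exists_isDescent {k : ℕ} {v : Fin 4 → ℂ} (hv : IsVec k v) (he : denExp v ≠ 0) :
    ∃ i j m, IsDescent v i j m := by
  have h1 := even_card_tops hv.1 he
  have h2 := (tops_nonempty he).card_pos
  rw [Nat.even_iff] at h1
  obtain ⟨i, hi, j, hj, hij⟩ := Finset.one_lt_card.1
    (show 1 < (tops v (denExp v)).card by omega)
  have hm := mem_filt_denExp hv.1.1
  obtain ⟨m, -, h⟩ := exists_sub_omega_pow_mul_mem_filt (hm i) (mem_tops.1 hi) (hm j) (mem_tops.1 hj)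
  exact ⟨i, j, m, (isDescent_iff hv.1.1 he).2 ⟨hij, hi, hj, h⟩⟩

open Classical in
/-- The coset of the elements of the presented group that map the standard basis vector `e_b` to the
given unit vector, modulo the standard subgroup below `b`. It is defined by following descents,
until the vector is a standard basis vector up to a power of `ω`. The last case is never needed. -/
def frame (b : Fin 4) (v : Fin 4 → ℂ) : Pres 4 ⧸ standard b.val :=
  if h : ∃ p : Fin 4 × ℕ, v = Pi.single p.1 (omega ^ p.2) then
    ((gW h.choose.1 ^ h.choose.2 * gX h.choose.1 b : Pres 4) : Pres 4 ⧸ standard b.val)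
  else if h : ∃ p : Fin 4 × Fin 4 × ℕ, IsDescent v p.1 p.2.1 p.2.2 then
    (gH h.choose.1 h.choose.2.1 * gW h.choose.2.1 ^ h.choose.2.2)⁻¹ •
      frame b (act (gH h.choose.1 h.choose.2.1 * gW h.choose.2.1 ^ h.choose.2.2) v)
  else ((1 : Pres 4) : Pres 4 ⧸ standard b.val)
  termination_by level v
  decreasing_by exact h.choose_spec.2

theorem orderOf_omega : orderOf omega = 8 := by
  refine orderOf_eq_prime_pow (p := 2) (n := 2) ?_ omega_pow_eight
  rw [show 2 ^ 2 = 4 by norm_num, omega_pow_four]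
  norm_num

theorem frame_single (b l : Fin 4) (a : ℕ) :
    frame b (Pi.single l (omega ^ a)) = ((gW l ^ a * gX l b : Pres 4) : Pres 4 ⧸ standard b.val) := by
  have h : ∃ p : Fin 4 × ℕ,
      (Pi.single l (omega ^ a) : Fin 4 → ℂ) = Pi.single p.1 (omega ^ p.2) := ⟨(l, a), rfl⟩
  rw [frame, dif_pos h]
  have hs := h.choose_spec
  generalize h.choose = p at hs
  have hl : p.1 = l := by
    by_contra hne
    have := congrFun hs l
    rw [Pi.single_eq_same, Pi.single_eq_of_ne (Ne.symm hne)] at this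
    exact pow_ne_zero _ omega_ne_zero this
  rw [hl] at hs ⊢
  have ha := Pi.single_injective l hs
  have ha' : gW l ^ a = gW l ^ p.2 := by
    have hprim : IsPrimitiveRoot omega 8 := orderOf_omega ▸ IsPrimitiveRoot.orderOf omega
    rw [← pow_mod_orderOf omega a, ← pow_mod_orderOf omega p.2, orderOf_omega] at ha
    replace ha := hprim.pow_inj (Nat.mod_lt _ (by norm_num)) (Nat.mod_lt _ (by norm_num)) ha
    rw [← Nat.div_add_mod a 8, ← Nat.div_add_mod p.2 8, pow_add, pow_add, pow_mul, pow_mul,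
      gW_pow_eight, one_pow, one_pow, ha]
  rw [ha']

theorem denExp_single (l : Fin 4) (a : ℕ) : denExp (Pi.single l (omega ^ a)) = 0 := by
  refine Nat.le_zero.1 (denExp_le fun i => ?_)
  rw [Nat.cast_zero, neg_zero, mem_filt_zero]
  by_cases h : i = l
  · subst h; rw [Pi.single_eq_same]; exact pow_mem omega_mem_ZOmega a
  · rw [Pi.single_eq_of_ne h]; exact zero_mem _

theorem frame_eq_pullBack {b : Fin 4} {v : Fin 4 → ℂ} (hv : IsVec (b.val + 1) v)
    (he : denExp v ≠ 0) (hf : EquivariantBelow (frame b) (b.val + 1) (level v)) {i j : Fin 4} {m : ℕ}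
    (h : IsDescent v i j m) : frame b v = pullBack (frame b) (gH i j * gW j ^ m) v := by
  have h1 : ¬ ∃ p : Fin 4 × ℕ, v = Pi.single p.1 (omega ^ p.2) := by
    rintro ⟨p, rfl⟩
    exact he (denExp_single _ _)
  have h2 : ∃ p : Fin 4 × Fin 4 × ℕ, IsDescent v p.1 p.2.1 p.2.2 := ⟨(i, j, m), h⟩
  rw [frame, dif_neg h1, dif_pos h2]
  exact pullBack_eq_of_isDescent hv (by omega) he hf h h2.choose_spec

/-- Vectors of denominator exponent zero are standard basis vectors up to powers of `ω`. -/
theorem IsVec.eq_single {k : ℕ} {v : Fin 4 → ℂ} (hv : IsVec k v) (he : denExp v = 0) :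
    ∃ (l : Fin 4) (a : ℕ), l.val < k ∧ v = Pi.single l (omega ^ a) := by
  obtain ⟨l, a, rfl⟩ := eq_single_of_denExp_eq_zero hv.1 he
  refine ⟨l, a, ?_, rfl⟩
  by_contra h
  have := hv.2 l (by omega)
  rw [Pi.single_eq_same] at this
  exact pow_ne_zero _ omega_ne_zero this

theorem swap_val_lt {b l i : Fin 4} (hl : l.val < b.val + 1) (hi : i.val < b.val + 1) (hil : i ≠ l) :
    (Equiv.swap l b i).val < b.val := by
  rw [Equiv.swap_apply_def]; split_ifs <;> omega

theorem frame_act_gW_of_single {b : Fin 4} {i l : Fin 4} (hi : i.val < b.val + 1)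
    (hl : l.val < b.val + 1) (a : ℕ) : frame b (act (gW i) (Pi.single l (omega ^ a)))
      = gW i • frame b (Pi.single l (omega ^ a)) := by
  rw [act_gW, frame_single]
  by_cases hil : i = l
  · subst hil
    have : opW i (Pi.single i (omega ^ a)) = Pi.single i (omega ^ (a + 1)) := by
      funext j
      by_cases hj : j = i
      · subst hj; simp [opW, pow_succ']
      · simp [opW, hj]
    rw [this, frame_single, MulAction.Quotient.smul_mk, smul_eq_mul, ← mul_assoc, pow_succ']
  · have : opW i (Pi.single l (omega ^ a)) = Pi.single l (omega ^ a) := by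
      funext j
      by_cases hj : j = i
      · subst hj; simp [opW, hil]
      · simp [opW, hj]
    rw [this, frame_single, MulAction.Quotient.smul_mk, smul_eq_mul, QuotientGroup.eq]
    have hc : Commute (gW i) (gW l ^ a) := (show Commute (gW i) (gW l) from gW_comm i l).pow_right a
    rw [← mul_assoc (gW i), hc.eq, mul_inv_rev, mul_assoc, mul_assoc (gW l ^ a), inv_mul_cancel_left, gX_inv,
      ← mul_assoc, ← conjX_apply, conjX_gW]
    exact Subgroup.subset_closure (.W _ (swap_val_lt hl hi hil))

theorem frame_act_gX_of_single {b : Fin 4} {i j l : Fin 4} (hi : i.val < b.val + 1)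
    (hj : j.val < b.val + 1) (hl : l.val < b.val + 1) (a : ℕ) :
    frame b (act (gX i j) (Pi.single l (omega ^ a)))
      = gX i j • frame b (Pi.single l (omega ^ a)) := by
  have hop : opX i j (Pi.single l (omega ^ a)) = Pi.single (Equiv.swap i j l) (omega ^ a) := by
    funext t
    rw [opX]
    by_cases ht : t = Equiv.swap i j l
    · subst ht; simp
    · rw [Pi.single_eq_of_ne ht, Pi.single_eq_of_ne]
      rintro rfl; simp at ht
  rw [act_gX, hop, frame_single, frame_single, MulAction.Quotient.smul_mk, smul_eq_mul,
    QuotientGroup.eq]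
  have hW : gX i j * (gW l ^ a * gX l b) = gW (Equiv.swap i j l) ^ a * (gX i j * gX l b) := by
    rw [← conjX_gW, ← map_pow, conjX_apply]
    simp only [mul_assoc, gX_mul_cancel]
  rw [hW, mul_inv_rev, mul_assoc, inv_mul_cancel_left, gX_inv]
  have key : ∀ {l j : Fin 4}, l.val < b.val + 1 → j.val < b.val + 1 →
      gX j b * (gX l j * gX l b) ∈ standard b.val := fun {l j} hl hj => by
    by_cases hlj : l = j
    · subst hlj; rw [gX_self, one_mul, gX_mul_self]; exact one_mem _
    by_cases hjb : j = b
    · subst hjb; rw [gX_self, one_mul, gX_mul_self]; exact one_mem _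
    by_cases hlb : l = b
    · subst hlb; rw [gX_self, mul_one, gX_comm, gX_mul_self]; exact one_mem _
    have h := conjX_gX_of_ne hlj hlb hjb
    rw [conjX_eq_iff] at h
    rw [h, gX_mul_cancel]
    exact Subgroup.subset_closure (.X _ _ (by omega) (by omega))
  by_cases hli : l = i
  · subst hli; rw [Equiv.swap_apply_left]; exact key hl hj
  by_cases hlj : l = j
  · subst hlj; rw [Equiv.swap_apply_right, gX_comm i l]; exact key hl hi
  rw [Equiv.swap_apply_of_ne_of_ne hli hlj, ← mul_assoc, ← conjX_apply, conjX_gX]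
  exact Subgroup.subset_closure
    (.X _ _ (swap_val_lt hl hi (Ne.symm hli)) (swap_val_lt hl hj (Ne.symm hlj)))

theorem frame_act_gH_of_single {b : Fin 4} {i j l : Fin 4} (hij : i ≠ j) (hi : i.val < b.val + 1)
    (hj : j.val < b.val + 1) (hl : l.val < b.val + 1) (hli : l ≠ i) (hlj : l ≠ j) (a : ℕ) :
    frame b (act (gH i j) (Pi.single l (omega ^ a)))
      = gH i j • frame b (Pi.single l (omega ^ a)) := by
  have hop : opH i j (Pi.single l (omega ^ a)) = Pi.single l (omega ^ a) := by
    funext t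
    simp only [opH, Pi.single_eq_of_ne hli.symm, Pi.single_eq_of_ne hlj.symm]
    split_ifs with h1 h2
    · subst h1; simp [hli.symm]
    · subst h2; simp [hlj.symm]
    · rfl
  rw [act_gH hij, hop, frame_single, MulAction.Quotient.smul_mk, smul_eq_mul, QuotientGroup.eq,
    ← mul_assoc (gH i j), ((gH_gW_comm hij hli hlj).pow_right a).eq, mul_inv_rev,
    mul_assoc, mul_assoc (gW l ^ a),
    inv_mul_cancel_left, gX_inv, ← mul_assoc, ← conjX_apply, conjX_gH]
  exact Subgroup.subset_closure (.H _ _ ((Equiv.injective _).ne hij)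
    (swap_val_lt hl hi hli.symm) (swap_val_lt hl hj hlj.symm))

/-- If `g` preserves the level and carries a descent of `v` to a descent of `act g v`, up to a
monomial element, then `frame` is equivariant under `g` at `v`. -/
theorem frame_act_of_conj {b : Fin 4} {v : Fin 4 → ℂ} (hv : IsVec (b.val + 1) v)
    (he : denExp v ≠ 0) (hf : EquivariantBelow (frame b) (b.val + 1) (level v)) {g : Pres 4}
    (hv' : IsVec (b.val + 1) (act g v)) (hl : level (act g v) = level v) {i j i' j' : Fin 4}
    {m m' : ℕ} (h : IsDescent v i j m) (hij' : i' ≠ j') (hi' : i'.val < b.val + 1)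
    (hj' : j'.val < b.val + 1) {μ : Pres 4} (hμ : μ ∈ monomial (b.val + 1))
    (e : gH i j * gW j ^ m * g⁻¹ = μ * (gH i' j' * gW j' ^ m')) :
    frame b (act g v) = g • frame b v := by
  have hd := hv'.act_descent hij' hi' hj' m'
  have he' : denExp (act g v) ≠ 0 := by
    rwa [← five_le_level_iff, hl, five_le_level_iff]
  have hlt : level (act (gH i' j' * gW j' ^ m') (act g v)) < level (act g v) := by
    have h1 := (monomial_invariants (f := frame b) (ℓ := 0) hμ _ hd).2.1
    rw [← act_mul, ← e, act_mul, act_inv_act] at h1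
    rw [← h1, hl]; exact h.2
  rw [frame_eq_pullBack hv' he' (by rwa [hl]) ⟨hij', hlt⟩,
    ← pullBack_monomial_mul (by rwa [hl]) hμ hd hlt, ← e, pullBack_mul, inv_inv, act_inv_act,
    ← frame_eq_pullBack hv he hf h]

theorem frame_act_gW {b : Fin 4} {v : Fin 4 → ℂ} (hv : IsVec (b.val + 1) v)
    (hf : EquivariantBelow (frame b) (b.val + 1) (level v)) {l : Fin 4} (hl : l.val < b.val + 1) :
    frame b (act (gW l) v) = gW l • frame b v := by
  by_cases he : denExp v = 0
  · obtain ⟨i, a, hi, rfl⟩ := hv.eq_single he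
    exact frame_act_gW_of_single hl hi a
  obtain ⟨i, j, m, h⟩ := exists_isDescent hv he
  have hd := (isDescent_iff hv.1.1 he).1 h
  have hi := hv.lt_of_mem_tops hd.2.1
  have hj := hv.lt_of_mem_tops hd.2.2.1
  obtain ⟨μ, hμ, m', e⟩ := exists_monomial_mul_gW_pow hd.1 hi hj hl m 7
  have hinv : (gW l)⁻¹ = gW l ^ 7 := inv_eq_of_mul_eq_one_left (by rw [← pow_succ, gW_pow_eight])
  exact frame_act_of_conj hv he hf (hv.act_of_isGen (.W l hl)) (by rw [act_gW, level_opW]) h hd.1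
    hi hj hμ (by rw [hinv, e])

theorem frame_act_gX {b : Fin 4} {v : Fin 4 → ℂ} (hv : IsVec (b.val + 1) v)
    (hf : EquivariantBelow (frame b) (b.val + 1) (level v)) {s t : Fin 4} (hs : s.val < b.val + 1)
    (ht : t.val < b.val + 1) : frame b (act (gX s t) v) = gX s t • frame b v := by
  by_cases he : denExp v = 0
  · obtain ⟨i, a, hi, rfl⟩ := hv.eq_single he
    exact frame_act_gX_of_single hs ht hi a
  obtain ⟨i, j, m, h⟩ := exists_isDescent hv he
  have hd := (isDescent_iff hv.1.1 he).1 h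
  have hi := hv.lt_of_mem_tops hd.2.1
  have hj := hv.lt_of_mem_tops hd.2.2.1
  have hlt : ∀ {i : Fin 4}, i.val < b.val + 1 → (Equiv.swap s t i).val < b.val + 1 := by
    intro i hi
    rw [Equiv.swap_apply_def]; split_ifs <;> assumption
  refine frame_act_of_conj hv he hf (hv.act_of_isGen (.X s t hs ht)) (by rw [act_gX, level_opX]) h
    ((Equiv.injective (Equiv.swap s t)).ne hd.1) (hlt hi) (hlt hj) (gX_mem_monomial hs ht)
    (m' := m) ?_
  rw [← conjX_gH, ← conjX_gW, ← map_pow, ← map_mul, conjX_apply, gX_inv]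
  simp only [mul_assoc, gX_mul_cancel]

/-- Equivariance under `H_[i,j]`, if it does not raise the level. -/
theorem frame_act_gH_of_level_le {b : Fin 4} {v : Fin 4 → ℂ} (hv : IsVec (b.val + 1) v)
    (hf : EquivariantBelow (frame b) (b.val + 1) (level v)) {i j : Fin 4} (hij : i ≠ j)
    (hi : i.val < b.val + 1) (hj : j.val < b.val + 1) (hle : level (act (gH i j) v) ≤ level v) :
    frame b (act (gH i j) v) = gH i j • frame b v := by
  have hv' := hv.act_of_isGen (.H i j hij hi hj)
  obtain ⟨h1, h2⟩ := mem_filt_of_level_opH_le hv.1.1 hij (by rwa [act_gH hij] at hle)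
  by_cases he : denExp v = 0
  · obtain ⟨l, a, hl, rfl⟩ := hv.eq_single he
    have hu : ∀ r : ℤ, 1 ≤ r → omega ^ a ∉ filt r := fun r hr h => by
      rw [← mul_one (omega ^ a), omega_pow_mul_mem_filt] at h
      exact one_notMem_filt_one (filt_anti hr h)
    rw [he] at h1
    refine frame_act_gH_of_single hij hi hj hl ?_ ?_ a
    · rintro rfl
      rw [Pi.single_eq_same, Pi.single_eq_of_ne hij.symm, add_zero] at h1
      exact hu _ (by norm_num) h1
    · rintro rfl
      rw [Pi.single_eq_same, Pi.single_eq_of_ne hij, zero_add] at h1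
      exact hu _ (by norm_num) h1
  have hm := mem_filt_denExp hv.1.1
  by_cases hit : i ∈ tops v (denExp v)
  · have hjt : j ∈ tops v (denExp v) := by
      rw [mem_tops] at hit ⊢
      intro hj
      exact hit (by simpa using add_mem (filt_anti (by omega) h2) hj)
    obtain ⟨m, hm4, hm3⟩ :=
      exists_sub_omega_pow_mul_mem_filt (hm i) (mem_tops.1 hit) (hm j) (mem_tops.1 hjt)
    have hd : IsDescent v i j m := (isDescent_iff hv.1.1 he).2 ⟨hij, hit, hjt, hm3⟩
    have heven : Even m := by
      refine even_of_mem_filt (hm j) (mem_tops.1 hjt) ?_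
      have := sub_mem h2 (filt_anti (r := -(denExp v) + 2) (by omega) hm3)
      convert this using 1; ring
    obtain rfl | rfl : m = 0 ∨ m = 2 := by rw [Nat.even_iff] at heven; omega
    · have := frame_eq_pullBack hv he hf hd
      rw [pow_zero, mul_one, pullBack] at this
      rw [this, smul_inv_smul]
    · -- the triangle of `v`, `H v` and their common descent
      set μ := gW i ^ 6 * (gW i * gW j) ^ 3 with hμdef
      have hμ : μ ∈ monomial (b.val + 1) := mul_mem (pow_mem (gW_mem_monomial hi) _)
        (pow_mem (mul_mem (gW_mem_monomial hi) (gW_mem_monomial hj)) _)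
      have e : gH i j * gW i ^ 2 * gH i j = μ * (gH i j * gW j ^ 2) := by
        have h26 : gW j ^ (7 * 3) * gW j ^ 5 = gW j ^ 2 := by
          rw [← pow_add, show 7 * 3 + 5 = 8 * 3 + 2 by norm_num, pow_add, pow_mul, gW_pow_eight,
            one_pow, one_mul]
        rw [gH_mul_gW_sq_mul_gH hij, mul_assoc (gW i ^ 6), gH_mul_gW_left hij, hμdef, ← h26]
        simp only [mul_assoc]
      have hdv := hv.act_descent hij hi hj 2
      have hlow : level (act (gH i j * gW i ^ 2) (act (gH i j) v)) < level v := by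
        rw [← act_mul, e, act_mul, (monomial_invariants (f := frame b) (ℓ := 0) hμ _ hdv).2.1]
        exact hd.2
      have key : frame b (act (gH i j) v)
          = pullBack (frame b) (gH i j * gW i ^ 2) (act (gH i j) v) := by
        rcases hle.lt_or_eq with hlt | heq
        · have hmono := monomial_invariants (f := frame b) (ℓ := level v)
            (pow_mem (gW_mem_monomial hi) 2) _ hv'
          rw [act_mul] at hlow
          rw [pullBack, act_mul, hf _ hmono.1 (by rwa [hmono.2.1]) _ (.H i j hij hi hj) hlow,
            hmono.2.2 hf hlt, smul_smul, smul_smul, mul_assoc, inv_mul_cancel, one_smul]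
        · have e2 := gH_mul_gW_left hij 2
          have hdv' := hv'.act_descent hij hi hj (7 * 2)
          have hμ2 : (gW i * gW j) ^ 2 ∈ monomial (b.val + 1) :=
            pow_mem (mul_mem (gW_mem_monomial hi) (gW_mem_monomial hj)) _
          have hlt : level (act (gH i j * gW j ^ (7 * 2)) (act (gH i j) v))
              < level (act (gH i j) v) := by
            rwa [e2, act_mul, (monomial_invariants (f := frame b) (ℓ := 0) hμ2 _ hdv').2.1,
              ← heq] at hlow
          have he' : denExp (act (gH i j) v) ≠ 0 := by
            rwa [← five_le_level_iff, heq, five_le_level_iff]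
          rw [e2, pullBack_monomial_mul (by rwa [heq]) hμ2 hdv' hlt]
          exact frame_eq_pullBack hv' he' (by rwa [heq]) ⟨hij, hlt⟩
      have h3 := pullBack_mul (frame b) (gH i j * gW i ^ 2) (gH i j) v
      rw [e, pullBack_monomial_mul hf hμ hdv hd.2, ← frame_eq_pullBack hv he hf hd, ← key] at h3
      rw [h3, smul_inv_smul]
  · have hjt : j ∉ tops v (denExp v) := by
      rw [mem_tops, not_not] at hit ⊢
      simpa using sub_mem hit (filt_anti (by omega) h2)
    obtain ⟨hl, hexp, hsub⟩ := opH_of_notMem_tops hv.1.1 he hij hit hjt (by rwa [act_gH hij] at hle)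
    rw [← act_gH hij] at hl hexp hsub
    obtain ⟨p, q, m, hd⟩ := exists_isDescent hv he
    obtain ⟨hpq, hp, hq, hpqm⟩ := (isDescent_iff hv.1.1 he).1 hd
    have hpi : p ≠ i := fun h => hit (h ▸ hp)
    have hpj : p ≠ j := fun h => hjt (h ▸ hp)
    have hqi : q ≠ i := fun h => hit (h ▸ hq)
    have hqj : q ≠ j := fun h => hjt (h ▸ hq)
    have he' : denExp (act (gH i j) v) ≠ 0 := by rwa [hexp]
    have hd' : IsDescent (act (gH i j) v) p q m := by
      rw [isDescent_iff hv'.1.1 he', hexp]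
      refine ⟨hpq, hsub hp, hsub hq, ?_⟩
      rwa [act_gH hij, opH_other hpi hpj, opH_other hqi hqj]
    have hc : Commute (gH p q * gW q ^ m) (gH i j) :=
      (gH_gH_comm hpq hij hpi.symm hqi.symm hpj.symm hqj.symm).mul_left
        ((gH_gW_comm hij hqi hqj).symm.pow_left m)
    have hlow : level (act (gH i j) (act (gH p q * gW q ^ m) v)) < level v := by
      rw [← act_mul, ← hc.eq, act_mul, ← hl]; exact hd'.2
    have h3 := pullBack_mul (frame b) (gH p q * gW q ^ m) (gH i j) v
    rw [← frame_eq_pullBack hv' he' (by rwa [hl]) hd', hc.eq, pullBack_mul, pullBack,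
      hf _ (hv.act_descent hpq (hv.lt_of_mem_tops hp) (hv.lt_of_mem_tops hq) m) hd.2 _
        (.H i j hij hi hj) hlow, inv_smul_smul] at h3
    rw [frame_eq_pullBack hv he hf hd, pullBack, h3, smul_inv_smul]

/-- The map `frame` commutes with the generators. -/
theorem equivariantBelow_frame (b : Fin 4) (ℓ : ℕ) :
    EquivariantBelow (frame b) (b.val + 1) ℓ := by
  induction ℓ with
  | zero => intro v hv hl; omega
  | succ ℓ ih =>
    intro v hv hl g hg hl'
    have mono : ∀ {w : Fin 4 → ℂ}, level w < ℓ + 1 →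
        EquivariantBelow (frame b) (b.val + 1) (level w) := fun hw u hu h1 g hg h2 =>
      ih u hu (by omega) g hg (by omega)
    cases hg with
    | W i hi => exact frame_act_gW hv (mono hl) hi
    | X i j hi hj => exact frame_act_gX hv (mono hl) hi hj
    | H i j hij hi hj =>
      rcases le_total (level (act (gH i j) v)) (level v) with h | h
      · exact frame_act_gH_of_level_le hv (mono hl) hij hi hj h
      · have hback : act (gH i j) (act (gH i j) v) = v := by
          rw [← act_mul, gH_mul_self, act_one]
        have := frame_act_gH_of_level_le (hv.act_of_isGen (.H i j hij hi hj)) (mono hl') hij hi hj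
          (by rwa [hback])
        rw [hback] at this
        rw [this, smul_smul, gH_mul_self, one_smul]

theorem frame_act {b : Fin 4} {g : Pres 4} (hg : g ∈ standard (b.val + 1)) :
    ∀ v, IsVec (b.val + 1) v → IsVec (b.val + 1) (act g v) ∧ frame b (act g v) = g • frame b v := by
  refine closure_induction_of_inv_eq_pow (p := fun g => ∀ v, IsVec (b.val + 1) v →
    IsVec (b.val + 1) (act g v) ∧ frame b (act g v) = g • frame b v) (fun x hx => IsGen.inv_eq_pow hx) (fun x hx v hv => ?_)
    (fun v hv => ?_) (fun x y hx hy v hv => ?_) hg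
  · refine ⟨hv.act_of_isGen hx, ?_⟩
    exact equivariantBelow_frame b (level v + level (act x v) + 1) _ hv (by omega) x hx (by omega)
  · rw [act_one]; exact ⟨hv, (one_smul _ _).symm⟩
  · obtain ⟨h1, h2⟩ := hy v hv
    rw [act_mul, mul_smul, ← h2]
    exact hx _ h1


/-! ### Faithfulness and surjectivity of the representation -/

section Faithful

open Matrix

theorem isVec_single {k : ℕ} {b : Fin 4} (hb : b.val < k) : IsVec k (Pi.single b 1) := by
  refine ⟨⟨⟨0, fun i => ?_⟩, ?_⟩, fun l hl => ?_⟩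
  · rw [Nat.cast_zero, neg_zero, mem_filt_zero]
    by_cases h : i = b
    · subst h; rw [Pi.single_eq_same]; exact one_mem _
    · rw [Pi.single_eq_of_ne h]; exact zero_mem _
  · rw [Finset.sum_eq_single b]
    · simp
    · intro i _ hi; simp [hi]
    · simp
  · exact Pi.single_eq_of_ne (by rintro rfl; omega) _

/-- The stabilizer of the basis vector `e_b` in a standard subgroup is the previous one. -/
theorem mem_standard_of_act_single {b : Fin 4} {g : Pres 4} (hg : g ∈ standard (b.val + 1))
    (h : act g (Pi.single b 1) = Pi.single b 1) : g ∈ standard b.val := by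
  have h1 := (frame_act hg _ (isVec_single (Nat.lt_succ_self _))).2
  have h2 := frame_single b b 0
  rw [pow_zero, pow_zero, one_mul, gX_self] at h2
  rw [h, h2, MulAction.Quotient.smul_mk, smul_eq_mul, mul_one, QuotientGroup.eq, inv_one,
    one_mul] at h1
  exact h1

theorem rep_injective : Function.Injective (rep (n := 4)) := by
  rw [injective_iff_map_eq_one]
  intro g hg
  have hact : ∀ v, act g v = v := fun v => by rw [act, hg, map_one, one_mulVec]
  have h4 : g ∈ standard 4 := by rw [standard_four]; exact Subgroup.mem_top g
  have h3 := mem_standard_of_act_single (b := 3) h4 (hact _)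
  have h2 := mem_standard_of_act_single (b := 2) h3 (hact _)
  have h1 := mem_standard_of_act_single (b := 1) h2 (hact _)
  have h0 := mem_standard_of_act_single (b := 0) h1 (hact _)
  rw [Fin.val_zero, standard_zero] at h0
  exact Subgroup.mem_bot.1 h0

/-- Every unit vector can be moved to a standard basis vector, by following descents. -/
theorem exists_act_eq_single (b : Fin 4) {v : Fin 4 → ℂ} (hv : IsVec (b.val + 1) v) :
    ∃ g ∈ standard (b.val + 1), act g v = Pi.single b 1 := by
  induction hn : level v using Nat.strong_induction_on generalizing v with
  | _ ℓ ih =>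
  by_cases he : denExp v = 0
  · obtain ⟨l, a, hl, rfl⟩ := hv.eq_single he
    have h : act (gW l ^ a * gX l b) (Pi.single b 1) = Pi.single l (omega ^ a) := by
      rw [act_mul, act_gW_pow, opW_iterate, act_gX]
      funext t
      by_cases ht : t = l
      · subst ht; simp [opX]
      · rw [if_neg ht, opX, Pi.single_eq_of_ne ht, Pi.single_eq_of_ne]
        exact fun h => ht ((Equiv.swap l b).injective (h.trans (Equiv.swap_apply_left l b).symm))
    refine ⟨(gW l ^ a * gX l b)⁻¹, inv_mem (mul_mem (pow_mem ?_ a) ?_), by rw [← h, act_inv_act]⟩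
    · exact Subgroup.subset_closure (.W l hl)
    · exact Subgroup.subset_closure (.X l b hl (Nat.lt_succ_self _))
  · obtain ⟨i, j, m, hd⟩ := exists_isDescent hv he
    have hd' := (isDescent_iff hv.1.1 he).1 hd
    have hi := hv.lt_of_mem_tops hd'.2.1
    have hj := hv.lt_of_mem_tops hd'.2.2.1
    obtain ⟨g, hg, h⟩ := ih _ (hn ▸ hd.2) (hv.act_descent hd.1 hi hj m) rfl
    refine ⟨g * (gH i j * gW j ^ m), mul_mem hg (mul_mem ?_ (pow_mem ?_ m)), by rw [act_mul, h]⟩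
    · exact Subgroup.subset_closure (.H i j hd.1 hi hj)
    · exact Subgroup.subset_closure (.W j hj)

theorem act_single_of_mem_standard {k : ℕ} {g : Pres 4} (hg : g ∈ standard k) {l : Fin 4}
    (hl : k ≤ l.val) : act g (Pi.single l 1) = Pi.single l 1 := by
  refine closure_induction_of_inv_eq_pow (p := fun g => act g (Pi.single l 1) = Pi.single l 1)
    (fun x hx => IsGen.inv_eq_pow hx) (fun x hx => ?_) (act_one _) (fun x y hx hy => ?_) hg
  · have hne : ∀ {i : Fin 4}, i.val < k → i ≠ l := by rintro i hi rfl; omega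
    cases hx with
    | W i hi =>
      rw [act_gW]; funext t
      by_cases ht : t = i
      · subst ht; simp [opW, hne hi]
      · simp [opW, ht]
    | X i j hi hj =>
      rw [act_gX]; funext t
      rw [opX, ← Equiv.swap_apply_of_ne_of_ne (hne hi).symm (hne hj).symm]
      by_cases ht : t = l
      · subst ht; simp [Equiv.swap_apply_of_ne_of_ne (hne hi).symm (hne hj).symm]
      · rw [Equiv.swap_apply_of_ne_of_ne (hne hi).symm (hne hj).symm, Pi.single_eq_of_ne ht,
          Pi.single_eq_of_ne]
        intro h
        rw [← Equiv.swap_apply_of_ne_of_ne (hne hi).symm (hne hj).symm] at h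
        exact ht (Equiv.injective _ h)
    | H i j hij hi hj =>
      rw [act_gH hij]; funext t
      simp only [opH, Pi.single_eq_of_ne (hne hi), Pi.single_eq_of_ne (hne hj)]
      split_ifs with h1 h2
      · subst h1; simp [hne hi]
      · subst h2; simp [hne hj]
      · rfl
  · rw [act_mul, hy, hx]

/-- The last `k` columns of a matrix in `U 4` can be reduced to those of the identity. -/
theorem exists_rep_mul_fixes (N : U 4) (k : ℕ) (hk : k ≤ 4) :
    ∃ g : Pres 4, ∀ l : Fin 4, 4 - k ≤ l.val →
      matrixHom (rep g * N) *ᵥ Pi.single l 1 = Pi.single l 1 := by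
  induction k with
  | zero => exact ⟨1, fun l hl => by omega⟩
  | succ k ih =>
    obtain ⟨g, hg⟩ := ih (by omega)
    set b : Fin 4 := ⟨4 - (k + 1), by omega⟩ with hb
    have hb1 : b.val + 1 = 4 - k := by rw [hb]; simp only; omega
    set v := matrixHom (rep g * N) *ᵥ Pi.single b 1 with hv
    have hvec : IsVec (b.val + 1) v := by
      refine ⟨⟨?_, ?_⟩, fun l hl => ?_⟩
      · have hD : ∀ i, ∃ e : ℕ, v i ∈ filt (-e) := fun i => by
          rw [hv, mulVec_single_one]
          exact exists_mem_filt_of_mem_DOmega ((rep g * N).2 i b)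
        choose e he using hD
        refine ⟨∑ i, e i, fun i => filt_anti ?_ (he i)⟩
        have := Finset.single_le_sum (f := e) (fun _ _ => Nat.zero_le _) (Finset.mem_univ i)
        omega
      · rw [hv, sum_mulVec_mul_star]; exact (isVec_single (Nat.lt_succ_self b.val)).1.2
      · -- the columns of a unitary matrix are orthogonal
        have h := star_mulVec_dotProduct_mulVec (rep g * N) (Pi.single l 1) (Pi.single b 1)
        rw [hg l (by omega), ← hv] at h
        have hlb : l ≠ b := by rintro rfl; omega
        have hs : star (Pi.single l 1 : Fin 4 → ℂ) = Pi.single l 1 := by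
          funext t
          by_cases ht : t = l
          · subst ht; simp
          · simp [ht]
        rwa [hs, single_one_dotProduct, single_one_dotProduct, Pi.single_eq_of_ne hlb] at h
    obtain ⟨p, hp, hpv⟩ := exists_act_eq_single b hvec
    refine ⟨p * g, fun l hl => ?_⟩
    have hmul : matrixHom (rep (p * g) * N) *ᵥ Pi.single l 1
        = act p (matrixHom (rep g * N) *ᵥ Pi.single l 1) := by
      rw [act, mulVec_mulVec, ← map_mul, map_mul rep, mul_assoc]
    rw [hmul]
    by_cases hlb : l = b
    · rw [hlb, ← hv, hpv]
    · have : l.val ≠ b.val := fun h => hlb (Fin.ext h)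
      have hbv : b.val = 4 - (k + 1) := rfl
      rw [hg l (by omega), act_single_of_mem_standard hp (by omega)]

theorem rep_surjective : Function.Surjective (rep (n := 4)) := by
  intro N
  obtain ⟨g, hg⟩ := exists_rep_mul_fixes N 4 le_rfl
  have h1 : rep g * N = 1 := by
    apply matrixHom_injective
    rw [map_one]
    refine ext_of_mulVec_single fun l => ?_
    rw [hg l (by omega), one_mulVec]
  exact ⟨g⁻¹, by rw [map_inv]; exact inv_eq_of_mul_eq_one_right h1⟩

end Faithful

/-! ### Words -/

theorem matrixHom_rep_toPres {n : ℕ} (w : Word n) : matrixHom (rep (Word.toPres w)) = Word.eval w := by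
  have : (matrixHom.comp rep).comp Word.toPres = Word.eval (n := n) := FreeMonoid.hom_eq fun g => by
    simp [Word.eval, Word.toPres, rep_of]; rfl
  rw [← this]; rfl

theorem toPres_surjective : Function.Surjective (Word.toPres (n := 4)) := by
  intro g
  have hg : g ∈ Subgroup.closure (Set.range (PresentedGroup.of (rels := relators 4))) := by
    rw [PresentedGroup.closure_range_of]; exact Subgroup.mem_top g
  refine closure_induction_of_inv_eq_pow (p := fun g => ∃ w, Word.toPres w = g) ?_ ?_ ⟨1, map_one _⟩
    ?_ hg
  · rintro _ ⟨s, rfl⟩; exact (isGen_of s).inv_eq_pow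
  · rintro _ ⟨s, rfl⟩; exact ⟨FreeMonoid.of s, by simp [Word.toPres]⟩
  · rintro _ _ ⟨u, rfl⟩ ⟨v, rfl⟩; exact ⟨u * v, map_mul _ _ _⟩

theorem isUnit_of {n : ℕ} (g : Gen n) :
    IsUnit ((FreeMonoid.of g : Word n) : (conGen (Rel n)).Quotient) := by
  have key : ∀ (w : Word n) (m : ℕ), m ≠ 0 → Rel n (w ^ m) 1 →
      IsUnit (w : (conGen (Rel n)).Quotient) := fun w m hm h => by
    refine IsUnit.of_pow_eq_one (n := m) ?_ hm
    rw [← Con.coe_mk', ← map_pow, ← map_one (conGen (Rel n)).mk']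
    exact (Con.eq _).2 (ConGen.Rel.of _ _ h)
  cases g with
  | X j k h => exact key _ 2 (by norm_num) (Rel.X_order j k h)
  | H j k h => exact key _ 2 (by norm_num) (Rel.H_order j k h)
  | W j => exact key _ 8 (by norm_num) (Rel.W_order j)

/-- Since the generators have finite order, the monoid presentation and the group presentation
define the same object. -/
theorem eqEquiv_of_toPres_eq {n : ℕ} {u v : Word n} (h : Word.toPres u = Word.toPres v) :
    EqEquiv u v := by
  set F : Gen n → ((conGen (Rel n)).Quotient)ˣ := fun g => (isUnit_of g).unit with hF
  have hlift : ∀ w : Word n, ((FreeGroup.lift F (FreeMonoid.lift FreeGroup.of w) :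
      ((conGen (Rel n)).Quotient)ˣ) : (conGen (Rel n)).Quotient) = (w : (conGen (Rel n)).Quotient) := by
    intro w
    have : ((Units.coeHom _).comp (FreeGroup.lift F)).comp (FreeMonoid.lift FreeGroup.of)
        = (conGen (Rel n)).mk' := FreeMonoid.hom_eq fun g => by
      simp [hF]
    exact DFunLike.congr_fun this w
  have hrel : ∀ r ∈ relators n, FreeGroup.lift F r = 1 := by
    rintro _ ⟨u, v, huv, rfl⟩
    rw [map_mul, map_inv, mul_inv_eq_one]
    apply Units.ext
    rw [hlift, hlift, Con.eq]
    exact ConGen.Rel.of _ _ huv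
  have h2 := congrArg (PresentedGroup.toGroup hrel) h
  rw [Word.toPres_eq_mk, Word.toPres_eq_mk] at h2
  have h3 : FreeGroup.lift F (FreeMonoid.lift FreeGroup.of u)
      = FreeGroup.lift F (FreeMonoid.lift FreeGroup.of v) := h2
  have h4 := congrArg (Units.val) h3
  rw [hlift, hlift, Con.eq] at h4
  exact h4

end CliffordT

end

/-- Equational equivalence of words coincides with equality of the denoted matrices; the matrices
denoted by words are exactly those of `U_4(𝔻[ω])`; and the generators and relations present that
group. -/
theorem theorem3p1 :
    (∀ G G' : CliffordT.Word 4, CliffordT.EqEquiv G G' ↔ CliffordT.OpEquiv G G') ∧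
    (∀ M : Matrix (Fin 4) (Fin 4) ℂ,
      (∃ G : CliffordT.Word 4, CliffordT.Word.eval G = M) ↔
        M ∈ Matrix.unitaryGroup (Fin 4) ℂ ∧ ∀ i j, M i j ∈ CliffordT.DOmega) ∧
    ∃ e : PresentedGroup (CliffordT.relators 4) ≃* CliffordT.U 4,
      ∀ g : CliffordT.Gen 4,
        ((e (PresentedGroup.of g) : Matrix.unitaryGroup (Fin 4) ℂ) : Matrix (Fin 4) (Fin 4) ℂ) =
          g.toMatrix := by
  refine ⟨fun G G' => ⟨fun h => ?_, fun h => ?_⟩, fun M => ⟨?_, ?_⟩, ?_⟩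
  · have hle : conGen (CliffordT.Rel 4) ≤ Con.ker CliffordT.Word.eval :=
      Con.conGen_le.2 fun u v huv => CliffordT.eval_eq_of_rel huv
    exact hle h
  · refine CliffordT.eqEquiv_of_toPres_eq (CliffordT.rep_injective
      (CliffordT.matrixHom_injective ?_))
    rw [CliffordT.matrixHom_rep_toPres, CliffordT.matrixHom_rep_toPres]
    exact h
  · rintro ⟨G, rfl⟩
    rw [← CliffordT.matrixHom_rep_toPres]
    exact ⟨(CliffordT.rep (CliffordT.Word.toPres G)).1.2, (CliffordT.rep (CliffordT.Word.toPres G)).2⟩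
  · rintro ⟨hM, hD⟩
    obtain ⟨g, hg⟩ := CliffordT.rep_surjective ⟨⟨M, hM⟩, hD⟩
    obtain ⟨G, rfl⟩ := CliffordT.toPres_surjective g
    refine ⟨G, ?_⟩
    rw [← CliffordT.matrixHom_rep_toPres, hg]
    rfl
  · refine ⟨MulEquiv.ofBijective CliffordT.rep
      ⟨CliffordT.rep_injective, CliffordT.rep_surjective⟩, fun g => ?_⟩
    exact congrArg CliffordT.matrixHom (CliffordT.rep_of g)
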